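/- Let $\Omega=(0,1)^2$ with periodic boundary conditions, $\varepsilon>0$, $A\ge 0$, $a\le 0<T$, and let $m\ge 0$ be an integer. Let $u_e$ be a solution on $\Omega\times(a,T)$ of the no-slope-selection (NSS) equation $$\partial_t u=-\nabla\cdot\Bigl(\frac{\nabla u}{1+|\nabla u|^2}\Bigr)-\varepsilon^2\Delta^2u$$ of regularity class $$\mathcal R=H^4(a,T;C^0)\cap H^1(a,T;H^4)\cap H^3(a,T;H^{m+2})\cap L^\infty(a,T;H^{m+4})$$ ($a=0$ is the usual case; $a<0$ is only needed if the scheme is started from ghost points at negative times). For $N=2K+1$ and $h=1/N$ consider the grid points $(ih,jh)$, $0\le i,j\le N-1$. For a grid function $f_{i,j}=\sum_{k,l=-K}^{K}\hat f_{k,l}e^{2\pi \mathrm i(kih+ljh)}$ let $\mathcal D_{Nx}f,\mathcal D_{Ny}f$ be the collocation derivatives, obtained by multiplying $\hat f_{k,l}$ by $2\pi\mathrm i k$, $2\pi\mathrm i l$; let $\nabla_N f=(\mathcal D_{Nx}f,\mathcal D_{Ny}f)$, $\nabla_N\cdot(f_1,f_2)=\mathcal D_{Nx}f_1+\mathcal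 D_{Ny}f_2$, let $\Delta_N$ multiply $\hat f_{k,l}$ by $-4\pi^2(k^2+l^2)$, and let $\|f\|_2=(h^2\sum_{i,j}|f_{i,j}|^2)^{1/2}$. For a time step $\Delta t>0$ let $t^n=n\Delta t$, let $U^n$ be the grid values of the Fourier projection of $u_e(\cdot,t^n)$ onto the trigonometric polynomials of degree at most $K$ in each variable, and put $e^n=U^n-u^n$. Fix an integer $s\le 0$ (the index of the first time level) and a constant $C_0$. There are $C>0$, $\delta>0$, $h_0>0$, independent of $\Delta t$ and $h$, such that the following holds whenever $0<\Delta t\le\delta$, $h\le h_0$ and $s\Delta t\ge a$. Let the grid functions $(u^n)_{n\ge s}$ satisfy the third order BDF scheme $$\frac{\frac{11}{6}u^{n+1}-3u^n+\frac32u^{n-1}-\frac13u^{n-2}}{\Delta t}+\varepsilon^2\Delta_N^2u^{n+1}+\nabla_N\cdot\Bigl(3\tfrac{\nabla_Nu^n}{1+|\nabla_Nu^n|^2}-3\tfrac{\nabla_Nu^{n-1}}{1+|\nabla_Nu^{n-1}|^2}+\tfrac{\nabla_Nu^{n-2}}{1+|\nabla_Nu^{n-2}|^2}\Bigr)+A\Delta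 t^2\Delta_N^2(u^{n+1}-u^n)=0$$ for all $n\ge s+2$, with starting values that are exact ($u^j=U^j$ for $j=s,s+1,s+2$) or, more generally, satisfy $$\|e^j\|_2+\bigl(\varepsilon^2\Delta t\,\|\Delta_Ne^j\|_2^2\bigr)^{1/2}\le C_0(\Delta t^3+h^m),\qquad j=s,s+1,s+2 .$$ Then for all positive integers $\ell$ with $\ell\,\Delta t\le T$ $$\|e^\ell\|_2+\Bigl(\varepsilon^2\Delta t\sum_{j=1}^{\ell}\|\Delta_Ne^j\|_2^2\Bigr)^{1/2}\le C(\Delta t^3+h^m).$$ (The case $s=-2$ is the scheme with ghost points $u^{-2},u^{-1},u^0$; the case $s=0$ is the scheme with $u^1,u^2$ produced by another third order method.) -/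

import Mathlib

open MeasureTheory Set
open scoped ContDiff

noncomputable section

namespace NSS

/-! ### Periodic functions on the unit square -/

/-- The domain `Ω = (0,1)²` with periodic boundary conditions. -/
abbrev Torus : Type := UnitAddTorus (Fin 2)

/-- The Lebesgue measure of the periodic unit square (the measure used by Mathlib's `mFourierCoeff`). -/
def torusMeasure : Measure Torus := Measure.pi fun _ => AddCircle.haarAddCircle

/-- The Fourier coefficient `û(k) = ∫_Ω u(x) e^{-2πi k·x} dx`. -/
def fCoeff (f : C(Torus, ℝ)) (k : Fin 2 → ℤ) : ℂ :=
  UnitAddTorus.mFourierCoeff (fun x : Torus => (f x : ℂ)) k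

/-- The partial derivative in the `i`-th direction. -/
def pderiv (i : Fin 2) (f : Torus → ℝ) (x : Torus) : ℝ :=
  deriv (fun r : ℝ => f (x + Pi.single i (r : UnitAddCircle))) 0

/-- The Laplacian. -/
def laplacian (f : Torus → ℝ) (x : Torus) : ℝ := ∑ i, pderiv i (pderiv i f) x

/-- The function is smooth, i.e. its periodic lift to the plane is. -/
def IsSmooth (f : Torus → ℝ) : Prop :=
  ContDiff ℝ ∞ fun x : Fin 2 → ℝ => f fun i => (x i : UnitAddCircle)

/-! ### Sobolev spaces in time with values in a Banach space -/

/-- `g` is the weak derivative of `f` on the interval `(a, b)`. -/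
def IsWeakDeriv {X : Type*} [NormedAddCommGroup X] [NormedSpace ℝ X] (a b : ℝ) (f g : ℝ → X) :
    Prop :=
  ∀ φ : ℝ → ℝ, ContDiff ℝ ∞ φ → HasCompactSupport φ → tsupport φ ⊆ Ioo a b →
    ∫ t in Ioo a b, deriv φ t • f t = -∫ t in Ioo a b, φ t • g t

/-- `u ∈ H^k(a, b; X)`: the weak time derivatives of orders `0, …, k` lie in `L²(a, b; X)`. -/
def MemHTime {X : Type*} [NormedAddCommGroup X] [NormedSpace ℝ X] (k : ℕ) (a b : ℝ) (u : ℝ → X) :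
    Prop :=
  ∃ v : ℕ → ℝ → X, v 0 = u ∧
    (∀ j ≤ k, MemLp (v j) 2 (volume.restrict (Ioo a b))) ∧
    ∀ j < k, IsWeakDeriv a b (v j) (v (j + 1))

/-- The Hilbert space `ℓ²(ℤ²; ℂ)`. -/
abbrev SeqSpace : Type := lp (fun _ : Fin 2 → ℤ => ℂ) 2

/-- `v t = ((1 + |k|²)^{s/2} û(t)(k))_k` for almost every `t ∈ (a, b)`. In particular
`u(t) ∈ H^s(Ω)` with `‖u(t)‖_{H^s} = ‖v t‖`, and `v` is `u` under the isometric embedding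
of the periodic Sobolev space `H^s(Ω)` in `ℓ²(ℤ²; ℂ)`. -/
def IsSobolevImage (s : ℕ) (a b : ℝ) (u : ℝ → C(Torus, ℝ)) (v : ℝ → SeqSpace) : Prop :=
  ∀ᵐ t ∂(volume.restrict (Ioo a b)), ∀ k : Fin 2 → ℤ,
    v t k = (√((1 + ∑ i, (k i : ℝ) ^ 2) ^ s) : ℂ) * fCoeff (u t) k

/-- `u ∈ H^k(a, b; H^s(Ω))`. -/
def MemHTimeHSpace (k s : ℕ) (a b : ℝ) (u : ℝ → C(Torus, ℝ)) : Prop :=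
  ∃ v : ℝ → SeqSpace, IsSobolevImage s a b u v ∧ MemHTime k a b v

/-- `u ∈ L^∞(a, b; H^s(Ω))`. -/
def MemLInfHSpace (s : ℕ) (a b : ℝ) (u : ℝ → C(Torus, ℝ)) : Prop :=
  ∃ v : ℝ → SeqSpace, IsSobolevImage s a b u v ∧ MemLp v ⊤ (volume.restrict (Ioo a b))

/-- The regularity class
`H⁴(a,T; C⁰) ∩ H¹(a,T; H⁴) ∩ H³(a,T; H^{m+2}) ∩ L^∞(a,T; H^{m+4})`;
`u` is the representative that is continuous in time. -/
structure RegularityClass (m : ℕ) (a T : ℝ) (u : ℝ → C(Torus, ℝ)) : Prop where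
  continuousOn : ContinuousOn u (Icc a T)
  h4_c0 : MemHTime 4 a T u
  h1_h4 : MemHTimeHSpace 1 4 a T u
  h3_hm2 : MemHTimeHSpace 3 (m + 2) a T u
  linf_hm4 : MemLInfHSpace (m + 4) a T u

/-- `u` solves `∂ₜu = -∇·(∇u / (1 + |∇u|²)) - ε²Δ²u` on `Ω × (a, T)`, with periodic boundary
conditions; the spatial derivatives on the right-hand side are taken in the sense of
distributions (`Δ²u` is only square integrable when `m` is small). -/
def SolvesNSS (ε a T : ℝ) (u : ℝ → C(Torus, ℝ)) : Prop :=
  ∀ t ∈ Ioo a T, ∀ φ : Torus → ℝ, IsSmooth φ →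
    ∫ x, deriv (fun τ => u τ x) t * φ x ∂torusMeasure =
      (∫ x, (∑ i, pderiv i (u t) x * pderiv i φ x) /
          (1 + ∑ i, pderiv i (u t) x ^ 2) ∂torusMeasure)
        - ε ^ 2 * ∫ x, u t x * laplacian (laplacian φ) x ∂torusMeasure

/-! ### The Fourier pseudo-spectral discretization, with `N = 2K + 1` points per direction -/

/-- Indices `(i, j)`, `0 ≤ i, j ≤ N - 1`, of the numerical grid. -/
abbrev Grid (K : ℕ) : Type := Fin 2 → Fin (2 * K + 1)

/-- The mesh size `h = 1 / N`. -/
def meshSize (K : ℕ) : ℝ := 1 / (2 * K + 1)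

/-- The grid point `(i h, j h)`. -/
def gridPoint (K : ℕ) (p : Grid K) : Torus :=
  fun i => (((p i : ℕ) * meshSize K : ℝ) : UnitAddCircle)

/-- The wave numbers `(k, ℓ)` with `-K ≤ k, ℓ ≤ K`. -/
def freq (K : ℕ) : Finset (Fin 2 → ℤ) := Fintype.piFinset fun _ => Finset.Icc (-(K : ℤ)) K

/-- The discrete Fourier coefficients of a grid function. -/
def dft {K : ℕ} (f : Grid K → ℝ) (k : Fin 2 → ℤ) : ℂ :=
  (meshSize K : ℂ) ^ 2 * ∑ p, (f p : ℂ) * UnitAddTorus.mFourier (-k) (gridPoint K p)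

/-- The operator on grid functions that multiplies the discrete Fourier coefficients by `σ`. For
the symbols below (`σ (-k)` is the conjugate of `σ k`) the sum is real: taking the real part only
changes the type. -/
def multiplier {K : ℕ} (σ : (Fin 2 → ℤ) → ℂ) (f : Grid K → ℝ) (p : Grid K) : ℝ :=
  (∑ k ∈ freq K, σ k * dft f k * UnitAddTorus.mFourier k (gridPoint K p)).re

/-- The collocation derivatives `𝓓_{Nx}` (`i = 0`) and `𝓓_{Ny}` (`i = 1`). -/
def dN {K : ℕ} (i : Fin 2) (f : Grid K → ℝ) : Grid K → ℝ :=
  multiplier (fun k => 2 * (k i : ℂ) * (Real.pi : ℂ) * Complex.I) f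

/-- The collocation second derivatives `𝓓²_{Nx}` and `𝓓²_{Ny}`. -/
def d2N {K : ℕ} (i : Fin 2) (f : Grid K → ℝ) : Grid K → ℝ :=
  multiplier (fun k => -4 * (Real.pi : ℂ) ^ 2 * (k i : ℂ) ^ 2) f

/-- The discrete Laplacian `Δ_N`. -/
def lapN {K : ℕ} (f : Grid K → ℝ) : Grid K → ℝ := fun p => ∑ i, d2N i f p

/-- The discrete flux `∇_N f / (1 + |∇_N f|²)`, componentwise. -/
def fluxN {K : ℕ} (f : Grid K → ℝ) (i : Fin 2) : Grid K → ℝ :=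
  fun q => dN i f q / (1 + ∑ l, dN l f q ^ 2)

/-- The discrete divergence `∇_N · F`. -/
def divN {K : ℕ} (F : Fin 2 → Grid K → ℝ) : Grid K → ℝ := fun p => ∑ i, dN i (F i) p

/-- The discrete norm `‖f‖₂ = (h² ∑ |f_{i,j}|²)^{1/2}`. -/
def norm2 {K : ℕ} (f : Grid K → ℝ) : ℝ := √(meshSize K ^ 2 * ∑ p, f p ^ 2)

/-- The third order BDF scheme at the time level `n + 1`. -/
def BDF3Step (ε A dt : ℝ) {K : ℕ} (u : ℤ → Grid K → ℝ) (n : ℤ) : Prop :=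
  ∀ p : Grid K,
    (11 / 6 * u (n + 1) p - 3 * u n p + 3 / 2 * u (n - 1) p - 1 / 3 * u (n - 2) p) / dt
      + ε ^ 2 * lapN (lapN (u (n + 1))) p
      + divN (fun i => 3 * fluxN (u n) i - 3 * fluxN (u (n - 1)) i + fluxN (u (n - 2)) i) p
      + A * dt ^ 2 * lapN (lapN (u (n + 1) - u n)) p = 0

/-- The Fourier projection `𝓟_N f` onto the trigonometric polynomials of degree at most `K` (real,
since `f` is: taking the real part only changes the type). -/
def fourierProj (K : ℕ) (f : C(Torus, ℝ)) (x : Torus) : ℝ :=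
  (∑ k ∈ freq K, fCoeff f k * UnitAddTorus.mFourier k x).re

/-- The error grid function `e^n = U^n - u^n`, where `U^n` holds the grid values of the Fourier
projection of the exact solution at the time `n dt`. -/
def err (ue : ℝ → C(Torus, ℝ)) (dt : ℝ) {K : ℕ} (u : ℤ → Grid K → ℝ) (n : ℤ) : Grid K → ℝ :=
  fun p => fourierProj K (ue (n * dt)) (gridPoint K p) - u n p

end NSS

end

set_option linter.unusedSectionVars false

noncomputable section

namespace NSS

/-! ### Discrete Fourier analysis on the grid -/

/-! The theorem is consistency plus stability for the errors `e^n`, in the discrete L² norm.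

Stability. BDF3 is not A-stable, so testing with `e^{n+1}` alone does not suffice. With the
multiplier `2 e^{n+1} - e^n` the BDF difference is bounded below by an increment of a positive
definite quadratic form in three consecutive values (`gForm_sub_le`, `le_gForm`). The same
multiplier turns the biharmonic term into dissipation of `‖Δ_N e‖²`, and the stabilising `A` term
into a telescoping one up to a nonnegative remainder. The flux `v/(1+|v|²)` is globally Lipschitz
(`abs_flux_sub_le`), so the nonlinear error costs only `‖∇_N e‖²`, which `gradSq_le` splits into a
small multiple of `‖Δ_N e‖²`, absorbed by the dissipation, and a multiple of `‖e‖²`, left to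
Gronwall. No bound on the numerical solution, no inverse inequality and no relation between `Δt` and
`h` is needed. This is `energy_step`, summed by `implicit_gronwall`.

Consistency. The projected exact solution satisfies the scheme with a residual `τ + ∇_N·ρ`
(`ExactBounds.exists_consistency`). The flux error is kept in divergence form, so that its
derivative falls on the test function. The squared residual is at most a multiple of `h^{2m} + d⁶ +
d⁵ ∫ β` for `d = Δt`, with `β` integrable and the integral over the four-point stencil; multiplying
by `d` and summing over the time levels gives `(d³ + h^m)²`, as the stencils overlap only three
times.

Three facts carry the consistency estimate. In time, weak derivatives yield continuous
representatives, and Taylor's formula with integral remainder bounds the BDF and extrapolation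
errors. In space, the flux of a truncated gradient has `m + 1` bounded derivatives uniformly in `K`,
so its Fourier tail, and with it the aliasing error, is `O(h^m)` (`exists_alias_bound`). Finally,
the third time difference of the nonlinear flux is estimated by a discrete Leibniz rule (`Ctrl.mul`,
`Ctrl.inv`) in which each product has only one factor in L² and the others in the supremum norm; the
latter is obtained by interpolating between H² and H⁴ (`exists_third_difference_bound`). -/

/-- The primitive `N`-th root of unity, `N = 2 * K + 1`. -/
def rootN (K : ℕ) : ℂ := Complex.exp (2 * Real.pi * Complex.I / ((2 * K + 1 : ℕ) : ℂ))

lemma isPrimitiveRoot_rootN (K : ℕ) : IsPrimitiveRoot (rootN K) (2 * K + 1) :=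
  Complex.isPrimitiveRoot_exp _ (by omega)

lemma rootN_ne_zero (K : ℕ) : rootN K ≠ 0 := Complex.exp_ne_zero _

lemma meshSize_pos (K : ℕ) : 0 < meshSize K := by unfold meshSize; positivity

lemma meshSize_mul (K : ℕ) : meshSize K * (2 * K + 1) = 1 := by unfold meshSize; field_simp

lemma fourier_grid (K : ℕ) (n : ℤ) (j : ℕ) :
    fourier n (((j : ℕ) * meshSize K : ℝ) : UnitAddCircle) = rootN K ^ (n * j) := by
  rw [fourier_coe_apply, rootN, ← Complex.exp_int_mul]
  congr 1
  simp only [meshSize]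
  push_cast
  ring

lemma mFourier_gridPoint (K : ℕ) (k : Fin 2 → ℤ) (p : Grid K) :
    UnitAddTorus.mFourier k (gridPoint K p) = ∏ i, rootN K ^ (k i * (p i : ℕ)) := by
  simp only [UnitAddTorus.mFourier, gridPoint, ContinuousMap.coe_mk, fourier_grid]

lemma sum_range_rootN (K : ℕ) (m : ℤ) :
    ∑ j ∈ Finset.range (2 * K + 1), rootN K ^ (m * (j : ℤ))
      = if ((2 * K + 1 : ℕ) : ℤ) ∣ m then ((2 * K + 1 : ℕ) : ℂ) else 0 := by
  have h1 := (isPrimitiveRoot_rootN K).zpow_eq_one_iff_dvd m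
  simp only [zpow_mul, zpow_natCast]
  split_ifs with h
  · rw [h1.2 h]; simp
  · have h2 : rootN K ^ m ≠ 1 := fun h' => h (h1.1 h')
    have h3 := mul_geom_sum (rootN K ^ m) (2 * K + 1)
    have h4 : (rootN K ^ m) ^ (2 * K + 1) = 1 := by
      rw [← zpow_natCast, ← zpow_mul, mul_comm, zpow_mul, zpow_natCast,
        (isPrimitiveRoot_rootN K).pow_eq_one, one_zpow]
    rw [h4, sub_self] at h3
    exact (mul_eq_zero.1 h3).resolve_left (sub_ne_zero.2 h2)

lemma sum_Icc_rootN (K : ℕ) (m : ℤ) :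
    ∑ k ∈ Finset.Icc (-(K : ℤ)) K, rootN K ^ (k * m)
      = if ((2 * K + 1 : ℕ) : ℤ) ∣ m then ((2 * K + 1 : ℕ) : ℂ) else 0 := by
  have h1 : ∑ k ∈ Finset.Icc (-(K : ℤ)) K, rootN K ^ (k * m)
      = ∑ j ∈ Finset.range (2 * K + 1), rootN K ^ (-(K : ℤ) * m) * rootN K ^ (m * (j : ℤ)) := by
    symm
    refine Finset.sum_bij (fun j _ => (j : ℤ) - K) ?_ ?_ ?_ ?_
    · intro j hj; simp at hj ⊢; omega
    · intro a _ b _ h; simpa using h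
    · intro b hb; simp at hb; exact ⟨(b + K).toNat, by simp; omega, by simp; omega⟩
    · intro j _
      rw [← zpow_add₀ (rootN_ne_zero K)]
      congr 1; ring
  rw [h1, ← Finset.mul_sum, sum_range_rootN]
  split_ifs with h
  · rw [((isPrimitiveRoot_rootN K).zpow_eq_one_iff_dvd _).2 (h.mul_left _), one_mul]
  · rw [mul_zero]

/-- The sum factors into two geometric sums. Divisibility by `N` is exactly aliasing: characters
whose indices agree modulo `N` coincide on the grid. -/
lemma sum_grid_mFourier (K : ℕ) (k : Fin 2 → ℤ) :
    (meshSize K : ℂ) ^ 2 * ∑ p, UnitAddTorus.mFourier k (gridPoint K p)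
      = if ∀ i, ((2 * K + 1 : ℕ) : ℤ) ∣ k i then 1 else 0 := by
  have h1 : ∑ p, UnitAddTorus.mFourier k (gridPoint K p)
      = ∏ i, (if ((2 * K + 1 : ℕ) : ℤ) ∣ k i then ((2 * K + 1 : ℕ) : ℂ) else 0) := by
    simp only [mFourier_gridPoint]
    rw [← Fintype.piFinset_univ,
      ← Finset.prod_univ_sum (fun _ : Fin 2 => (Finset.univ : Finset (Fin (2 * K + 1))))
        (fun i j => rootN K ^ (k i * (j : ℕ)))]
    refine Finset.prod_congr rfl fun i _ => ?_
    rw [← sum_range_rootN, Finset.sum_range]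
  have h2 : (meshSize K : ℂ) * (2 * K + 1) = 1 := by exact_mod_cast meshSize_mul K
  rw [h1]
  split_ifs with h
  · rw [Finset.prod_congr rfl fun i _ => if_pos (h i)]
    simp only [Finset.prod_const, Finset.card_univ, Fintype.card_fin]
    rw [← mul_pow]
    push_cast
    rw [h2, one_pow]
  · push Not at h
    obtain ⟨i, hi⟩ := h
    rw [Finset.prod_eq_zero (Finset.mem_univ i) (if_neg hi), mul_zero]

lemma mem_freq {K : ℕ} {k : Fin 2 → ℤ} : k ∈ freq K ↔ ∀ i, -(K : ℤ) ≤ k i ∧ k i ≤ K := by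
  simp [freq]

lemma neg_mem_freq {K : ℕ} {k : Fin 2 → ℤ} (hk : k ∈ freq K) : -k ∈ freq K := by
  rw [mem_freq] at *
  intro i
  have := hk i
  simp only [Pi.neg_apply]
  omega

lemma sum_freq_neg {M : Type*} [AddCommMonoid M] (K : ℕ) (g : (Fin 2 → ℤ) → M) :
    ∑ k ∈ freq K, g (-k) = ∑ k ∈ freq K, g k :=
  Finset.sum_nbij' (fun k => -k) (fun k => -k) (fun _ h => neg_mem_freq h)
    (fun _ h => neg_mem_freq h) (by simp) (by simp) (by simp)

/-- Resolved wave numbers differ by at most `2K < N` in each component, so no two of them alias. -/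
lemma freq_dvd_iff {K : ℕ} {k l : Fin 2 → ℤ} (hk : k ∈ freq K) (hl : l ∈ freq K) :
    (∀ i, ((2 * K + 1 : ℕ) : ℤ) ∣ (k - l) i) ↔ k = l := by
  rw [mem_freq] at hk hl
  constructor
  · intro h
    ext i
    have h1 := hk i
    have h2 := hl i
    have h3 := Int.eq_zero_of_abs_lt_dvd (h i) (by
      simp only [Pi.sub_apply]; rw [abs_lt]; push_cast; omega)
    simp only [Pi.sub_apply] at h3
    omega
  · rintro rfl; simp

lemma sum_freq_mFourier (K : ℕ) (p q : Grid K) :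
    (meshSize K : ℂ) ^ 2 * ∑ k ∈ freq K, UnitAddTorus.mFourier k (gridPoint K p)
      * UnitAddTorus.mFourier (-k) (gridPoint K q) = if p = q then 1 else 0 := by
  have h1 : ∑ k ∈ freq K, UnitAddTorus.mFourier k (gridPoint K p)
      * UnitAddTorus.mFourier (-k) (gridPoint K q)
      = ∏ i, (if ((2 * K + 1 : ℕ) : ℤ) ∣ ((p i : ℕ) : ℤ) - ((q i : ℕ) : ℤ)
          then ((2 * K + 1 : ℕ) : ℂ) else 0) := by
    simp only [mFourier_gridPoint, ← Finset.prod_mul_distrib]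
    have : ∀ k : Fin 2 → ℤ, ∏ i, rootN K ^ (k i * ((p i : ℕ) : ℤ)) *
        rootN K ^ ((-k) i * ((q i : ℕ) : ℤ))
        = ∏ i, rootN K ^ (k i * (((p i : ℕ) : ℤ) - ((q i : ℕ) : ℤ))) := by
      intro k
      refine Finset.prod_congr rfl fun i _ => ?_
      rw [← zpow_add₀ (rootN_ne_zero K)]
      congr 1
      simp only [Pi.neg_apply]; ring
    simp only [this]
    rw [freq, ← Finset.prod_univ_sum (fun _ : Fin 2 => Finset.Icc (-(K : ℤ)) K)
      (fun i j => rootN K ^ (j * (((p i : ℕ) : ℤ) - ((q i : ℕ) : ℤ))))]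
    exact Finset.prod_congr rfl fun i _ => sum_Icc_rootN K _
  have h2 : (meshSize K : ℂ) * (2 * K + 1) = 1 := by exact_mod_cast meshSize_mul K
  rw [h1]
  split_ifs with h
  · subst h
    simp only [sub_self, dvd_zero, if_true, Finset.prod_const, Finset.card_univ, Fintype.card_fin]
    rw [← mul_pow]
    push_cast
    rw [h2, one_pow]
  · obtain ⟨i, hi⟩ := Function.ne_iff.1 h
    rw [Finset.prod_eq_zero (Finset.mem_univ i), mul_zero]
    refine if_neg fun hd => hi ?_
    have h3 := Int.eq_zero_of_abs_lt_dvd hd (by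
      rw [abs_lt]; push_cast; omega)
    ext
    omega

/-- The real trigonometric polynomial with coefficients `a`. -/
def trig (K : ℕ) (a : (Fin 2 → ℤ) → ℂ) (x : Torus) : ℝ :=
  (∑ k ∈ freq K, a k * UnitAddTorus.mFourier k x).re

/-- Coefficients of real functions. -/
def IsHerm (a : (Fin 2 → ℤ) → ℂ) : Prop := ∀ k, a (-k) = (starRingEnd ℂ) (a k)

lemma conj_mFourier (k : Fin 2 → ℤ) (x : Torus) :
    (starRingEnd ℂ) (UnitAddTorus.mFourier k x) = UnitAddTorus.mFourier (-k) x :=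
  UnitAddTorus.mFourier_neg.symm

lemma trig_coe (K : ℕ) {a : (Fin 2 → ℤ) → ℂ} (ha : IsHerm a) (x : Torus) :
    (trig K a x : ℂ) = ∑ k ∈ freq K, a k * UnitAddTorus.mFourier k x := by
  rw [trig, ← Complex.conj_eq_iff_re, map_sum, ← sum_freq_neg]
  refine Finset.sum_congr rfl fun k _ => ?_
  rw [map_mul, ha k, conj_mFourier, neg_neg, Complex.conj_conj]

lemma dft_isHerm {K : ℕ} (f : Grid K → ℝ) : IsHerm (dft f) := by
  intro k
  simp only [dft, map_mul, map_sum, map_pow, Complex.conj_ofReal, conj_mFourier]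

/-- No information is lost by sampling a polynomial of degree at most `K`. Hermitian symmetry is
needed because `trig` takes a real part. -/
lemma dft_trig (K : ℕ) {a : (Fin 2 → ℤ) → ℂ} (ha : IsHerm a) {k : Fin 2 → ℤ} (hk : k ∈ freq K) :
    dft (fun p => trig K a (gridPoint K p)) k = a k := by
  simp only [dft, trig_coe K ha, Finset.sum_mul]
  rw [Finset.sum_comm, Finset.mul_sum]
  have : ∀ l ∈ freq K, (meshSize K : ℂ) ^ 2 * ∑ p : Grid K,
      a l * UnitAddTorus.mFourier l (gridPoint K p) * UnitAddTorus.mFourier (-k) (gridPoint K p)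
      = if k = l then a l else 0 := by
    intro l hl
    have h1 := sum_grid_mFourier K (l - k)
    simp only [freq_dvd_iff hl hk] at h1
    simp only [mul_assoc, ← UnitAddTorus.mFourier_add]
    rw [← Finset.mul_sum, mul_left_comm, ← sub_eq_add_neg, h1]
    simp [eq_comm]
  rw [Finset.sum_congr rfl this, Finset.sum_ite_eq, if_pos hk]

lemma dft_inversion {K : ℕ} (f : Grid K → ℝ) (p : Grid K) :
    trig K (dft f) (gridPoint K p) = f p := by
  have h : (trig K (dft f) (gridPoint K p) : ℂ) = f p := by
    rw [trig_coe K (dft_isHerm f)]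
    simp only [dft, Finset.mul_sum, Finset.sum_mul]
    rw [Finset.sum_comm]
    have : ∀ q : Grid K, ∑ k ∈ freq K, (meshSize K : ℂ) ^ 2 *
        ((f q : ℂ) * UnitAddTorus.mFourier (-k) (gridPoint K q))
          * UnitAddTorus.mFourier k (gridPoint K p) = if p = q then (f q : ℂ) else 0 := by
      intro q
      have h1 := sum_freq_mFourier K p q
      calc _ = (f q : ℂ) * ((meshSize K : ℂ) ^ 2 * ∑ k ∈ freq K,
            UnitAddTorus.mFourier k (gridPoint K p)
              * UnitAddTorus.mFourier (-k) (gridPoint K q)) := by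
            simp only [Finset.mul_sum]
            exact Finset.sum_congr rfl fun k _ => by ring
        _ = _ := by rw [h1]; simp
    rw [Finset.sum_congr rfl fun q _ => this q]
    simp
  exact_mod_cast h

/-- The discrete inner product. -/
def ip {K : ℕ} (f g : Grid K → ℝ) : ℝ := meshSize K ^ 2 * ∑ p, f p * g p

/-- Only `f` is expanded by inversion; the grid sum that remains against `g` is already a conjugated
coefficient. -/
lemma parseval {K : ℕ} (f g : Grid K → ℝ) :
    (ip f g : ℂ) = ∑ k ∈ freq K, dft f k * (starRingEnd ℂ) (dft g k) := by
  have h1 : ∀ p, (f p : ℂ) = ∑ k ∈ freq K, dft f k * UnitAddTorus.mFourier k (gridPoint K p) :=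
    fun p => by rw [← trig_coe K (dft_isHerm f), dft_inversion]
  simp only [ip]
  push_cast
  simp only [h1, Finset.sum_mul]
  rw [Finset.sum_comm, Finset.mul_sum]
  refine Finset.sum_congr rfl fun k _ => ?_
  have h2 : (starRingEnd ℂ) (dft g k)
      = (meshSize K : ℂ) ^ 2 * ∑ p, (g p : ℂ) * UnitAddTorus.mFourier k (gridPoint K p) := by
    simp only [dft, map_mul, map_sum, map_pow, Complex.conj_ofReal, conj_mFourier, neg_neg]
  rw [h2, Finset.mul_sum, Finset.mul_sum, Finset.mul_sum]
  exact Finset.sum_congr rfl fun p _ => by ring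

lemma norm2_sq {K : ℕ} (f : Grid K → ℝ) : norm2 f ^ 2 = ip f f := by
  rw [norm2, Real.sq_sqrt (by positivity), ip]
  simp only [sq]

lemma norm2_nonneg {K : ℕ} (f : Grid K → ℝ) : 0 ≤ norm2 f := Real.sqrt_nonneg _

lemma norm2_sq_dft {K : ℕ} (f : Grid K → ℝ) : norm2 f ^ 2 = ∑ k ∈ freq K, ‖dft f k‖ ^ 2 := by
  have h := parseval f f
  simp only [Complex.mul_conj, Complex.normSq_eq_norm_sq] at h
  rw [norm2_sq]
  exact_mod_cast h

lemma norm2_sq_trig (K : ℕ) {a : (Fin 2 → ℤ) → ℂ} (ha : IsHerm a) :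
    norm2 (fun p => trig K a (gridPoint K p)) ^ 2 = ∑ k ∈ freq K, ‖a k‖ ^ 2 := by
  rw [norm2_sq_dft]
  exact Finset.sum_congr rfl fun k hk => by rw [dft_trig K ha hk]

/-- The symbol of `dN i`. -/
def symD (i : Fin 2) (k : Fin 2 → ℤ) : ℂ := 2 * (k i : ℂ) * (Real.pi : ℂ) * Complex.I

/-- The symbol of `lapN`. -/
def symL (k : Fin 2 → ℤ) : ℂ := -4 * (Real.pi : ℂ) ^ 2 * ((∑ i, (k i : ℝ) ^ 2 : ℝ) : ℂ)

lemma symD_neg (i : Fin 2) (k : Fin 2 → ℤ) : symD i (-k) = (starRingEnd ℂ) (symD i k) := by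
  simp [symD, Complex.conj_ofNat]

lemma symL_neg (k : Fin 2 → ℤ) : symL (-k) = (starRingEnd ℂ) (symL k) := by
  simp [symL, Complex.conj_ofNat]

lemma sum_symD_sq (k : Fin 2 → ℤ) : ∑ i, symD i k ^ 2 = symL k := by
  simp only [symD, symL, Fin.sum_univ_two]
  push_cast
  ring_nf
  simp only [Complex.I_sq]
  ring

lemma IsHerm.mul {a b : (Fin 2 → ℤ) → ℂ} (ha : IsHerm a) (hb : IsHerm b) :
    IsHerm fun k => a k * b k := fun k => by
  simp only [ha k, hb k, map_mul]

lemma multiplier_eq_trig {K : ℕ} (σ : (Fin 2 → ℤ) → ℂ) (f : Grid K → ℝ) :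
    multiplier σ f = fun p => trig K (fun k => σ k * dft f k) (gridPoint K p) := rfl

lemma dft_multiplier {K : ℕ} {σ : (Fin 2 → ℤ) → ℂ} (hσ : IsHerm σ) (f : Grid K → ℝ)
    {k : Fin 2 → ℤ} (hk : k ∈ freq K) : dft (multiplier σ f) k = σ k * dft f k := by
  rw [multiplier_eq_trig, dft_trig K (hσ.mul (dft_isHerm f)) hk]

lemma lapN_eq {K : ℕ} (f : Grid K → ℝ) : lapN f = multiplier symL f := by
  ext p
  simp only [lapN, d2N, multiplier, ← Complex.re_sum]
  congr 1
  rw [Finset.sum_comm]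
  refine Finset.sum_congr rfl fun k _ => ?_
  rw [← Finset.sum_mul, ← Finset.sum_mul, symL]
  congr 2
  push_cast
  rw [Finset.mul_sum]

lemma dft_dN {K : ℕ} (i : Fin 2) (f : Grid K → ℝ) {k : Fin 2 → ℤ} (hk : k ∈ freq K) :
    dft (dN i f) k = symD i k * dft f k := dft_multiplier (symD_neg i) f hk

lemma dft_lapN {K : ℕ} (f : Grid K → ℝ) {k : Fin 2 → ℤ} (hk : k ∈ freq K) :
    dft (lapN f) k = symL k * dft f k := by rw [lapN_eq, dft_multiplier symL_neg f hk]

lemma ip_comm {K : ℕ} (f g : Grid K → ℝ) : ip f g = ip g f := by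
  simp only [ip, mul_comm]

/-- Summation by parts: the symbol is purely imaginary and periodicity leaves no boundary terms. -/
lemma ip_dN {K : ℕ} (i : Fin 2) (f g : Grid K → ℝ) : ip (dN i f) g = -ip f (dN i g) := by
  have h : (ip (dN i f) g : ℂ) = -ip f (dN i g) := by
    rw [parseval, parseval, ← Finset.sum_neg_distrib]
    refine Finset.sum_congr rfl fun k hk => ?_
    rw [dft_dN i f hk, dft_dN i g hk, map_mul]
    simp only [symD, map_mul, Complex.conj_ofReal, Complex.conj_I, map_intCast, map_ofNat]
    ring
  exact_mod_cast h

lemma ip_lapN {K : ℕ} (f g : Grid K → ℝ) : ip (lapN f) g = ip f (lapN g) := by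
  have h : (ip (lapN f) g : ℂ) = ip f (lapN g) := by
    rw [parseval, parseval]
    refine Finset.sum_congr rfl fun k hk => ?_
    rw [dft_lapN f hk, dft_lapN g hk, map_mul]
    simp only [symL, map_mul, map_neg, map_pow, Complex.conj_ofReal, map_ofNat]
    ring
  exact_mod_cast h

lemma sum_norm2_dN {K : ℕ} (f : Grid K → ℝ) :
    ∑ i, norm2 (dN i f) ^ 2 = -ip f (lapN f) := by
  have h : ((∑ i, norm2 (dN i f) ^ 2 : ℝ) : ℂ) = -ip f (lapN f) := by
    push_cast
    rw [parseval, ← Finset.sum_neg_distrib]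
    have : ∀ i, (norm2 (dN i f) : ℂ) ^ 2
        = ∑ k ∈ freq K, symD i k * dft f k * (starRingEnd ℂ) (symD i k * dft f k) := by
      intro i
      have h1 := norm2_sq (dN i f)
      have h2 := parseval (dN i f) (dN i f)
      rw [← h1] at h2
      push_cast at h2
      rw [h2]
      exact Finset.sum_congr rfl fun k hk => by rw [dft_dN i f hk]
    simp only [this]
    rw [Finset.sum_comm]
    refine Finset.sum_congr rfl fun k hk => ?_
    rw [dft_lapN f hk, map_mul, ← symL_neg, ← sum_symD_sq, Finset.sum_mul, Finset.mul_sum,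
      ← Finset.sum_neg_distrib]
    refine Finset.sum_congr rfl fun i _ => ?_
    rw [map_mul, ← symD_neg]
    simp only [symD, Pi.neg_apply]
    push_cast
    ring
  exact_mod_cast h

lemma abs_ip_le {K : ℕ} (f g : Grid K → ℝ) : |ip f g| ≤ norm2 f * norm2 g := by
  refine abs_le_of_sq_le_sq ?_ (mul_nonneg (norm2_nonneg f) (norm2_nonneg g))
  rw [mul_pow, norm2_sq, norm2_sq, ip, ip, ip]
  have h := Finset.sum_mul_sq_le_sq_mul_sq Finset.univ f g
  have h0 : 0 ≤ meshSize K ^ 4 := by positivity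
  simp only [← sq]
  nlinarith [mul_le_mul_of_nonneg_left h h0]

/-! ### Weak derivatives in time -/

section WeakDeriv

variable {X : Type*} [NormedAddCommGroup X] [NormedSpace ℝ X] [CompleteSpace X] {a b : ℝ}

lemma intervalIntegral_eq_indicator {g : ℝ → X} {t : ℝ} (ht : t ∈ Ioo a b) :
    ∫ τ in a..t, g τ = ∫ τ in Ioo a b, (Iio t).indicator g τ := by
  rw [intervalIntegral.integral_of_le ht.1.le, integral_Ioc_eq_integral_Ioo,
    setIntegral_indicator measurableSet_Iio]
  congr 2
  ext x
  simp only [mem_Ioo, mem_inter_iff, mem_Iio]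
  constructor
  · exact fun h => ⟨⟨h.1, h.2.trans ht.2⟩, h.2⟩
  · exact fun h => ⟨h.1.1, h.2⟩

/-- Fubini on the triangle `τ < t`: the inner integral of `φ'` over `(τ, b)` is `-φ(τ)`, because `φ`
vanishes at `b`. -/
lemma isWeakDeriv_primitive {g : ℝ → X} (hg : IntegrableOn g (Ioo a b)) :
    IsWeakDeriv a b (fun t => ∫ τ in a..t, g τ) g := by
  intro φ hφ hc hsub
  have hφb : φ b = 0 := by
    by_contra h
    exact lt_irrefl _ (hsub (subset_tsupport φ h)).2
  have hd : Continuous (deriv φ) := hφ.continuous_deriv (by simp)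
  have hdc : HasCompactSupport (deriv φ) := hc.deriv
  have hdi : Integrable (deriv φ) (volume.restrict (Ioo a b)) :=
    (hd.integrable_of_hasCompactSupport hdc).restrict
  set F : ℝ → ℝ → X := fun t τ => {p : ℝ × ℝ | p.2 < p.1}.indicator
    (fun p => deriv φ p.1 • g p.2) (t, τ) with hF
  have hFi : Integrable (Function.uncurry F)
      ((volume.restrict (Ioo a b)).prod (volume.restrict (Ioo a b))) := by
    have h1 := (hdi.smul_prod hg).indicator (measurableSet_lt measurable_snd measurable_fst)
    exact h1
  have hL : ∫ t in Ioo a b, deriv φ t • ∫ τ in a..t, g τ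
      = ∫ t in Ioo a b, ∫ τ in Ioo a b, F t τ := by
    refine setIntegral_congr_fun measurableSet_Ioo fun t ht => ?_
    rw [intervalIntegral_eq_indicator ht, ← integral_smul]
    refine integral_congr_ae (Filter.Eventually.of_forall fun τ => ?_)
    by_cases h : τ < t <;> simp [hF, indicator, h]
  have hR : ∀ τ ∈ Ioo a b, ∫ t in Ioo a b, F t τ = -(φ τ • g τ) := by
    intro τ hτ
    have h1 : ∀ t, F t τ = (Ioi τ).indicator (deriv φ) t • g τ := by
      intro t
      by_cases h : τ < t <;> simp [hF, indicator, h]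
    simp only [h1]
    rw [integral_smul_const, setIntegral_indicator measurableSet_Ioi]
    have h2 : Ioo a b ∩ Ioi τ = Ioo τ b := by
      ext x
      simp only [mem_inter_iff, mem_Ioo, mem_Ioi]
      exact ⟨fun h => ⟨h.2, h.1.2⟩, fun h => ⟨⟨hτ.1.trans h.1, h.2⟩, h.1⟩⟩
    rw [h2, ← integral_Ioc_eq_integral_Ioo, ← intervalIntegral.integral_of_le hτ.2.le,
      intervalIntegral.integral_deriv_eq_sub (fun x _ => (hφ.differentiable (by simp)) x)
        (hd.intervalIntegrable _ _), hφb, zero_sub, neg_smul]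
  rw [hL, integral_integral_swap hFi, setIntegral_congr_fun measurableSet_Ioo hR, integral_neg]

lemma exists_Icc_of_tsupport {s : Set ℝ} (hs : IsCompact s) (hsub : s ⊆ Ioo a b) (hab : a < b) :
    ∃ α β, a < α ∧ α ≤ β ∧ β < b ∧ s ⊆ Icc α β := by
  rcases s.eq_empty_or_nonempty with rfl | hne
  · exact ⟨(a + b) / 2, (a + b) / 2, by linarith, le_rfl, by linarith, empty_subset _⟩
  · obtain ⟨α, hα⟩ := hs.exists_isLeast hne
    obtain ⟨β, hβ⟩ := hs.exists_isGreatest hne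
    exact ⟨α, β, (hsub hα.1).1, hα.2 hβ.1, (hsub hβ.1).2, fun x hx => ⟨hα.2 hx, hβ.2 hx⟩⟩

/-- A smooth function of vanishing mean with compact support in `(a, b)` is the derivative of
such a function. -/
lemma exists_test_primitive {χ : ℝ → ℝ} (hχ : ContDiff ℝ ∞ χ) (hc : HasCompactSupport χ)
    (hsub : tsupport χ ⊆ Ioo a b) (hab : a < b) (h0 : ∫ t in Ioo a b, χ t = 0) :
    ∃ ψ : ℝ → ℝ, ContDiff ℝ ∞ ψ ∧ HasCompactSupport ψ ∧ tsupport ψ ⊆ Ioo a b ∧ deriv ψ = χ := by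
  obtain ⟨α, β, h1, h2, h3, h4⟩ := exists_Icc_of_tsupport hc.isCompact hsub hab
  have hz : ∀ t, t ∉ Icc α β → χ t = 0 := fun t ht => by
    by_contra h
    exact ht (h4 (subset_tsupport χ h))
  have hder : ∀ t, HasDerivAt (fun t => ∫ τ in a..t, χ τ) (χ t) t := fun t =>
    intervalIntegral.integral_hasDerivAt_right (hχ.continuous.intervalIntegrable _ _)
      hχ.continuous.aestronglyMeasurable.stronglyMeasurableAtFilter hχ.continuous.continuousAt
  have hderiv : deriv (fun t => ∫ τ in a..t, χ τ) = χ := funext fun t => (hder t).deriv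
  have htot : ∫ τ in a..b, χ τ = 0 := by
    rw [intervalIntegral.integral_of_le hab.le, integral_Ioc_eq_integral_Ioo, h0]
  have hsupp : ∀ t, t ∉ Icc α β → ∫ τ in a..t, χ τ = 0 := by
    intro t ht
    rcases lt_or_ge t α with h | h
    · refine (intervalIntegral.integral_congr (g := fun _ => (0 : ℝ)) fun τ hτ => ?_).trans (by simp)
      refine hz τ fun h' => ?_
      rw [mem_uIcc] at hτ
      rcases hτ with hτ | hτ <;> linarith [h'.1]
    · have h' : β < t := by
        by_contra h'
        exact ht ⟨h, not_lt.1 h'⟩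
      rw [← intervalIntegral.integral_add_adjacent_intervals
        (hχ.continuous.intervalIntegrable a b) (hχ.continuous.intervalIntegrable b t), htot, zero_add]
      refine (intervalIntegral.integral_congr (g := fun _ => (0 : ℝ)) fun τ hτ => ?_).trans (by simp)
      refine hz τ fun h'' => ?_
      rw [mem_uIcc] at hτ
      rcases hτ with hτ | hτ <;> linarith [h''.2]
  have hts : tsupport (fun t => ∫ τ in a..t, χ τ) ⊆ Icc α β :=
    closure_minimal (fun t ht => by_contra fun h => ht (hsupp t h)) isClosed_Icc
  refine ⟨fun t => ∫ τ in a..t, χ τ, ?_, ?_, ?_, hderiv⟩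
  · rw [contDiff_infty_iff_deriv, hderiv]
    exact ⟨fun t => (hder t).differentiableAt, hχ⟩
  · exact isCompact_Icc.of_isClosed_subset (isClosed_tsupport _) hts
  · exact hts.trans fun t ht => ⟨h1.trans_le ht.1, ht.2.trans_lt h3⟩

/-- **Du Bois-Reymond lemma**: a function with vanishing weak derivative is constant. -/
lemma ae_const_of_isWeakDeriv_zero {w : ℝ → X} (hw : IntegrableOn w (Ioo a b)) (hab : a < b)
    (h : ∀ φ : ℝ → ℝ, ContDiff ℝ ∞ φ → HasCompactSupport φ → tsupport φ ⊆ Ioo a b →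
      ∫ t in Ioo a b, deriv φ t • w t = 0) :
    ∃ c, ∀ᵐ t ∂(volume.restrict (Ioo a b)), w t = c := by
  obtain ⟨θ₀, hθ1, hθ2, hθ3, hθ4, hθ5⟩ := exists_contDiff_tsupport_subset (n := ⊤)
    (Ioo_mem_nhds (show a < (a + b) / 2 by linarith) (show (a + b) / 2 < b by linarith))
  have key : ∀ φ : ℝ → ℝ, ContDiff ℝ ∞ φ → HasCompactSupport φ → tsupport φ ⊆ Ioo a b →
      IntegrableOn φ (Ioo a b) ∧ IntegrableOn (fun t => φ t • w t) (Ioo a b) := by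
    intro φ h1 h2 _
    refine ⟨(h1.continuous.integrable_of_hasCompactSupport h2).restrict, ?_⟩
    obtain ⟨M, hM⟩ := h1.continuous.bounded_above_of_compact_support h2
    exact Integrable.bdd_smul (C := M) hw h1.continuous.aestronglyMeasurable
      (Filter.Eventually.of_forall hM)
  have hpos : 0 < ∫ t in Ioo a b, θ₀ t := by
    have h1 : ∫ t in Ioo a b, θ₀ t = ∫ t, θ₀ t :=
      setIntegral_eq_integral_of_forall_compl_eq_zero fun t ht => by
        by_contra h'
        exact ht (hθ1 (subset_tsupport _ h'))
    rw [h1]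
    exact hθ3.continuous.integral_pos_of_hasCompactSupport_nonneg_nonzero hθ2
      (fun t => (hθ4 (mem_range_self t)).1) (by rw [hθ5]; norm_num)
  set I := ∫ t in Ioo a b, θ₀ t with hI
  -- The constant must be the mean of `w` weighted by the bump `θ₀`.
  refine ⟨I⁻¹ • ∫ t in Ioo a b, θ₀ t • w t, ?_⟩
  set c := I⁻¹ • ∫ t in Ioo a b, θ₀ t • w t with hc
  have hloc : LocallyIntegrableOn (fun t => w t - c) (Ioo a b) :=
    (hw.sub (integrable_const c)).locallyIntegrableOn
  have := isOpen_Ioo.ae_eq_zero_of_integral_contDiff_smul_eq_zero hloc ?_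
  · rw [ae_restrict_iff' measurableSet_Ioo]
    filter_upwards [this] with t ht h'
    exact sub_eq_zero.1 (ht h')
  intro φ hφ1 hφ2 hφ3
  -- This multiple makes `φ - m θ₀` have mean zero, hence be the derivative of an admissible test
  -- function.
  set m := (∫ t in Ioo a b, φ t) / I with hm
  have hχ : ContDiff ℝ ∞ fun t => φ t - m * θ₀ t := hφ1.sub (contDiff_const.mul hθ3)
  have hcs : HasCompactSupport fun t => φ t - m * θ₀ t := hφ2.sub hθ2.mul_left
  have hts : tsupport (fun t => φ t - m * θ₀ t) ⊆ Ioo a b := by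
    refine subset_trans (closure_minimal (t := tsupport φ ∪ tsupport θ₀) ?_
      ((isClosed_tsupport _).union (isClosed_tsupport _))) (union_subset hφ3 hθ1)
    intro t ht
    by_contra h'
    rw [mem_union, not_or] at h'
    exact ht (by simp [image_eq_zero_of_notMem_tsupport h'.1, image_eq_zero_of_notMem_tsupport h'.2])
  have hmean : ∫ t in Ioo a b, (φ t - m * θ₀ t) = 0 := by
    rw [integral_sub (key φ hφ1 hφ2 hφ3).1 ((key θ₀ hθ3 hθ2 hθ1).1.const_mul m), integral_const_mul,
      ← hI, hm, div_mul_cancel₀ _ hpos.ne', sub_self]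
  obtain ⟨ψ, hψ1, hψ2, hψ3, hψ4⟩ := exists_test_primitive hχ hcs hts hab hmean
  have h1 := h ψ hψ1 hψ2 hψ3
  rw [hψ4] at h1
  simp only [sub_smul, mul_smul] at h1
  have h1' : IntegrableOn (fun t => m • θ₀ t • w t) (Ioo a b) :=
    Integrable.smul m (key θ₀ hθ3 hθ2 hθ1).2
  rw [integral_sub (key φ hφ1 hφ2 hφ3).2 h1', integral_smul] at h1
  have h2 : ∫ t, φ t • (w t - c) = ∫ t in Ioo a b, φ t • (w t - c) := by
    symm
    refine setIntegral_eq_integral_of_forall_compl_eq_zero fun t ht => ?_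
    rw [image_eq_zero_of_notMem_tsupport fun h' => ht (hφ3 h'), zero_smul]
  rw [h2]
  simp only [smul_sub]
  rw [integral_sub (key φ hφ1 hφ2 hφ3).2 ((key φ hφ1 hφ2 hφ3).1.smul_const c),
    integral_smul_const, hc, smul_smul, ← div_eq_mul_inv, ← hm]
  exact h1

lemma IsWeakDeriv.exists_primitive {f g : ℝ → X} (h : IsWeakDeriv a b f g)
    (hf : IntegrableOn f (Ioo a b)) (hg : IntegrableOn g (Ioo a b)) (hab : a < b) :
    ∃ c, ∀ᵐ t ∂(volume.restrict (Ioo a b)), f t = c + ∫ τ in a..t, g τ := by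
  have hG : ContinuousOn (fun t => ∫ τ in a..t, g τ) (Icc a b) := by
    have := intervalIntegral.continuousOn_primitive_interval (a := a) (b := b) (μ := volume) (f := g)
      (by rw [uIcc_of_le hab.le]; exact (integrableOn_Icc_iff_integrableOn_Ioo).2 hg)
    rwa [uIcc_of_le hab.le] at this
  have hGi : IntegrableOn (fun t => ∫ τ in a..t, g τ) (Ioo a b) :=
    (hG.integrableOn_compact isCompact_Icc).mono_set Ioo_subset_Icc_self
  suffices hz : ∀ φ : ℝ → ℝ, ContDiff ℝ ∞ φ → HasCompactSupport φ → tsupport φ ⊆ Ioo a b →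
      ∫ t in Ioo a b, deriv φ t • (f t - ∫ τ in a..t, g τ) = 0 by
    obtain ⟨c, hc⟩ := ae_const_of_isWeakDeriv_zero (hf.sub hGi) hab hz
    exact ⟨c, by filter_upwards [hc] with t ht using sub_eq_iff_eq_add.1 ht⟩
  intro φ h1 h2 h3
  have hd : Continuous (deriv φ) := h1.continuous_deriv (by simp)
  obtain ⟨M, hM⟩ := hd.bounded_above_of_compact_support h2.deriv
  have hi : ∀ u : ℝ → X, IntegrableOn u (Ioo a b) →
      IntegrableOn (fun t => deriv φ t • u t) (Ioo a b) := fun u hu =>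
    Integrable.bdd_smul (C := M) hu hd.aestronglyMeasurable (Filter.Eventually.of_forall hM)
  simp only [smul_sub]
  rw [integral_sub (hi _ hf) (hi _ hGi), h φ h1 h2 h3, isWeakDeriv_primitive hg φ h1 h2 h3, sub_self]

/-- `V 0, …, V k` are the successive time derivatives of `V 0`, all but the last one continuous. -/
structure IsTimeJet (k : ℕ) (a b : ℝ) (V : ℕ → ℝ → X) : Prop where
  cont : ∀ j < k, ContinuousOn (V j) (Icc a b)
  memLp : ∀ j ≤ k, MemLp (V j) 2 (volume.restrict (Ioo a b))
  ftc : ∀ j < k, ∀ s ∈ Icc a b, ∀ t ∈ Icc a b, V j t = V j s + ∫ τ in s..t, V (j + 1) τ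

lemma intervalIntegrable_of_memLp {v : ℝ → X} (hv : MemLp v 2 (volume.restrict (Ioo a b)))
    (s t : ℝ) (hs : s ∈ Icc a b) (ht : t ∈ Icc a b) : IntervalIntegrable v volume s t := by
  have h1 : IntegrableOn v (Icc a b) :=
    (integrableOn_Icc_iff_integrableOn_Ioo).2 (hv.integrable (by norm_num))
  exact (h1.mono_set (uIcc_subset_Icc hs ht)).intervalIntegrable

/-- Every derivative below the top order is replaced by its continuous representative, a primitive
of the next one; the top derivative stays merely square integrable. -/
lemma MemHTime.exists_jet {k : ℕ} {u : ℝ → X} (h : MemHTime k a b u) (hk : 0 < k) (hab : a < b) :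
    ∃ V : ℕ → ℝ → X, IsTimeJet k a b V ∧ V 0 =ᵐ[volume.restrict (Ioo a b)] u := by
  obtain ⟨v, hv0, hv1, hv2⟩ := h
  have hi : ∀ j ≤ k, IntegrableOn (v j) (Ioo a b) := fun j hj => (hv1 j hj).integrable (by norm_num)
  choose! c hc using fun (j : ℕ) (hj : j < k) =>
    (hv2 j hj).exists_primitive (hi j hj.le) (hi (j + 1) hj) hab
  set V : ℕ → ℝ → X := fun j => if j < k then fun t => c j + ∫ τ in a..t, v (j + 1) τ else v j with hV
  have hVae : ∀ j ≤ k, V j =ᵐ[volume.restrict (Ioo a b)] v j := by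
    intro j hj
    simp only [hV]
    split_ifs with hjk
    · filter_upwards [hc j hjk] with t ht
      rw [ht]
    · rfl
  have hmem : ∀ j ≤ k, MemLp (V j) 2 (volume.restrict (Ioo a b)) := fun j hj =>
    (memLp_congr_ae (hVae j hj)).2 (hv1 j hj)
  refine ⟨V, ⟨?_, hmem, ?_⟩, (hVae 0 hk.le).trans (by rw [hv0])⟩
  · intro j hj
    simp only [hV, if_pos hj]
    refine continuousOn_const.add ?_
    have := intervalIntegral.continuousOn_primitive_interval (a := a) (b := b) (μ := volume)
      (f := v (j + 1)) (by
        rw [uIcc_of_le hab.le]; exact (integrableOn_Icc_iff_integrableOn_Ioo).2 (hi (j + 1) hj))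
    rwa [uIcc_of_le hab.le] at this
  · intro j hj s hs t ht
    have h1 : ∫ τ in s..t, V (j + 1) τ = ∫ τ in s..t, v (j + 1) τ := by
      refine intervalIntegral.integral_congr_ae ?_
      have h2 := (ae_restrict_iff' measurableSet_Ioo).1 (hVae (j + 1) hj)
      have h3 : ∀ᵐ x : ℝ ∂volume, x ≠ b := Measure.ae_ne volume b
      filter_upwards [h2, h3] with x hx hxb hxs
      refine hx ⟨?_, lt_of_le_of_ne ?_ hxb⟩
      · exact (le_min hs.1 ht.1).trans_lt hxs.1
      · exact hxs.2.trans (max_le hs.2 ht.2)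
    rw [h1]
    simp only [hV, if_pos hj]
    have hmem' := hv1 (j + 1) hj
    have ha : a ∈ Icc a b := ⟨le_rfl, hab.le⟩
    rw [add_assoc, intervalIntegral.integral_add_adjacent_intervals
      (intervalIntegrable_of_memLp hmem' a s ha hs) (intervalIntegrable_of_memLp hmem' s t hs ht)]

end WeakDeriv

/-! ### Taylor estimates in time -/

section Taylor

variable {X : Type*} [NormedAddCommGroup X] [NormedSpace ℝ X] [CompleteSpace X] {a b : ℝ}

/-- Nonnegativity of the variance of `f` around its mean `m`. -/
lemma sq_integral_le {f : ℝ → ℝ} {s t : ℝ} (hst : s ≤ t)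
    (h1 : IntervalIntegrable f volume s t)
    (h2 : IntervalIntegrable (fun τ => f τ ^ 2) volume s t) :
    (∫ τ in s..t, f τ) ^ 2 ≤ (t - s) * ∫ τ in s..t, f τ ^ 2 := by
  rcases hst.eq_or_lt with rfl | hlt
  · simp
  set m := (∫ τ in s..t, f τ) / (t - s) with hm
  have hp : 0 < t - s := sub_pos.2 hlt
  have h3 : 0 ≤ ∫ τ in s..t, (f τ - m) ^ 2 :=
    intervalIntegral.integral_nonneg hst fun τ _ => sq_nonneg _
  have h4 : ∫ τ in s..t, (f τ - m) ^ 2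
      = (∫ τ in s..t, f τ ^ 2) - 2 * m * (∫ τ in s..t, f τ) + m ^ 2 * (t - s) := by
    have : ∀ τ, (f τ - m) ^ 2 = f τ ^ 2 - 2 * m * f τ + m ^ 2 := fun τ => by ring
    simp only [this]
    rw [intervalIntegral.integral_add (h2.sub (h1.const_mul _)) (by simp),
      intervalIntegral.integral_sub h2 (h1.const_mul _), intervalIntegral.integral_const_mul]
    simp; ring
  have h5 : ∫ τ in s..t, f τ = m * (t - s) := by rw [hm]; field_simp
  rw [h4] at h3
  rw [h5] at h3 ⊢
  nlinarith

lemma IsTimeJet.sq_integral_norm_le {k : ℕ} {V : ℕ → ℝ → X} (hV : IsTimeJet k a b V) {j : ℕ}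
    (hj : j ≤ k) {s t : ℝ} (hs : a ≤ s) (hst : s ≤ t) (ht : t ≤ b) :
    (∫ τ in s..t, ‖V j τ‖) ^ 2 ≤ (t - s) * ∫ τ in s..t, ‖V j τ‖ ^ 2 := by
  have hsI : s ∈ Icc a b := ⟨hs, hst.trans ht⟩
  have htI : t ∈ Icc a b := ⟨hs.trans hst, ht⟩
  refine sq_integral_le hst (intervalIntegrable_of_memLp (hV.memLp j hj) s t hsI htI).norm ?_
  have h1 : IntegrableOn (fun τ => ‖V j τ‖ ^ 2) (Ioo a b) := (hV.memLp j hj).integrable_norm_pow (by norm_num)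
  have h2 : IntegrableOn (fun τ => ‖V j τ‖ ^ 2) (Icc a b) :=
    (integrableOn_Icc_iff_integrableOn_Ioo).2 h1
  exact (h2.mono_set (uIcc_subset_Icc hsI htI)).intervalIntegrable

/-- Integrating an estimate `‖B₁(r) - P'(r)‖ ≤ M` from `0`. -/
lemma norm_sub_poly_le {L M : ℝ} {B₀ B₁ : ℝ → X} {p P : ℝ → X}
    (hB : ∀ r ∈ Icc 0 L, B₀ r = B₀ 0 + ∫ τ in 0..r, B₁ τ)
    (hi : ∀ r ∈ Icc 0 L, IntervalIntegrable B₁ volume 0 r)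
    (hp : Continuous p) (hP : ∀ r, HasDerivAt P (p r) r)
    (h : ∀ r ∈ Icc 0 L, ‖B₁ r - p r‖ ≤ M) :
    ∀ r ∈ Icc 0 L, ‖B₀ r - B₀ 0 - (P r - P 0)‖ ≤ M * r := by
  intro r hr
  have h1 : ∫ τ in 0..r, p τ = P r - P 0 :=
    intervalIntegral.integral_eq_sub_of_hasDerivAt (fun x _ => hP x) (hp.intervalIntegrable _ _)
  have h2 : B₀ r - B₀ 0 - (P r - P 0) = ∫ τ in 0..r, (B₁ τ - p τ) := by
    rw [intervalIntegral.integral_sub (hi r hr) (hp.intervalIntegrable _ _), h1, hB r hr]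
    abel
  rw [h2]
  refine (intervalIntegral.norm_integral_le_of_norm_le_const (C := M) fun x hx => ?_).trans ?_
  · rw [uIoc_of_le hr.1] at hx
    exact h x ⟨hx.1.le, hx.2.trans hr.2⟩
  · rw [sub_zero, abs_of_nonneg hr.1]

/-- The derivatives with respect to the reversed time `r = t - τ`. -/
def revJet (V : ℕ → ℝ → X) (t : ℝ) (j : ℕ) (r : ℝ) : X := (-1 : ℝ) ^ j • V j (t - r)

variable {k : ℕ} {V : ℕ → ℝ → X} {t L : ℝ}

lemma IsTimeJet.intervalIntegrable_rev (hV : IsTimeJet k a b V) (hs : a ≤ t - L) (ht : t ≤ b)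
    {j : ℕ} (hj : j ≤ k) {r : ℝ} (hr : r ∈ Icc 0 L) :
    IntervalIntegrable (revJet V t j) volume 0 r := by
  have h1 := intervalIntegrable_of_memLp (hV.memLp j hj) t (t - r)
    ⟨by linarith [hr.1, hr.2], ht⟩ ⟨by linarith [hr.2], by linarith [hr.1]⟩
  have h2 := h1.comp_sub_left t
  simp only [sub_self, sub_sub_cancel] at h2
  exact h2.smul ((-1 : ℝ) ^ j)

lemma IsTimeJet.revJet_eq (hV : IsTimeJet k a b V) (hs : a ≤ t - L) (ht : t ≤ b)
    {j : ℕ} (hj : j < k) {r : ℝ} (hr : r ∈ Icc 0 L) :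
    revJet V t j r = revJet V t j 0 + ∫ τ in 0..r, revJet V t (j + 1) τ := by
  have h1 := hV.ftc j hj (t - r) ⟨by linarith [hr.2], by linarith [hr.1]⟩ t
    ⟨by linarith [hr.1, hr.2], ht⟩
  simp only [revJet, sub_zero]
  rw [intervalIntegral.integral_smul, intervalIntegral.integral_comp_sub_left (V (j + 1)) t, sub_zero,
    h1, pow_succ]
  simp

/-- Start of the Taylor expansions in reversed time. Each further order is obtained by integrating
the previous remainder. The bounds always use the integral of the top derivative over the whole
stencil `[t - L, t]`, so that the remainders at different nodes can be added. -/
lemma IsTimeJet.taylor_one (hV : IsTimeJet k a b V) (hs : a ≤ t - L) (ht : t ≤ b)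
    {j : ℕ} (hj : j < k) {r : ℝ} (hr : r ∈ Icc 0 L) :
    ‖revJet V t j r - revJet V t j 0‖ ≤ ∫ τ in (t - L)..t, ‖V (j + 1) τ‖ := by
  rw [hV.revJet_eq hs ht hj hr, add_sub_cancel_left]
  refine (intervalIntegral.norm_integral_le_integral_norm hr.1).trans ?_
  have h1 : ∀ τ, ‖revJet V t (j + 1) τ‖ = ‖V (j + 1) (t - τ)‖ := fun τ => by
    rw [revJet, norm_smul]; simp
  simp only [h1]
  rw [intervalIntegral.integral_comp_sub_left (fun τ => ‖V (j + 1) τ‖) t, sub_zero]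
  refine intervalIntegral.integral_mono_interval (by linarith [hr.2]) (by linarith [hr.1]) le_rfl
    (Filter.Eventually.of_forall fun _ => norm_nonneg _) ?_
  exact (intervalIntegrable_of_memLp (hV.memLp (j + 1) hj) _ _
    ⟨hs, by linarith [hr.1, hr.2]⟩ ⟨by linarith [hr.1, hr.2], ht⟩).norm

lemma IsTimeJet.taylor_two (hV : IsTimeJet k a b V) (hs : a ≤ t - L) (ht : t ≤ b)
    {j : ℕ} (hj : j + 1 < k) {r : ℝ} (hr : r ∈ Icc 0 L) :
    ‖revJet V t j r - revJet V t j 0 - r • revJet V t (j + 1) 0‖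
      ≤ (∫ τ in (t - L)..t, ‖V (j + 2) τ‖) * r := by
  have h := norm_sub_poly_le (p := fun _ => revJet V t (j + 1) 0)
    (P := fun r => r • revJet V t (j + 1) 0)
    (fun r hr => hV.revJet_eq hs ht (by omega : j < k) hr)
    (fun r hr => hV.intervalIntegrable_rev hs ht (by omega : j + 1 ≤ k) hr)
    continuous_const (fun r => by simpa using (hasDerivAt_id r).smul_const (revJet V t (j + 1) 0))
    (fun r hr => hV.taylor_one hs ht hj hr) r hr
  simpa using h

lemma IsTimeJet.taylor_three (hV : IsTimeJet k a b V) (hs : a ≤ t - L) (ht : t ≤ b)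
    {j : ℕ} (hj : j + 2 < k) {r : ℝ} (hr : r ∈ Icc 0 L) :
    ‖revJet V t j r - revJet V t j 0 - (r • revJet V t (j + 1) 0 + (r ^ 2 / 2) • revJet V t (j + 2) 0)‖
      ≤ (∫ τ in (t - L)..t, ‖V (j + 3) τ‖) * L * r := by
  have hJ : 0 ≤ ∫ τ in (t - L)..t, ‖V (j + 3) τ‖ :=
    intervalIntegral.integral_nonneg (by linarith [hr.1, hr.2]) fun _ _ => norm_nonneg _
  have h := norm_sub_poly_le (p := fun r => revJet V t (j + 1) 0 + r • revJet V t (j + 2) 0)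
    (P := fun r => r • revJet V t (j + 1) 0 + (r ^ 2 / 2) • revJet V t (j + 2) 0)
    (fun r hr => hV.revJet_eq hs ht (by omega : j < k) hr)
    (fun r hr => hV.intervalIntegrable_rev hs ht (by omega : j + 1 ≤ k) hr)
    (by fun_prop) (fun r => by
      have h1 := (hasDerivAt_id r).smul_const (revJet V t (j + 1) 0)
      have h2 := (((hasDerivAt_id r).pow 2).div_const 2).smul_const (revJet V t (j + 2) 0)
      convert! h1.add h2 using 1
      simp)
    (M := (∫ τ in (t - L)..t, ‖V (j + 3) τ‖) * L)
    (fun r hr => by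
      rw [← sub_sub]
      exact (hV.taylor_two hs ht hj hr).trans (mul_le_mul_of_nonneg_left hr.2 hJ)) r hr
  simpa using h

lemma IsTimeJet.taylor_four (hV : IsTimeJet k a b V) (hs : a ≤ t - L) (ht : t ≤ b)
    {j : ℕ} (hj : j + 3 < k) {r : ℝ} (hr : r ∈ Icc 0 L) :
    ‖revJet V t j r - revJet V t j 0 - (r • revJet V t (j + 1) 0 + (r ^ 2 / 2) • revJet V t (j + 2) 0
        + (r ^ 3 / 6) • revJet V t (j + 3) 0)‖
      ≤ (∫ τ in (t - L)..t, ‖V (j + 4) τ‖) * L * L * r := by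
  have hL : 0 ≤ L := hr.1.trans hr.2
  have hJ : 0 ≤ ∫ τ in (t - L)..t, ‖V (j + 4) τ‖ :=
    intervalIntegral.integral_nonneg (by linarith [hr.1, hr.2]) fun _ _ => norm_nonneg _
  have h := norm_sub_poly_le
    (p := fun r => revJet V t (j + 1) 0 + (r • revJet V t (j + 2) 0
      + (r ^ 2 / 2) • revJet V t (j + 3) 0))
    (P := fun r => r • revJet V t (j + 1) 0 + (r ^ 2 / 2) • revJet V t (j + 2) 0
      + (r ^ 3 / 6) • revJet V t (j + 3) 0)
    (fun r hr => hV.revJet_eq hs ht (by omega : j < k) hr)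
    (fun r hr => hV.intervalIntegrable_rev hs ht (by omega : j + 1 ≤ k) hr)
    (by fun_prop) (fun r => by
      have h1 := (hasDerivAt_id r).smul_const (revJet V t (j + 1) 0)
      have h2 := (((hasDerivAt_id r).pow 2).div_const 2).smul_const (revJet V t (j + 2) 0)
      have h3 := (((hasDerivAt_id r).pow 3).div_const 6).smul_const (revJet V t (j + 3) 0)
      convert! (h1.add h2).add h3 using 1
      simp only [id, one_smul, add_assoc]
      congr 2
      · simp
      · congr 1; norm_num; ring)
    (M := (∫ τ in (t - L)..t, ‖V (j + 4) τ‖) * L * L)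
    (fun r hr => by
      rw [← sub_sub]
      exact (hV.taylor_three hs ht hj hr).trans
        (mul_le_mul_of_nonneg_left hr.2 (mul_nonneg hJ hL))) r hr
  simpa using h

lemma norm_lincomb_three_le (c₁ c₂ c₃ : ℝ) (x y z : X) :
    ‖c₁ • x + c₂ • y + c₃ • z‖ ≤ |c₁| * ‖x‖ + |c₂| * ‖y‖ + |c₃| * ‖z‖ := by
  refine (norm_add₃_le).trans ?_
  simp only [norm_smul, Real.norm_eq_abs, le_refl]

/-- The BDF3 weights annihilate the Taylor terms of orders 0, 2 and 3 and reproduce `d • V 1 t`, so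
only three remainders survive. Their sum is `63 d³` times the integral; the constant 135 is
generous. -/
lemma IsTimeJet.bdf_error (hV : IsTimeJet 4 a b V) {d : ℝ} (hd : 0 ≤ d) (hs : a ≤ t - 3 * d)
    (ht : t ≤ b) :
    ‖(11 / 6 : ℝ) • V 0 t - (3 : ℝ) • V 0 (t - d) + (3 / 2 : ℝ) • V 0 (t - 2 * d)
        - (1 / 3 : ℝ) • V 0 (t - 3 * d) - d • V 1 t‖
      ≤ 135 * d ^ 3 * ∫ τ in (t - 3 * d)..t, ‖V 4 τ‖ := by
  have hJ : 0 ≤ ∫ τ in (t - 3 * d)..t, ‖V 4 τ‖ :=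
    intervalIntegral.integral_nonneg (by linarith) fun _ _ => norm_nonneg _
  have h1 := hV.taylor_four hs ht (j := 0) (by norm_num) (r := d) ⟨hd, by linarith⟩
  have h2 := hV.taylor_four hs ht (j := 0) (by norm_num) (r := 2 * d) ⟨by linarith, by linarith⟩
  have h3 := hV.taylor_four hs ht (j := 0) (by norm_num) (r := 3 * d) ⟨by linarith, by linarith⟩
  simp only [revJet, sub_zero, zero_add, pow_zero, one_smul, pow_one] at h1 h2 h3
  set J := ∫ τ in (t - 3 * d)..t, ‖V 4 τ‖
  have key := norm_lincomb_three_le (-3) (3 / 2) (-(1 / 3))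
    (V 0 (t - d) - V 0 t - (d • (-1 : ℝ) • V 1 t + (d ^ 2 / 2) • (-1 : ℝ) ^ 2 • V 2 t
      + (d ^ 3 / 6) • (-1 : ℝ) ^ 3 • V 3 t))
    (V 0 (t - 2 * d) - V 0 t - ((2 * d) • (-1 : ℝ) • V 1 t + ((2 * d) ^ 2 / 2) • (-1 : ℝ) ^ 2 • V 2 t
      + ((2 * d) ^ 3 / 6) • (-1 : ℝ) ^ 3 • V 3 t))
    (V 0 (t - 3 * d) - V 0 t - ((3 * d) • (-1 : ℝ) • V 1 t + ((3 * d) ^ 2 / 2) • (-1 : ℝ) ^ 2 • V 2 t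
      + ((3 * d) ^ 3 / 6) • (-1 : ℝ) ^ 3 • V 3 t))
  calc _ = _ := ?_
    _ ≤ _ := key
    _ ≤ 3 * (J * (3 * d) * (3 * d) * d) + 3 / 2 * (J * (3 * d) * (3 * d) * (2 * d))
        + 1 / 3 * (J * (3 * d) * (3 * d) * (3 * d)) := by
      rw [show |(-3 : ℝ)| = 3 by norm_num, show |(3 / 2 : ℝ)| = 3 / 2 by norm_num,
        show |(-(1 / 3) : ℝ)| = 1 / 3 by norm_num]
      gcongr
    _ ≤ 135 * d ^ 3 * J := by nlinarith [mul_nonneg hJ (pow_nonneg hd 3)]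
  congr 1
  module

/-- Polynomials of degree two are annihilated. The constant is `3·3 + 3·6 + 9 = 36`. -/
lemma IsTimeJet.third_difference (hV : IsTimeJet 3 a b V) {d : ℝ} (hd : 0 ≤ d)
    (hs : a ≤ t - 3 * d) (ht : t ≤ b) :
    ‖V 0 t - (3 : ℝ) • V 0 (t - d) + (3 : ℝ) • V 0 (t - 2 * d) - V 0 (t - 3 * d)‖
      ≤ 36 * d ^ 2 * ∫ τ in (t - 3 * d)..t, ‖V 3 τ‖ := by
  have hJ : 0 ≤ ∫ τ in (t - 3 * d)..t, ‖V 3 τ‖ :=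
    intervalIntegral.integral_nonneg (by linarith) fun _ _ => norm_nonneg _
  have h1 := hV.taylor_three hs ht (j := 0) (by norm_num) (r := d) ⟨hd, by linarith⟩
  have h2 := hV.taylor_three hs ht (j := 0) (by norm_num) (r := 2 * d) ⟨by linarith, by linarith⟩
  have h3 := hV.taylor_three hs ht (j := 0) (by norm_num) (r := 3 * d) ⟨by linarith, by linarith⟩
  simp only [revJet, sub_zero, zero_add, pow_zero, one_smul, pow_one] at h1 h2 h3
  set J := ∫ τ in (t - 3 * d)..t, ‖V 3 τ‖
  have key := norm_lincomb_three_le (-3) 3 (-1)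
    (V 0 (t - d) - V 0 t - (d • (-1 : ℝ) • V 1 t + (d ^ 2 / 2) • (-1 : ℝ) ^ 2 • V 2 t))
    (V 0 (t - 2 * d) - V 0 t - ((2 * d) • (-1 : ℝ) • V 1 t
      + ((2 * d) ^ 2 / 2) • (-1 : ℝ) ^ 2 • V 2 t))
    (V 0 (t - 3 * d) - V 0 t - ((3 * d) • (-1 : ℝ) • V 1 t
      + ((3 * d) ^ 2 / 2) • (-1 : ℝ) ^ 2 • V 2 t))
  calc _ = _ := ?_
    _ ≤ _ := key
    _ ≤ 3 * (J * (3 * d) * d) + 3 * (J * (3 * d) * (2 * d)) + 1 * (J * (3 * d) * (3 * d)) := by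
      rw [show |(-3 : ℝ)| = 3 by norm_num, show |(3 : ℝ)| = 3 by norm_num,
        show |(-1 : ℝ)| = 1 by norm_num]
      gcongr
    _ ≤ 36 * d ^ 2 * J := by nlinarith [mul_nonneg hJ (pow_nonneg hd 2)]
  congr 1
  module

lemma IsTimeJet.exists_bound (hV : IsTimeJet k a b V) {j : ℕ} (hj : j < k) :
    ∃ M, 0 ≤ M ∧ ∀ t ∈ Icc a b, ‖V j t‖ ≤ M := by
  obtain ⟨M, hM⟩ := isCompact_Icc.exists_bound_of_continuousOn (hV.cont j hj)
  exact ⟨max M 0, le_max_right _ _, fun t ht => (hM t ht).trans (le_max_left _ _)⟩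

/-- A uniform bound on the second derivative is used instead of an integral one: this difference
later enters a product and needs the full power `d²` at every time. -/
lemma IsTimeJet.second_difference (hV : IsTimeJet 3 a b V) {M : ℝ}
    (hM : ∀ t ∈ Icc a b, ‖V 2 t‖ ≤ M) {d : ℝ} (hd : 0 ≤ d) (hs : a ≤ t - 2 * d) (ht : t ≤ b) :
    ‖V 0 t - (2 : ℝ) • V 0 (t - d) + V 0 (t - 2 * d)‖ ≤ 8 * d ^ 2 * M := by
  have hJ : ∫ τ in (t - 2 * d)..t, ‖V 2 τ‖ ≤ 2 * d * M := by
    have h := intervalIntegral.norm_integral_le_of_norm_le_const (a := t - 2 * d) (b := t) (C := M)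
      (f := fun τ => ‖V 2 τ‖) fun x hx => by
        rw [uIoc_of_le (by linarith)] at hx
        rw [norm_norm]
        exact hM x ⟨by linarith [hx.1], hx.2.trans ht⟩
    rw [sub_sub_cancel, abs_of_nonneg (by linarith)] at h
    exact (le_abs_self _).trans (h.trans (by linarith))
  have h1 := hV.taylor_two hs ht (j := 0) (by norm_num) (r := d) ⟨hd, by linarith⟩
  have h2 := hV.taylor_two hs ht (j := 0) (by norm_num) (r := 2 * d) ⟨by linarith, by linarith⟩
  simp only [revJet, sub_zero, zero_add, pow_zero, one_smul, pow_one] at h1 h2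
  set J := ∫ τ in (t - 2 * d)..t, ‖V 2 τ‖
  have key := norm_lincomb_three_le (-2) 1 0 (V 0 (t - d) - V 0 t - d • (-1 : ℝ) • V 1 t)
    (V 0 (t - 2 * d) - V 0 t - (2 * d) • (-1 : ℝ) • V 1 t) (0 : X)
  calc _ = _ := ?_
    _ ≤ _ := key
    _ ≤ 2 * (J * d) + 1 * (J * (2 * d)) + 0 := by
      rw [show |(-2 : ℝ)| = 2 by norm_num, show |(1 : ℝ)| = 1 by norm_num]
      simp only [abs_zero, zero_mul]
      gcongr
    _ ≤ 8 * d ^ 2 * M := by nlinarith [mul_le_mul_of_nonneg_right hJ hd]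
  congr 1
  module

lemma IsTimeJet.norm_sub_le (hV : IsTimeJet k a b V) {j : ℕ} (hj : j < k) {s : ℝ} (hs : a ≤ s)
    (hst : s ≤ t) (ht : t ≤ b) : ‖V j t - V j s‖ ≤ ∫ τ in s..t, ‖V (j + 1) τ‖ := by
  rw [hV.ftc j hj s ⟨hs, hst.trans ht⟩ t ⟨hs.trans hst, ht⟩, add_sub_cancel_left]
  exact intervalIntegral.norm_integral_le_integral_norm hst

lemma IsTimeJet.norm_sub_le_mul (hV : IsTimeJet k a b V) {j : ℕ} (hj : j < k) {M : ℝ}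
    (hM : ∀ t ∈ Icc a b, ‖V (j + 1) t‖ ≤ M) {s : ℝ} (hs : a ≤ s) (hst : s ≤ t) (ht : t ≤ b) :
    ‖V j t - V j s‖ ≤ M * (t - s) := by
  rw [hV.ftc j hj s ⟨hs, hst.trans ht⟩ t ⟨hs.trans hst, ht⟩, add_sub_cancel_left]
  refine (intervalIntegral.norm_integral_le_of_norm_le_const (C := M) fun x hx => ?_).trans ?_
  · rw [uIoc_of_le hst] at hx
    exact hM x ⟨by linarith [hx.1], hx.2.trans ht⟩
  · rw [abs_of_nonneg (by linarith)]

end Taylor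

/-! ### Fourier coefficients on the torus -/

instance : IsProbabilityMeasure torusMeasure := by unfold torusMeasure; infer_instance

instance : torusMeasure.IsAddHaarMeasure := by unfold torusMeasure; infer_instance

/-- The complexification of a real continuous function. -/
def cplx (f : C(Torus, ℝ)) : C(Torus, ℂ) := ⟨fun x => (f x : ℂ), by fun_prop⟩

lemma fCoeff_eq (f : C(Torus, ℝ)) (k : Fin 2 → ℤ) :
    fCoeff f k = ∫ x, UnitAddTorus.mFourier (-k) x * (f x : ℂ) ∂torusMeasure := rfl

lemma continuous_integrable {E : Type*} [NormedAddCommGroup E] [SecondCountableTopology E]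
    {g : Torus → E} (hg : Continuous g) : Integrable g torusMeasure :=
  hg.integrable_of_hasCompactSupport (HasCompactSupport.of_compactSpace g)

/-- The Fourier coefficient as a continuous linear functional. -/
def fCoeffL (k : Fin 2 → ℤ) : C(Torus, ℝ) →L[ℝ] ℂ :=
  LinearMap.mkContinuous
    { toFun := fun f => fCoeff f k
      map_add' := fun f g => by
        simp only [fCoeff_eq, ContinuousMap.add_apply, Complex.ofReal_add, mul_add]
        exact integral_add (continuous_integrable (by fun_prop)) (continuous_integrable (by fun_prop))
      map_smul' := fun r f => by
        simp only [fCoeff_eq, ContinuousMap.smul_apply, smul_eq_mul, Complex.ofReal_mul,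
          RingHom.id_apply, Complex.real_smul]
        rw [← integral_const_mul]
        congr 1; ext x; ring } 1 (fun f => by
      simp only [LinearMap.coe_mk, AddHom.coe_mk, fCoeff_eq, one_mul]
      refine (norm_integral_le_of_norm_le_const (C := ‖f‖)
        (Filter.Eventually.of_forall fun x => ?_)).trans (by simp)
      rw [norm_mul, Complex.norm_real]
      have h1 : ‖UnitAddTorus.mFourier (-k) x‖ ≤ 1 :=
        (ContinuousMap.norm_coe_le_norm _ x).trans UnitAddTorus.mFourier_norm.le
      calc _ ≤ 1 * ‖f‖ := mul_le_mul h1 (f.norm_coe_le_norm x) (norm_nonneg _) zero_le_one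
        _ = _ := one_mul _)

lemma fCoeffL_apply (k : Fin 2 → ℤ) (f : C(Torus, ℝ)) : fCoeffL k f = fCoeff f k := rfl

lemma norm_mFourier_apply (k : Fin 2 → ℤ) (x : Torus) : ‖UnitAddTorus.mFourier k x‖ = 1 := by
  simp only [UnitAddTorus.mFourier, fourier_apply, ContinuousMap.coe_mk, norm_prod, Circle.norm_coe,
    Finset.prod_const_one]

lemma fCoeff_isHerm (f : C(Torus, ℝ)) : IsHerm (fCoeff f) := by
  intro k
  rw [fCoeff_eq, fCoeff_eq, ← integral_conj]
  congr 1; ext x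
  rw [map_mul, conj_mFourier, Complex.conj_ofReal]

/-- Bessel's inequality; the torus has measure one, so the supremum norm dominates the L² norm. -/
lemma sum_norm_fCoeff_sq_le (f : C(Torus, ℝ)) (S : Finset (Fin 2 → ℤ)) :
    ∑ k ∈ S, ‖fCoeff f k‖ ^ 2 ≤ ‖f‖ ^ 2 := by
  have h0 : ∀ k, fCoeff f k = UnitAddTorus.mFourierCoeff
      (ContinuousMap.toLp (E := ℂ) 2 torusMeasure ℂ (cplx f)) k :=
    fun k => (UnitAddTorus.mFourierCoeff_toLp (cplx f) k).symm
  have h1 : HasSum (fun k => ‖fCoeff f k‖ ^ 2)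
      (∫ x, ‖(ContinuousMap.toLp (E := ℂ) 2 torusMeasure ℂ (cplx f)) x‖ ^ 2 ∂torusMeasure) := by
    simp only [h0]
    exact UnitAddTorus.hasSum_sq_mFourierCoeff (d := Fin 2)
      (ContinuousMap.toLp (E := ℂ) 2 torusMeasure ℂ (cplx f))
  refine (sum_le_hasSum S (fun _ _ => sq_nonneg _) h1).trans ?_
  have h2 := ContinuousMap.coeFn_toLp (p := 2) (𝕜 := ℂ) torusMeasure (cplx f)
  have h3 : ∫ x, ‖(ContinuousMap.toLp (E := ℂ) 2 torusMeasure ℂ (cplx f)) x‖ ^ 2 ∂torusMeasure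
      = ∫ x, ‖f x‖ ^ 2 ∂torusMeasure := by
    refine integral_congr_ae ?_
    filter_upwards [h2] with x hx
    rw [hx]; simp [cplx]
  refine h3.le.trans ?_
  calc ∫ x, ‖f x‖ ^ 2 ∂torusMeasure ≤ ∫ _, ‖f‖ ^ 2 ∂torusMeasure := by
        refine integral_mono (continuous_integrable (by fun_prop)) (integrable_const _) fun x => ?_
        exact pow_le_pow_left₀ (norm_nonneg _) (f.norm_coe_le_norm x) 2
    _ = ‖f‖ ^ 2 := by simp

lemma hasSum_fCoeff {f : C(Torus, ℝ)} (h : Summable fun k => ‖fCoeff f k‖) (x : Torus) :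
    HasSum (fun k => fCoeff f k * UnitAddTorus.mFourier k x) (f x : ℂ) :=
  UnitAddTorus.hasSum_mFourier_series_apply_of_summable (f := cplx f) h.of_norm x

/-- Translation of a function on the torus. -/
def translate (y : Torus) (f : C(Torus, ℝ)) : C(Torus, ℝ) := ⟨fun x => f (x + y), by fun_prop⟩

lemma mFourier_apply_add (k : Fin 2 → ℤ) (x y : Torus) :
    UnitAddTorus.mFourier k (x + y) = UnitAddTorus.mFourier k x * UnitAddTorus.mFourier k y := by
  simp only [UnitAddTorus.mFourier, ContinuousMap.coe_mk, ← Finset.prod_mul_distrib, Pi.add_apply,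
    fourier_apply, smul_add, AddCircle.toCircle_add, Circle.coe_mul]

lemma fCoeff_translate (y : Torus) (f : C(Torus, ℝ)) (k : Fin 2 → ℤ) :
    fCoeff (translate y f) k = UnitAddTorus.mFourier k y * fCoeff f k := by
  rw [fCoeff_eq, fCoeff_eq,
    ← integral_add_right_eq_self (fun x => UnitAddTorus.mFourier (-k) x * (f x : ℂ)) y,
    ← integral_const_mul]
  congr 1; ext x
  have h : UnitAddTorus.mFourier k y * UnitAddTorus.mFourier (-k) y = 1 := by
    rw [← UnitAddTorus.mFourier_add]; simp [UnitAddTorus.mFourier_zero]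
  rw [mFourier_apply_add]
  simp only [translate, ContinuousMap.coe_mk]
  linear_combination (-(UnitAddTorus.mFourier (-k) x * (f (x + y) : ℂ))) * h

lemma mFourier_single_coe (k : Fin 2 → ℤ) (i : Fin 2) (r : ℝ) :
    UnitAddTorus.mFourier k (Pi.single i (r : UnitAddCircle) : Torus)
      = Complex.exp (symD i k * r) := by
  have h : UnitAddTorus.mFourier k (Pi.single i (r : UnitAddCircle) : Torus)
      = fourier (k i) (r : UnitAddCircle) := by
    simp only [UnitAddTorus.mFourier, ContinuousMap.coe_mk]
    rw [Finset.prod_eq_single i]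
    · rw [Pi.single_eq_same]
    · intro j _ hj
      rw [Pi.single_eq_of_ne hj, fourier_eval_zero]
    · simp
  rw [h, fourier_coe_apply, symD]
  congr 1
  push_cast
  ring

/-! ### Weights -/

/-- The weight `1 + |k|²`. -/
def wt (k : Fin 2 → ℤ) : ℝ := 1 + ∑ i, (k i : ℝ) ^ 2

lemma one_le_wt (k : Fin 2 → ℤ) : 1 ≤ wt k := by
  unfold wt; nlinarith [Finset.sum_nonneg fun i (_ : i ∈ Finset.univ) => sq_nonneg (k i : ℝ)]

lemma wt_pos (k : Fin 2 → ℤ) : 0 < wt k := zero_lt_one.trans_le (one_le_wt k)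

lemma norm_symD_sq_sum (k : Fin 2 → ℤ) : ∑ i, ‖symD i k‖ ^ 2 = 4 * Real.pi ^ 2 * (wt k - 1) := by
  simp only [symD, wt, norm_mul, Complex.norm_I, Complex.norm_intCast, Complex.norm_real,
    Complex.norm_ofNat, Real.norm_eq_abs, mul_pow, sq_abs, add_sub_cancel_left, Finset.mul_sum]
  exact Finset.sum_congr rfl fun i _ => by ring

lemma norm_symD_sq_le (i : Fin 2) (k : Fin 2 → ℤ) : ‖symD i k‖ ^ 2 ≤ 4 * Real.pi ^ 2 * wt k := by
  have h1 := norm_symD_sq_sum k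
  have h2 := Finset.single_le_sum (fun j _ => sq_nonneg ‖symD j k‖) (Finset.mem_univ i)
  nlinarith [Real.pi_pos, sq_nonneg Real.pi]

lemma norm_symL (k : Fin 2 → ℤ) : ‖symL k‖ = 4 * Real.pi ^ 2 * (wt k - 1) := by
  rw [← norm_symD_sq_sum, ← sum_symD_sq]
  simp only [Fin.sum_univ_two, ← norm_pow]
  have : ∀ i, symD i k ^ 2 = ((-(4 * Real.pi ^ 2 * (k i : ℝ) ^ 2) : ℝ) : ℂ) := fun i => by
    simp only [symD]; push_cast; ring_nf; rw [Complex.I_sq]; ring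
  rw [this 0, this 1, ← Complex.ofReal_add, Complex.norm_real, Complex.norm_real, Complex.norm_real]
  simp only [Real.norm_eq_abs]
  rw [abs_of_nonpos (by nlinarith [mul_nonneg (sq_nonneg Real.pi) (sq_nonneg (k 0 : ℝ)), mul_nonneg (sq_nonneg Real.pi) (sq_nonneg (k 1 : ℝ))]),
    abs_of_nonpos (by nlinarith [mul_nonneg (sq_nonneg Real.pi) (sq_nonneg (k 0 : ℝ))]),
    abs_of_nonpos (by nlinarith [mul_nonneg (sq_nonneg Real.pi) (sq_nonneg (k 1 : ℝ))])]
  ring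

lemma wt_ge_of_notMem_freq {K : ℕ} {k : Fin 2 → ℤ} (hk : k ∉ freq K) : ((K : ℝ) + 1) ^ 2 ≤ wt k := by
  have h1 : ∃ i, (K : ℤ) + 1 ≤ |k i| := by
    by_contra h
    push Not at h
    refine hk (mem_freq.2 fun i => ?_)
    have := h i
    rw [← abs_le]
    omega
  obtain ⟨i, hi⟩ := h1
  have h2 : (K : ℝ) + 1 ≤ |(k i : ℝ)| := by exact_mod_cast hi
  have h3 := Finset.single_le_sum (fun j _ => sq_nonneg (k j : ℝ)) (Finset.mem_univ i)
  have h4 : ((K : ℝ) + 1) ^ 2 ≤ (k i : ℝ) ^ 2 := by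
    rw [← sq_abs (k i : ℝ)]; gcongr
  unfold wt
  linarith

lemma card_freq (K : ℕ) : (freq K).card = (2 * K + 1) ^ 2 := by
  simp [freq]
  omega

lemma freq_mono {K M : ℕ} (h : K ≤ M) : freq K ⊆ freq M := by
  intro k hk
  rw [mem_freq] at *
  intro i
  have := hk i
  omega

/-- The shell between `freq M` and `freq (M + 1)` has `8(M + 1)` points, each with weight at least
`(M + 1)²`. Comparison with the telescoping quantity `meshSize²` gives the tail in the form in which
it is needed. -/
lemma sum_wt_shell (K : ℕ) (n : ℕ) :
    ∑ k ∈ freq (K + n) \ freq K, (wt k ^ 2)⁻¹ ≤ 16 * (meshSize K ^ 2 - meshSize (K + n) ^ 2) := by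
  induction n with
  | zero => simp
  | succ n ih =>
    set M := K + n with hM
    have h1 : freq (M + 1) \ freq K = (freq M \ freq K) ∪ (freq (M + 1) \ freq M) :=
      by rw [Finset.union_comm, Finset.sdiff_union_sdiff_cancel (freq_mono (Nat.le_succ M))
          (freq_mono (by omega))]
    have h2 : ∑ k ∈ freq (M + 1) \ freq M, (wt k ^ 2)⁻¹ ≤ 8 * (M + 1) * (((M + 1 : ℝ) ^ 2) ^ 2)⁻¹ := by
      have h3 : ((freq (M + 1) \ freq M).card : ℝ) = 8 * (M + 1) := by
        rw [Finset.card_sdiff_of_subset (freq_mono (Nat.le_succ M)), card_freq, card_freq,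
          Nat.cast_sub (by gcongr; omega)]
        push_cast; ring
      rw [← h3, ← nsmul_eq_mul]
      refine Finset.sum_le_card_nsmul _ _ _ fun k hk => ?_
      have := wt_ge_of_notMem_freq (Finset.mem_sdiff.1 hk).2
      gcongr
    -- This rests on `(2M+1)(2M+3) ≤ 4(M+1)²`.
    have h4 : 8 * ((M : ℝ) + 1) * (((M + 1 : ℝ) ^ 2) ^ 2)⁻¹
        ≤ 16 * (meshSize M ^ 2 - meshSize (M + 1) ^ 2) := by
      have e : 16 * (meshSize M ^ 2 - meshSize (M + 1) ^ 2)
          = 128 * ((M : ℝ) + 1) / ((2 * M + 1) * (2 * M + 3)) ^ 2 := by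
        unfold meshSize; push_cast; field_simp; ring
      rw [e, ← div_eq_mul_inv, div_le_div_iff₀ (by positivity) (by positivity)]
      have hx : (0 : ℝ) ≤ M := by positivity
      have : ((2 * (M : ℝ) + 1) * (2 * M + 3)) ≤ 4 * ((M : ℝ) + 1) ^ 2 := by nlinarith
      have h5 : ((2 * (M : ℝ) + 1) * (2 * M + 3)) ^ 2 ≤ (4 * ((M : ℝ) + 1) ^ 2) ^ 2 := by gcongr
      nlinarith [mul_le_mul_of_nonneg_left h5 (by positivity : 0 ≤ 8 * ((M : ℝ) + 1))]
    have hd : Disjoint (freq M \ freq K) (freq (M + 1) \ freq M) :=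
      Finset.disjoint_left.2 fun k hk hk' => (Finset.mem_sdiff.1 hk').2 (Finset.mem_sdiff.1 hk).1
    rw [← add_assoc, ← hM, h1, Finset.sum_union hd]
    linarith

lemma exists_subset_freq (S : Finset (Fin 2 → ℤ)) (K : ℕ) : ∃ n, S ⊆ freq (K + n) := by
  refine ⟨∑ k ∈ S, ∑ i, (k i).natAbs, fun k hk => mem_freq.2 fun i => ?_⟩
  have h1 : (k i).natAbs ≤ ∑ i, (k i).natAbs :=
    Finset.single_le_sum (f := fun i => (k i).natAbs) (fun _ _ => Nat.zero_le _) (Finset.mem_univ i)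
  have h2 : ∑ i, (k i).natAbs ≤ ∑ k ∈ S, ∑ i, (k i).natAbs :=
    Finset.single_le_sum (f := fun k : Fin 2 → ℤ => ∑ i, (k i).natAbs) (fun _ _ => Nat.zero_le _) hk
  set n := ∑ k ∈ S, ∑ i, (k i).natAbs
  omega

lemma sum_wt_tail {K : ℕ} {S : Finset (Fin 2 → ℤ)} (hS : Disjoint S (freq K)) :
    ∑ k ∈ S, (wt k ^ 2)⁻¹ ≤ 16 * meshSize K ^ 2 := by
  obtain ⟨n, hn⟩ := exists_subset_freq S K
  calc ∑ k ∈ S, (wt k ^ 2)⁻¹ ≤ ∑ k ∈ freq (K + n) \ freq K, (wt k ^ 2)⁻¹ := by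
        refine Finset.sum_le_sum_of_subset_of_nonneg ?_ fun _ _ _ => by positivity
        exact fun k hk => Finset.mem_sdiff.2 ⟨hn hk, Finset.disjoint_left.1 hS hk⟩
    _ ≤ _ := sum_wt_shell K n
    _ ≤ _ := by nlinarith [sq_nonneg (meshSize (K + n))]

/-- The value 17 is the tail constant 16 at `K = 0` plus 1 for the zero mode. -/
lemma sum_wt_le (S : Finset (Fin 2 → ℤ)) : ∑ k ∈ S, (wt k ^ 2)⁻¹ ≤ 17 := by
  have h0 : freq 0 = {0} := by
    ext k
    rw [mem_freq, Finset.mem_singleton]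
    constructor
    · intro h; ext i; have := h i; simp at this ⊢; omega
    · rintro rfl; simp
  rw [← Finset.sum_inter_add_sum_sdiff S (freq 0)]
  have h1 : ∑ k ∈ S \ freq 0, (wt k ^ 2)⁻¹ ≤ 16 := by
    have := sum_wt_tail (S := S \ freq 0) (K := 0) Finset.sdiff_disjoint
    simpa [meshSize] using this
  have h2 : ∑ k ∈ S ∩ freq 0, (wt k ^ 2)⁻¹ ≤ 1 := by
    calc _ ≤ ∑ k ∈ freq 0, (wt k ^ 2)⁻¹ :=
          Finset.sum_le_sum_of_subset_of_nonneg Finset.inter_subset_right fun _ _ _ => by positivity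
      _ = 1 := by rw [h0]; simp [wt]
  linarith

/-- Cauchy–Schwarz with the weight `wt ^ 2`. -/
lemma sq_sum_le_wt (S : Finset (Fin 2 → ℤ)) (x : (Fin 2 → ℤ) → ℝ) :
    (∑ k ∈ S, x k) ^ 2 ≤ (∑ k ∈ S, (wt k ^ 2)⁻¹) * ∑ k ∈ S, wt k ^ 2 * x k ^ 2 := by
  refine Finset.sum_sq_le_sum_mul_sum_of_sq_le_mul S (fun _ _ => by positivity)
    (fun _ _ => by positivity) fun k _ => ?_
  have := wt_pos k
  refine le_of_eq ?_
  field_simp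

lemma sq_sum_le (S : Finset (Fin 2 → ℤ)) (x : (Fin 2 → ℤ) → ℝ) :
    (∑ k ∈ S, x k) ^ 2 ≤ 17 * ∑ k ∈ S, wt k ^ 2 * x k ^ 2 :=
  (sq_sum_le_wt S x).trans (mul_le_mul_of_nonneg_right (sum_wt_le S)
    (Finset.sum_nonneg fun _ _ => by positivity))

lemma meshSize_le_one (K : ℕ) : meshSize K ≤ 1 := by
  unfold meshSize
  rw [div_le_one (by positivity)]
  have : (0 : ℝ) ≤ K := by positivity
  linarith

lemma inv_wt_le {K : ℕ} {k : Fin 2 → ℤ} (hk : k ∉ freq K) : (wt k)⁻¹ ≤ 4 * meshSize K ^ 2 := by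
  have h1 := wt_ge_of_notMem_freq hk
  have h2 : 4 * meshSize K ^ 2 = (((2 * K + 1 : ℝ) / 2) ^ 2)⁻¹ := by
    unfold meshSize; field_simp; norm_num
  rw [h2]
  refine inv_anti₀ (by positivity) (le_trans ?_ h1)
  gcongr
  have : (0 : ℝ) ≤ K := by positivity
  linarith

/-- The tail of an absolutely convergent series, from a weighted square sum. -/
lemma sq_sum_tail_le {K : ℕ} {S : Finset (Fin 2 → ℤ)} (hS : Disjoint S (freq K)) (q : ℕ)
    (x : (Fin 2 → ℤ) → ℝ) {B : ℝ} (hB : ∑ k ∈ S, wt k ^ (q + 2) * x k ^ 2 ≤ B) :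
    (∑ k ∈ S, x k) ^ 2 ≤ 16 * 4 ^ q * B * (meshSize K ^ (q + 1)) ^ 2 := by
  -- Outside `freq K` each surplus power of the weight is worth a factor `4 h²`; the last factor
  -- `h²` of the squared bound comes from the tail of `∑ wt⁻²`.
  have h1 : ∑ k ∈ S, wt k ^ 2 * x k ^ 2 ≤ (4 * meshSize K ^ 2) ^ q * B := by
    calc _ ≤ ∑ k ∈ S, (4 * meshSize K ^ 2) ^ q * (wt k ^ (q + 2) * x k ^ 2) := by
          refine Finset.sum_le_sum fun k hk => ?_
          have h2 := inv_wt_le (Finset.disjoint_left.1 hS hk)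
          have h3 : 1 ≤ (4 * meshSize K ^ 2) ^ q * wt k ^ q := by
            rw [← mul_pow]
            refine one_le_pow₀ ?_
            rwa [inv_le_iff_one_le_mul₀ (wt_pos k)] at h2
          rw [pow_add]
          have h4 : 0 ≤ wt k ^ 2 * x k ^ 2 := by positivity
          nlinarith [mul_le_mul_of_nonneg_right h3 h4]
      _ ≤ _ := by
          rw [← Finset.mul_sum]
          exact mul_le_mul_of_nonneg_left hB (by positivity)
  have hB0 : 0 ≤ ∑ k ∈ S, wt k ^ 2 * x k ^ 2 := Finset.sum_nonneg fun _ _ => by positivity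
  calc _ ≤ _ := sq_sum_le_wt S x
    _ ≤ 16 * meshSize K ^ 2 * ((4 * meshSize K ^ 2) ^ q * B) :=
        mul_le_mul (sum_wt_tail hS) h1 hB0 (by positivity)
    _ = _ := by rw [mul_pow]; ring

/-! ### The flux function -/

/-- The flux `v ↦ vᵢ / (1 + |v|²)`. -/
def flux (i : Fin 2) (v : Fin 2 → ℝ) : ℝ := v i / (1 + ∑ l, v l ^ 2)

lemma one_add_sum_sq_pos (v : Fin 2 → ℝ) : 0 < 1 + ∑ l, v l ^ 2 := by
  have := Finset.sum_nonneg fun l (_ : l ∈ Finset.univ) => sq_nonneg (v l)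
  linarith

lemma fluxN_eq {K : ℕ} (f : Grid K → ℝ) (i : Fin 2) (q : Grid K) :
    fluxN f i q = flux i (fun l => dN l f q) := rfl

lemma contDiff_flux (i : Fin 2) : ContDiff ℝ ∞ (flux i) := by
  unfold flux
  refine ContDiff.div (by fun_prop) (by fun_prop) fun v => (one_add_sum_sq_pos v).ne'

lemma abs_flux_le (i : Fin 2) (v : Fin 2 → ℝ) : |flux i v| ≤ 1 := by
  have h := one_add_sum_sq_pos v
  rw [flux, abs_div, abs_of_pos h, div_le_one h]
  have h1 := Finset.single_le_sum (fun l _ => sq_nonneg (v l)) (Finset.mem_univ i)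
  nlinarith [sq_nonneg (|v i| - 1), sq_abs (v i), abs_nonneg (v i)]

/-- The estimate is global because the growth of the numerators is compensated by the two
denominators. This is what frees the stability argument from any bound on the gradient of the
numerical solution. -/
lemma abs_flux_sub_le (i : Fin 2) (v w : Fin 2 → ℝ) :
    |flux i v - flux i w| ≤ 3 * ∑ l, |v l - w l| := by
  have hv := one_add_sum_sq_pos v
  have hw := one_add_sum_sq_pos w
  set q := 1 + ∑ l, v l ^ 2 with hq
  set r := 1 + ∑ l, w l ^ 2 with hr
  have e : flux i v - flux i w
      -- The difference of the two denominators is written as `∑ (v_l - w_l)(v_l + w_l)`, which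
      -- isolates the increments.
      = (v i - w i) / q - ∑ l, (v l - w l) * (w i * (v l + w l) / (q * r)) := by
    simp only [flux, ← hq, ← hr]
    have : ∑ l, (v l - w l) * (w i * (v l + w l) / (q * r)) = w i * (q - r) / (q * r) := by
      simp only [hq, hr, Fin.sum_univ_two]
      ring
    rw [this]
    field_simp
    ring
  have hq1 : 1 ≤ q := by
    have := Finset.sum_nonneg fun l (_ : l ∈ Finset.univ) => sq_nonneg (v l)
    linarith
  have hr1 : 1 ≤ r := by
    have := Finset.sum_nonneg fun l (_ : l ∈ Finset.univ) => sq_nonneg (w l)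
    linarith
  have hb : ∀ l, |w i * (v l + w l) / (q * r)| ≤ 2 := by
    intro l
    rw [abs_div, abs_of_pos (mul_pos hv hw), div_le_iff₀ (mul_pos hv hw), abs_mul]
    have h1 := Finset.single_le_sum (fun j _ => sq_nonneg (w j)) (Finset.mem_univ i)
    have h2 := Finset.single_le_sum (fun j _ => sq_nonneg (w j)) (Finset.mem_univ l)
    have h3 := Finset.single_le_sum (fun j _ => sq_nonneg (v j)) (Finset.mem_univ l)
    have h4 : |w i| * |v l + w l| ≤ (r + (q + r)) := by
      have := abs_add_le (v l) (w l)
      nlinarith [sq_nonneg (|w i| - |v l|), sq_nonneg (|w i| - |w l|), sq_abs (w i), sq_abs (w l),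
        sq_abs (v l), abs_nonneg (w i), abs_nonneg (w l), abs_nonneg (v l),
        mul_le_mul_of_nonneg_left this (abs_nonneg (w i))]
    have h5 : |w i| * |v l| ≤ q * r := by
      have h6 : (|w i| * |v l|) ^ 2 ≤ (q * r) ^ 2 := by
        rw [mul_pow, sq_abs, sq_abs]
        nlinarith [mul_le_mul (show w i ^ 2 ≤ r by linarith) (show v l ^ 2 ≤ q by linarith)
          (sq_nonneg _) hw.le, mul_pos hv hw, one_le_mul_of_one_le_of_one_le hq1 hr1]
      exact le_of_sq_le_sq h6 (mul_pos hv hw).le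
    have h7 : |w i| * |w l| ≤ q * r := by
      have h8 : |w i| * |w l| ≤ r := by
        nlinarith [sq_nonneg (|w i| - |w l|), sq_abs (w i), sq_abs (w l)]
      nlinarith
    calc |w i| * |v l + w l| ≤ |w i| * (|v l| + |w l|) := by gcongr; exact abs_add_le _ _
      _ ≤ 2 * (q * r) := by nlinarith
  rw [e]
  calc _ ≤ |(v i - w i) / q| + |∑ l, (v l - w l) * (w i * (v l + w l) / (q * r))| := abs_sub _ _
    _ ≤ |v i - w i| + ∑ l, |v l - w l| * 2 := by
        refine add_le_add ?_ ((Finset.abs_sum_le_sum_abs _ _).trans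
          (Finset.sum_le_sum fun l _ => ?_))
        · rw [abs_div, abs_of_pos hv]
          exact div_le_self (abs_nonneg _) hq1
        · rw [abs_mul]
          exact mul_le_mul_of_nonneg_left (hb l) (abs_nonneg _)
    _ ≤ _ := by
        have := Finset.single_le_sum (fun l _ => abs_nonneg (v l - w l)) (Finset.mem_univ i)
        rw [← Finset.sum_mul]
        linarith

/-- The flux of a continuous vector field. -/
def fluxC (P : Fin 2 → C(Torus, ℝ)) (i : Fin 2) : C(Torus, ℝ) :=
  ⟨fun x => flux i fun l => P l x, (contDiff_flux i).continuous.comp (by fun_prop)⟩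

lemma fluxC_apply (P : Fin 2 → C(Torus, ℝ)) (i : Fin 2) (x : Torus) :
    fluxC P i x = flux i fun l => P l x := rfl

lemma norm_fluxC_le (P : Fin 2 → C(Torus, ℝ)) (i : Fin 2) : ‖fluxC P i‖ ≤ 1 :=
  (ContinuousMap.norm_le _ zero_le_one).2 fun x => by
    rw [Real.norm_eq_abs, fluxC_apply]; exact abs_flux_le i _

lemma norm_fluxC_sub_le (P Q : Fin 2 → C(Torus, ℝ)) (i : Fin 2) :
    ‖fluxC P i - fluxC Q i‖ ≤ 3 * ∑ l, ‖P l - Q l‖ := by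
  refine (ContinuousMap.norm_le _ (by positivity)).2 fun x => ?_
  rw [Real.norm_eq_abs, ContinuousMap.sub_apply, fluxC_apply, fluxC_apply]
  refine (abs_flux_sub_le i _ _).trans ?_
  gcongr with l
  exact (P l - Q l).norm_coe_le_norm x

/-! ### Fourier coefficients of smooth functions -/

/-- Each difference costs one mean value inequality and one derivative. -/
lemma abs_fwdDiff_iter_le (s : ℝ) (r : ℕ) : ∀ (B : ℝ) (g : ℝ → ℝ), ContDiff ℝ ∞ g →
    (∀ σ, |iteratedDeriv r g σ| ≤ B) → ∀ σ, |(fwdDiff s)^[r] g σ| ≤ |s| ^ r * B := by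
  induction r with
  | zero => intro B g _ h σ; simpa using h σ
  | succ r ih =>
    intro B g hg h σ
    rw [Function.iterate_succ_apply]
    have hshift : ContDiff ℝ ∞ fun σ => g (σ + s) := hg.comp (contDiff_id.add contDiff_const)
    have h1 := ih (B * |s|) (fwdDiff s g) (hshift.sub hg) (fun τ => ?_) σ
    · rw [pow_succ]
      linarith
    · have h2 : iteratedDeriv r (fwdDiff s g) τ
          = iteratedDeriv r g (τ + s) - iteratedDeriv r g τ := by
        have := iteratedDeriv_fun_sub (n := r) (x := τ)
          (hshift.contDiffAt.of_le (by exact_mod_cast le_top)) (hg.contDiffAt.of_le (by exact_mod_cast le_top))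
        rw [iteratedDeriv_comp_add_const] at this
        exact this
      rw [h2]
      have h3 := Convex.norm_image_sub_le_of_norm_deriv_le (f := iteratedDeriv r g) (s := univ)
        (x := τ) (y := τ + s) (C := B)
        (fun x _ => (hg.differentiable_iteratedDeriv r (by exact_mod_cast WithTop.coe_lt_top _)) x)
        (fun x _ => by rw [← iteratedDeriv_succ]; exact h x) convex_univ trivial trivial
      simpa using h3

/-- The difference operator in the `j`-th direction. -/
def diffOp (j : Fin 2) (s : ℝ) (f : C(Torus, ℝ)) : C(Torus, ℝ) :=
  translate (Pi.single j (s : UnitAddCircle)) f - f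

lemma fCoeff_diffOp_iter (j : Fin 2) (s : ℝ) (r : ℕ) (f : C(Torus, ℝ)) (k : Fin 2 → ℤ) :
    fCoeff ((diffOp j s)^[r] f) k = (Complex.exp (symD j k * s) - 1) ^ r * fCoeff f k := by
  induction r generalizing f with
  | zero => simp
  | succ r ih =>
    rw [Function.iterate_succ_apply, ih, ← fCoeffL_apply, diffOp, map_sub, fCoeffL_apply,
      fCoeffL_apply, fCoeff_translate, mFourier_single_coe]
    ring

lemma diffOp_iter_apply (j : Fin 2) (s : ℝ) (r : ℕ) (f : C(Torus, ℝ)) (x : Torus) (σ : ℝ) :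
    ((diffOp j s)^[r] f) (x + Pi.single j (σ : UnitAddCircle))
      = (fwdDiff s)^[r] (fun σ : ℝ => f (x + Pi.single j (σ : UnitAddCircle))) σ := by
  induction r generalizing f with
  | zero => rfl
  | succ r ih =>
    rw [Function.iterate_succ_apply, ih, Function.iterate_succ_apply]
    refine congrFun (congrArg (fwdDiff s)^[r] ?_) σ
    funext τ
    simp only [diffOp, translate, fwdDiff, ContinuousMap.sub_apply, ContinuousMap.coe_mk,
      AddCircle.coe_add, Pi.single_add, add_assoc]

/-- Jordan's inequality for the sine. It makes the multiplier of a finite difference comparable to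
that of a derivative, as long as the step does not exceed half a wavelength. -/
lemma norm_exp_symD_sub_one {j : Fin 2} {k : Fin 2 → ℤ} {s : ℝ} (h : |(k j : ℝ) * s| ≤ 1 / 2) :
    4 * |(k j : ℝ) * s| ≤ ‖Complex.exp (symD j k * s) - 1‖ := by
  have e : symD j k * s = Complex.I * ((2 * Real.pi * ((k j : ℝ) * s) : ℝ) : ℂ) := by
    simp only [symD]; push_cast; ring
  rw [e, Complex.norm_exp_I_mul_ofReal_sub_one, norm_mul, Real.norm_eq_abs, Real.norm_eq_abs,
    show 2 * Real.pi * ((k j : ℝ) * s) / 2 = Real.pi * ((k j : ℝ) * s) by ring]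
  have h1 : |Real.pi * ((k j : ℝ) * s)| = Real.pi * |(k j : ℝ) * s| := by
    rw [abs_mul, abs_of_pos Real.pi_pos]
  have h2 := Real.mul_abs_le_abs_sin (x := Real.pi * ((k j : ℝ) * s)) (by
    rw [h1]; nlinarith [Real.pi_pos])
  rw [h1] at h2
  have h3 : 2 / Real.pi * (Real.pi * |(k j : ℝ) * s|) = 2 * |(k j : ℝ) * s| := by
    field_simp
  rw [h3] at h2
  rw [abs_of_pos (by norm_num : (0 : ℝ) < 2)]
  linarith

/-- Square summability of the Fourier coefficients of a function with bounded derivatives. -/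
lemma sum_pow_mul_fCoeff_le {f : C(Torus, ℝ)} {j : Fin 2} {r : ℕ} {B : ℝ}
    (hf : ∀ x : Torus, ContDiff ℝ ∞ fun σ : ℝ => f (x + Pi.single j (σ : UnitAddCircle)))
    (hB : ∀ (x : Torus) (σ : ℝ),
      |iteratedDeriv r (fun σ : ℝ => f (x + Pi.single j (σ : UnitAddCircle))) σ| ≤ B)
    (S : Finset (Fin 2 → ℤ)) :
    ∑ k ∈ S, (|(k j : ℝ)| ^ r * ‖fCoeff f k‖) ^ 2 ≤ B ^ 2 := by
  have hB0 : 0 ≤ B := (abs_nonneg _).trans (hB 0 0)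
  -- Bessel's inequality is applied to the `r`-th finite difference instead of integrating by parts.
  -- The step `s = 1/(2n)` is chosen so that `|k_j s| ≤ 1/2` for all `k` in the finite set; the
  -- powers of `s` cancel in the end.
  set n : ℝ := 1 + ∑ k ∈ S, |(k j : ℝ)| with hn
  have hn0 : 0 < n := by positivity
  set s : ℝ := 1 / (2 * n) with hs
  have hs0 : 0 < s := by positivity
  have h1 : ∀ k ∈ S, |(k j : ℝ) * s| ≤ 1 / 2 := by
    intro k hk
    have h2 : |(k j : ℝ)| ≤ n := by
      have := Finset.single_le_sum (f := fun k : Fin 2 → ℤ => |(k j : ℝ)|)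
        (fun _ _ => abs_nonneg _) hk
      linarith
    rw [abs_mul, abs_of_pos hs0, hs]
    rw [mul_one_div, div_le_div_iff₀ (by positivity) (by norm_num)]
    linarith
  have h2 : ‖(diffOp j s)^[r] f‖ ≤ s ^ r * B := by
    refine (ContinuousMap.norm_le _ (by positivity)).2 fun x => ?_
    have h3 := diffOp_iter_apply j s r f x 0
    simp only [AddCircle.coe_zero, Pi.single_zero, add_zero] at h3
    rw [h3]
    have h4 := abs_fwdDiff_iter_le s r B _ (hf x) (hB x) 0
    rwa [abs_of_pos hs0] at h4
  have h3 := sum_norm_fCoeff_sq_le ((diffOp j s)^[r] f) S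
  have h4 : ∑ k ∈ S, (|(k j : ℝ)| ^ r * ‖fCoeff f k‖) ^ 2 * (s ^ r) ^ 2
      ≤ ∑ k ∈ S, ‖fCoeff ((diffOp j s)^[r] f) k‖ ^ 2 := by
    refine Finset.sum_le_sum fun k hk => ?_
    rw [fCoeff_diffOp_iter, norm_mul, norm_pow, ← mul_pow]
    refine pow_le_pow_left₀ (by positivity) ?_ 2
    have h5 := norm_exp_symD_sub_one (h1 k hk)
    have h6 : |(k j : ℝ)| * s ≤ ‖Complex.exp (symD j k * s) - 1‖ := by
      rw [abs_mul, abs_of_pos hs0] at h5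
      nlinarith [mul_nonneg (abs_nonneg (k j : ℝ)) hs0.le]
    have h7 := pow_le_pow_left₀ (by positivity) h6 r
    rw [mul_pow] at h7
    nlinarith [mul_le_mul_of_nonneg_right h7 (norm_nonneg (fCoeff f k))]
  rw [← Finset.sum_mul] at h4
  have h5 : (∑ k ∈ S, (|(k j : ℝ)| ^ r * ‖fCoeff f k‖) ^ 2) * (s ^ r) ^ 2 ≤ B ^ 2 * (s ^ r) ^ 2 := by
    refine h4.trans (h3.trans ?_)
    calc _ ≤ (s ^ r * B) ^ 2 := pow_le_pow_left₀ (norm_nonneg _) h2 2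
      _ = _ := by ring
  exact le_of_mul_le_mul_right h5 (by positivity)

/-- A nonzero integer vector has its larger component at least 1 in modulus, so that component alone
dominates a third of the weight. The zero mode has to be excluded. -/
lemma wt_pow_le {k : Fin 2 → ℤ} (hk : k ≠ 0) (r : ℕ) :
    wt k ^ r ≤ 3 ^ r * ∑ j, (|(k j : ℝ)| ^ r) ^ 2 := by
  have h0 : ∃ j, wt k ≤ 3 * (k j : ℝ) ^ 2 := by
    have h1 : ∃ j, k j ≠ 0 := Function.ne_iff.1 hk
    have h2 : ∀ j, k j ≠ 0 → (1 : ℝ) ≤ (k j : ℝ) ^ 2 := fun j hj => by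
      have : 1 ≤ (k j) ^ 2 := Int.one_le_abs (pow_ne_zero 2 hj) |>.trans (by rw [abs_of_nonneg (sq_nonneg _)])
      exact_mod_cast this
    simp only [wt, Fin.sum_univ_two]
    rcases le_total ((k 0 : ℝ) ^ 2) ((k 1 : ℝ) ^ 2) with h | h
    · refine ⟨1, ?_⟩
      have : (1 : ℝ) ≤ (k 1 : ℝ) ^ 2 := by
        obtain ⟨j, hj⟩ := h1
        fin_cases j
        · exact (h2 0 hj).trans h
        · exact h2 1 hj
      linarith
    · refine ⟨0, ?_⟩
      have : (1 : ℝ) ≤ (k 0 : ℝ) ^ 2 := by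
        obtain ⟨j, hj⟩ := h1
        fin_cases j
        · exact h2 0 hj
        · exact (h2 1 hj).trans h
      linarith
  obtain ⟨j, hj⟩ := h0
  calc wt k ^ r ≤ (3 * (k j : ℝ) ^ 2) ^ r := pow_le_pow_left₀ (wt_pos k).le hj r
    _ = 3 ^ r * (|(k j : ℝ)| ^ r) ^ 2 := by rw [mul_pow, ← sq_abs, ← pow_mul, ← pow_mul, mul_comm 2 r]
    _ ≤ _ := by
        gcongr
        exact Finset.single_le_sum (f := fun j => (|(k j : ℝ)| ^ r) ^ 2) (fun _ _ => sq_nonneg _)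
          (Finset.mem_univ j)

lemma sum_wt_pow_mul_fCoeff_le {f : C(Torus, ℝ)} {r : ℕ} {B : ℝ}
    (hf : ∀ (j : Fin 2) (x : Torus),
      ContDiff ℝ ∞ fun σ : ℝ => f (x + Pi.single j (σ : UnitAddCircle)))
    (hB : ∀ (j : Fin 2) (x : Torus) (σ : ℝ),
      |iteratedDeriv r (fun σ : ℝ => f (x + Pi.single j (σ : UnitAddCircle))) σ| ≤ B)
    {S : Finset (Fin 2 → ℤ)} (hS : (0 : Fin 2 → ℤ) ∉ S) :
    ∑ k ∈ S, wt k ^ r * ‖fCoeff f k‖ ^ 2 ≤ 3 ^ r * (2 * B ^ 2) := by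
  calc _ ≤ ∑ k ∈ S, 3 ^ r * ∑ j, (|(k j : ℝ)| ^ r * ‖fCoeff f k‖) ^ 2 := by
        refine Finset.sum_le_sum fun k hk => ?_
        have h1 := wt_pow_le (k := k) (fun h => hS (h ▸ hk)) r
        simp only [mul_pow, ← Finset.sum_mul] at h1 ⊢
        rw [← mul_assoc]
        gcongr
    _ = 3 ^ r * ∑ j, ∑ k ∈ S, (|(k j : ℝ)| ^ r * ‖fCoeff f k‖) ^ 2 := by
        rw [← Finset.mul_sum, Finset.sum_comm]
    _ ≤ 3 ^ r * ∑ _j : Fin 2, B ^ 2 := by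
        gcongr with j
        exact sum_pow_mul_fCoeff_le (hf j) (hB j) S
    _ = _ := by simp

/-! ### Aliasing error of the flux -/

/-- A real trigonometric polynomial as a continuous function. -/
def trigC (K : ℕ) (a : (Fin 2 → ℤ) → ℂ) : C(Torus, ℝ) :=
  ⟨trig K a, by unfold trig; fun_prop⟩

lemma trigC_apply (K : ℕ) (a : (Fin 2 → ℤ) → ℂ) (x : Torus) : trigC K a x = trig K a x := rfl

lemma abs_trig_le (K : ℕ) (a : (Fin 2 → ℤ) → ℂ) (x : Torus) :
    |trig K a x| ≤ ∑ k ∈ freq K, ‖a k‖ := by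
  refine (Complex.abs_re_le_norm _).trans ((norm_sum_le _ _).trans (le_of_eq ?_))
  exact Finset.sum_congr rfl fun k _ => by rw [norm_mul, norm_mFourier_apply, mul_one]

/-- The restriction of a trigonometric vector field to a line. -/
def lineCurve (K : ℕ) (b : Fin 2 → (Fin 2 → ℤ) → ℂ) (j : Fin 2) (x : Torus) (σ : ℝ) : Fin 2 → ℝ :=
  fun l => trig K (b l) (x + Pi.single j (σ : UnitAddCircle))

lemma hasDerivAt_trig_line (K : ℕ) (a : (Fin 2 → ℤ) → ℂ) (j : Fin 2) (x : Torus) (σ : ℝ) :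
    HasDerivAt (fun σ : ℝ => trig K a (x + Pi.single j (σ : UnitAddCircle)))
      (trig K (fun k => symD j k * a k) (x + Pi.single j (σ : UnitAddCircle))) σ := by
  have h : ∀ k : Fin 2 → ℤ, HasDerivAt
      (fun σ : ℝ => a k * UnitAddTorus.mFourier k (x + Pi.single j (σ : UnitAddCircle)))
      (symD j k * a k * UnitAddTorus.mFourier k (x + Pi.single j (σ : UnitAddCircle))) σ := by
    intro k
    simp only [mFourier_apply_add, mFourier_single_coe]
    have h1 : HasDerivAt (fun σ : ℝ => symD j k * (σ : ℂ)) (symD j k) σ := by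
      simpa using (Complex.ofRealCLM.hasDerivAt (x := σ)).const_mul (symD j k)
    convert! (h1.cexp.const_mul (UnitAddTorus.mFourier k x)).const_mul (a k) using 1
    ring
  exact (Complex.reCLM.hasFDerivAt.comp_hasDerivAt σ
    (HasDerivAt.fun_sum fun k (_ : k ∈ freq K) => h k))

lemma hasDerivAt_lineCurve (K : ℕ) (b : Fin 2 → (Fin 2 → ℤ) → ℂ) (j : Fin 2) (x : Torus) (σ : ℝ) :
    HasDerivAt (lineCurve K b j x) (lineCurve K (fun l k => symD j k * b l k) j x σ) σ :=
  hasDerivAt_pi.2 fun l => hasDerivAt_trig_line K (b l) j x σ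

lemma iteratedDeriv_lineCurve (K : ℕ) (b : Fin 2 → (Fin 2 → ℤ) → ℂ) (j : Fin 2) (x : Torus)
    (q : ℕ) : iteratedDeriv q (lineCurve K b j x)
      = lineCurve K (fun l k => symD j k ^ q * b l k) j x := by
  induction q generalizing b with
  | zero => simp [iteratedDeriv_zero]
  | succ q ih =>
    rw [iteratedDeriv_succ', funext fun σ => (hasDerivAt_lineCurve K b j x σ).deriv, ih]
    congr 1
    funext l k
    ring

lemma contDiff_lineCurve (K : ℕ) (b : Fin 2 → (Fin 2 → ℤ) → ℂ) (j : Fin 2) (x : Torus) :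
    ContDiff ℝ ∞ (lineCurve K b j x) := by
  refine contDiff_of_differentiable_iteratedDeriv fun q _ σ => ?_
  rw [iteratedDeriv_lineCurve]
  exact (hasDerivAt_lineCurve K _ j x σ).differentiableAt

lemma norm_lineCurve_le {K : ℕ} {b : Fin 2 → (Fin 2 → ℤ) → ℂ} {D : ℝ} (hD : 0 ≤ D)
    (h : ∀ l, ∑ k ∈ freq K, ‖b l k‖ ≤ D) (j : Fin 2) (x : Torus) (σ : ℝ) :
    ‖lineCurve K b j x σ‖ ≤ D :=
  (pi_norm_le_iff_of_nonneg hD).2 fun l => (abs_trig_le K (b l) _).trans (h l)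

/-- The Fourier coefficients of the gradient. -/
def gradCoeff (c : (Fin 2 → ℤ) → ℂ) (l : Fin 2) (k : Fin 2 → ℤ) : ℂ := symD l k * c k

lemma IsHerm.gradCoeff {c : (Fin 2 → ℤ) → ℂ} (hc : IsHerm c) (l : Fin 2) :
    IsHerm (gradCoeff c l) := by
  have h : IsHerm (symD l) := symD_neg l
  exact h.mul hc

/-- Uniform bounds for the weighted square sums. -/
def WtBound (n : ℕ) (M : ℝ) (c : (Fin 2 → ℤ) → ℂ) : Prop :=
  ∀ S : Finset (Fin 2 → ℤ), ∑ k ∈ S, wt k ^ n * ‖c k‖ ^ 2 ≤ M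

lemma WtBound.nonneg {n : ℕ} {M : ℝ} {c : (Fin 2 → ℤ) → ℂ} (h : WtBound n M c) : 0 ≤ M := by
  simpa using h ∅

lemma WtBound.mono {n n' : ℕ} {M : ℝ} {c : (Fin 2 → ℤ) → ℂ} (h : WtBound n M c) (hn : n' ≤ n) :
    WtBound n' M c := fun S => (Finset.sum_le_sum fun k _ => by
      have := pow_le_pow_right₀ (one_le_wt k) hn
      gcongr).trans (h S)

lemma one_le_four_pi_sq : (1 : ℝ) ≤ 4 * Real.pi ^ 2 := by
  nlinarith [Real.pi_gt_three]

/-- Sobolev embedding in dimension two: Cauchy–Schwarz spends the weight `wt²` on absolute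
convergence and leaves `m + 2` powers for the gradient and up to `m + 1` further derivatives. The
bound does not depend on the finite set, hence not on the truncation. -/
lemma sum_symD_pow_le {m : ℕ} {M : ℝ} {c : (Fin 2 → ℤ) → ℂ} (hc : WtBound (m + 4) M c)
    {q : ℕ} (hq : q ≤ m + 1) (j l : Fin 2) (S : Finset (Fin 2 → ℤ)) :
    ∑ k ∈ S, ‖symD j k ^ q * gradCoeff c l k‖ ≤ √(17 * ((4 * Real.pi ^ 2) ^ (m + 2) * M)) := by
  refine Real.le_sqrt_of_sq_le ((sq_sum_le S _).trans ?_)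
  have h1 : ∀ k ∈ S, wt k ^ 2 * ‖symD j k ^ q * gradCoeff c l k‖ ^ 2
      ≤ (4 * Real.pi ^ 2) ^ (m + 2) * (wt k ^ (m + 4) * ‖c k‖ ^ 2) := by
    intro k _
    have h2 : ‖symD j k ^ q * gradCoeff c l k‖ ^ 2
        = (‖symD j k‖ ^ 2) ^ q * ‖symD l k‖ ^ 2 * ‖c k‖ ^ 2 := by
      rw [gradCoeff, norm_mul, norm_mul, norm_pow]; ring
    have hw := one_le_wt k
    have h3 : (‖symD j k‖ ^ 2) ^ q * ‖symD l k‖ ^ 2 ≤ (4 * Real.pi ^ 2 * wt k) ^ (m + 2) := by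
      calc _ ≤ (4 * Real.pi ^ 2 * wt k) ^ q * (4 * Real.pi ^ 2 * wt k) := by
            gcongr <;> exact norm_symD_sq_le _ k
        _ = (4 * Real.pi ^ 2 * wt k) ^ (q + 1) := (pow_succ _ _).symm
        _ ≤ _ := pow_le_pow_right₀ (one_le_mul_of_one_le_of_one_le one_le_four_pi_sq hw) (by omega)
    rw [h2]
    calc _ ≤ wt k ^ 2 * ((4 * Real.pi ^ 2 * wt k) ^ (m + 2) * ‖c k‖ ^ 2) := by gcongr
      _ = _ := by rw [mul_pow, show m + 4 = 2 + (m + 2) by ring, pow_add (wt k) 2]; ring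
  gcongr
  refine (Finset.sum_le_sum h1).trans ?_
  rw [← Finset.mul_sum]
  gcongr
  exact hc S

/-- The truncated gradient and its derivatives along a coordinate line stay below one radius `R` for
all `K`. On that compact ball the derivatives of the flux are bounded, and the estimate for
derivatives of a composition applies. -/
lemma iteratedDeriv_flux_bound (m : ℕ) (M : ℝ) :
    ∃ B, 0 ≤ B ∧ ∀ (K : ℕ) (c : (Fin 2 → ℤ) → ℂ), WtBound (m + 4) M c → ∀ (i j : Fin 2) (x : Torus)
      (σ : ℝ), |iteratedDeriv (m + 1) (fun σ : ℝ => fluxC (fun l => trigC K (gradCoeff c l)) i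
        (x + Pi.single j (σ : UnitAddCircle))) σ| ≤ B := by
  set R := √(17 * ((4 * Real.pi ^ 2) ^ (m + 2) * M)) with hR
  have hbd : ∀ i : Fin 2, ∀ q : ℕ, ∃ C, ∀ v ∈ Metric.closedBall (0 : Fin 2 → ℝ) R,
      ‖iteratedFDeriv ℝ q (flux i) v‖ ≤ C := fun i q =>
    (isCompact_closedBall _ _).exists_bound_of_continuousOn
      ((contDiff_flux i).continuous_iteratedFDeriv (by exact_mod_cast le_top)).continuousOn
  choose C hC using hbd
  set C' := ∑ i, ∑ q ∈ Finset.range (m + 2), |C i q| with hC'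
  refine ⟨(m + 1).factorial * C' * (max 1 R) ^ (m + 1), by positivity, ?_⟩
  intro K c hc i j x σ
  have hD : ∀ q ≤ m + 1, ‖iteratedDeriv q (lineCurve K (gradCoeff c) j x) σ‖ ≤ R := by
    intro q hq
    rw [iteratedDeriv_lineCurve]
    exact norm_lineCurve_le (Real.sqrt_nonneg _) (fun l => sum_symD_pow_le hc hq j l _) j x σ
  have h := norm_iteratedFDeriv_comp_le (n := m + 1) (contDiff_flux i)
    (contDiff_lineCurve K (gradCoeff c) j x) (by exact_mod_cast le_top) σ (C := C') (D := max 1 R)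
    (fun q hq => ?_) (fun q hq1 hq2 => ?_)
  · rw [norm_iteratedFDeriv_eq_norm_iteratedDeriv] at h
    exact h
  · have h0 := hD 0 (Nat.zero_le _)
    rw [iteratedDeriv_zero] at h0
    refine (hC i q _ (by simpa using h0)).trans ((le_abs_self _).trans ?_)
    refine (Finset.single_le_sum (f := fun q => |C i q|) (fun _ _ => abs_nonneg _)
      (Finset.mem_range.2 (by omega : q < m + 2))).trans ?_
    exact Finset.single_le_sum (f := fun i => ∑ q ∈ Finset.range (m + 2), |C i q|)
      (fun _ _ => Finset.sum_nonneg fun _ _ => abs_nonneg _) (Finset.mem_univ i)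
  · rw [norm_iteratedFDeriv_eq_norm_iteratedDeriv]
    refine (hD q hq2).trans ((le_max_right 1 R).trans ?_)
    exact le_self_pow₀ (le_max_left _ _) (by omega)

/-! ### Comparison of the discrete norm with uniform bounds and Fourier sums. -/

lemma norm2_le_of_abs_le {K : ℕ} {g : Grid K → ℝ} {B : ℝ} (hB : 0 ≤ B) (h : ∀ p, |g p| ≤ B) :
    norm2 g ≤ B := by
  refine Real.sqrt_le_iff.2 ⟨hB, ?_⟩
  have h1 : ∑ p, g p ^ 2 ≤ (2 * K + 1 : ℝ) ^ 2 * B ^ 2 := by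
    calc _ ≤ ∑ _p : Grid K, B ^ 2 := Finset.sum_le_sum fun p _ => by
          rw [← sq_abs]; exact pow_le_pow_left₀ (abs_nonneg _) (h p) 2
      _ = _ := by simp
  calc _ ≤ meshSize K ^ 2 * ((2 * K + 1 : ℝ) ^ 2 * B ^ 2) := by gcongr
    _ = (meshSize K * (2 * K + 1)) ^ 2 * B ^ 2 := by ring
    _ = B ^ 2 := by rw [meshSize_mul]; ring

lemma norm2_trig_fCoeff_le (K : ℕ) (f : C(Torus, ℝ)) :
    norm2 (fun p => trig K (fCoeff f) (gridPoint K p)) ≤ ‖f‖ := by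
  refine le_of_sq_le_sq ?_ (norm_nonneg _)
  rw [norm2_sq_trig K (fCoeff_isHerm f)]
  exact sum_norm_fCoeff_sq_le f _

/-- The triangle inequality for `norm2`. -/
lemma norm2_add_le {K : ℕ} (f g : Grid K → ℝ) : norm2 (f + g) ≤ norm2 f + norm2 g := by
  refine le_of_sq_le_sq ?_ (add_nonneg (norm2_nonneg f) (norm2_nonneg g))
  have h := (le_abs_self _).trans (abs_ip_le f g)
  have e : norm2 (f + g) ^ 2 = norm2 f ^ 2 + 2 * ip f g + norm2 g ^ 2 := by
    simp only [norm2_sq, ip, Pi.add_apply, Finset.mul_sum, ← Finset.sum_add_distrib]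
    exact Finset.sum_congr rfl fun p _ => by ring
  rw [e]
  nlinarith

lemma norm2_neg {K : ℕ} (f : Grid K → ℝ) : norm2 (-f) = norm2 f := by simp [norm2]

lemma norm2_sub_le {K : ℕ} (f g : Grid K → ℝ) : norm2 (f - g) ≤ norm2 f + norm2 g := by
  rw [sub_eq_add_neg, ← norm2_neg g]
  exact norm2_add_le f (-g)

lemma summable_of_sum_wt {x : (Fin 2 → ℤ) → ℝ} (hx : ∀ k, 0 ≤ x k) {B : ℝ}
    (h : ∀ S : Finset (Fin 2 → ℤ), ∑ k ∈ S, wt k ^ 2 * x k ^ 2 ≤ B) : Summable x := by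
  refine summable_of_sum_le (c := √(17 * B)) hx fun S => Real.le_sqrt_of_sq_le ?_
  refine (sq_sum_le S x).trans ?_
  gcongr
  exact h S

/-- The pointwise error of the Fourier projection. -/
lemma abs_sub_trig_le {f : C(Torus, ℝ)} {K : ℕ} {E : ℝ} (hs : Summable fun k => ‖fCoeff f k‖)
    (hE : ∀ S : Finset (Fin 2 → ℤ), Disjoint S (freq K) → ∑ k ∈ S, ‖fCoeff f k‖ ≤ E) (x : Torus) :
    |f x - trig K (fCoeff f) x| ≤ E := by
  have h1 := hasSum_fCoeff hs x
  have h2 : HasSum (fun k : {k // k ∉ freq K} => fCoeff f k * UnitAddTorus.mFourier (k : Fin 2 → ℤ) x)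
      ((f x : ℂ) - (trig K (fCoeff f) x : ℂ)) := by
    rw [trig_coe K (fCoeff_isHerm f)]
    refine (Finset.hasSum_compl_iff (f := fun k => fCoeff f k * UnitAddTorus.mFourier k x)
      (freq K)).2 ?_
    rw [sub_add_cancel]
    exact h1
  have h3 : Summable fun k : {k // k ∉ freq K} => ‖fCoeff f k‖ := hs.subtype _
  have h4 : ‖(f x : ℂ) - (trig K (fCoeff f) x : ℂ)‖ ≤ ∑' k : {k // k ∉ freq K}, ‖fCoeff f k‖ := by
    rw [← h2.tsum_eq]
    refine (norm_tsum_le_tsum_norm ?_).trans (le_of_eq ?_)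
    · simpa only [norm_mul, norm_mFourier_apply, mul_one] using h3
    · simp only [norm_mul, norm_mFourier_apply, mul_one]
  rw [← Complex.ofReal_sub, Complex.norm_real, Real.norm_eq_abs] at h4
  refine h4.trans (h3.tsum_le_of_sum_le fun S => ?_)
  have h5 := hE (S.map (Function.Embedding.subtype _)) (Finset.disjoint_left.2 fun k hk => by
    simp only [Finset.mem_map, Function.Embedding.coe_subtype] at hk
    obtain ⟨k', _, rfl⟩ := hk
    exact k'.2)
  rwa [Finset.sum_map] at h5

/-- Interpolation is compared with projection at the grid points. The pointwise error is a tail of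
Fourier coefficients, and the `m + 1` bounded derivatives of the flux make this tail `O(h^m)`: one
derivative is lost in passing from square summability to absolute summability. -/
theorem exists_alias_bound (m : ℕ) (M : ℝ) :
    ∃ C, 0 ≤ C ∧ ∀ (K : ℕ) (c : (Fin 2 → ℤ) → ℂ), WtBound (m + 4) M c → ∀ i : Fin 2,
      norm2 (fun p => fluxC (fun l => trigC K (gradCoeff c l)) i (gridPoint K p)
        - trig K (fCoeff (fluxC (fun l => trigC K (gradCoeff c l)) i)) (gridPoint K p))
      ≤ C * meshSize K ^ m := by
  -- For `m = 0` no decay is required, and boundedness of the flux by 1 suffices.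
  rcases Nat.eq_zero_or_pos m with rfl | hm
  · refine ⟨2, by norm_num, fun K c _ i => ?_⟩
    set f := fluxC (fun l => trigC K (gradCoeff c l)) i
    have hf : ‖f‖ ≤ 1 := norm_fluxC_le _ i
    have h1 : norm2 (fun p => f (gridPoint K p)) ≤ 1 :=
      norm2_le_of_abs_le zero_le_one fun p => (f.norm_coe_le_norm _).trans hf
    have h2 := (norm2_trig_fCoeff_le K f).trans hf
    refine (norm2_sub_le _ _).trans ?_
    rw [pow_zero]
    linarith
  obtain ⟨B, hB0, hB⟩ := iteratedDeriv_flux_bound m M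
  obtain ⟨q, rfl⟩ : ∃ q, m = q + 1 := ⟨m - 1, by omega⟩
  set B' := 3 ^ (q + 2) * (2 * B ^ 2) with hB'
  have hB'0 : 0 ≤ B' := by positivity
  refine ⟨√(16 * 4 ^ q * B'), Real.sqrt_nonneg _, fun K c hc i => ?_⟩
  set f := fluxC (fun l => trigC K (gradCoeff c l)) i with hf
  have hh := meshSize_pos K
  have hsq : ∀ S : Finset (Fin 2 → ℤ), (0 : Fin 2 → ℤ) ∉ S →
      ∑ k ∈ S, wt k ^ (q + 2) * ‖fCoeff f k‖ ^ 2 ≤ B' := fun S hS =>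
    sum_wt_pow_mul_fCoeff_le (f := f) (r := q + 2) (B := B)
      (fun j x => (contDiff_flux i).comp (contDiff_lineCurve K (gradCoeff c) j x))
      (fun j x σ => hB K c hc i j x σ) hS
  have hsum : Summable fun k => ‖fCoeff f k‖ := by
    refine summable_of_sum_wt (fun _ => norm_nonneg _) (B := B' + ‖f‖ ^ 2) fun S => ?_
    calc _ ≤ ∑ k ∈ S.erase 0, wt k ^ 2 * ‖fCoeff f k‖ ^ 2 + ‖f‖ ^ 2 := by
          by_cases h0 : (0 : Fin 2 → ℤ) ∈ S
          · rw [← Finset.sum_erase_add S _ h0]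
            have := sum_norm_fCoeff_sq_le f {0}
            simp only [Finset.sum_singleton] at this
            simpa [wt] using this
          · rw [Finset.erase_eq_of_notMem h0]
            linarith [sq_nonneg ‖f‖]
      _ ≤ ∑ k ∈ S.erase 0, wt k ^ (q + 2) * ‖fCoeff f k‖ ^ 2 + ‖f‖ ^ 2 := by
          gcongr with k
          · exact one_le_wt k
          · omega
      _ ≤ _ := by
          gcongr
          exact hsq _ (Finset.notMem_erase _ _)
  refine norm2_le_of_abs_le (by positivity) fun p => abs_sub_trig_le hsum (fun S hS => ?_) _
  have h0 : (0 : Fin 2 → ℤ) ∉ S := fun h => Finset.disjoint_left.1 hS h (mem_freq.2 fun i => by simp)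
  have h1 := sq_sum_tail_le hS q (fun k => ‖fCoeff f k‖) (hsq S h0)
  refine le_of_sq_le_sq (h1.trans (le_of_eq ?_)) (by positivity)
  rw [mul_pow, Real.sq_sqrt (by positivity)]

/-! ### Absolutely convergent Fourier series and the differential equation -/

/-- The real part of a Fourier series. -/
def seriesC (a : (Fin 2 → ℤ) → ℂ) : C(Torus, ℝ) :=
  ⟨fun x => ((∑' k, a k • (UnitAddTorus.mFourier k : C(Torus, ℂ))) x).re, by fun_prop⟩

lemma summable_smul_mFourier {a : (Fin 2 → ℤ) → ℂ} (ha : Summable fun k => ‖a k‖) :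
    Summable fun k => a k • (UnitAddTorus.mFourier k : C(Torus, ℂ)) :=
  Summable.of_norm (by simpa only [norm_smul, UnitAddTorus.mFourier_norm, mul_one] using ha)

lemma seriesC_apply {a : (Fin 2 → ℤ) → ℂ} (ha : Summable fun k => ‖a k‖) (x : Torus) :
    seriesC a x = (∑' k, a k * UnitAddTorus.mFourier k x).re := by
  have h := (ContinuousMap.evalCLM ℂ x).map_tsum (summable_smul_mFourier ha)
  simp only [ContinuousMap.evalCLM_apply, ContinuousMap.smul_apply, smul_eq_mul] at h
  simp only [seriesC, ContinuousMap.coe_mk, h]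

lemma norm_seriesC_sub_trigC_le {a : (Fin 2 → ℤ) → ℂ} (ha : Summable fun k => ‖a k‖) {K : ℕ} {E : ℝ}
    (hE : ∀ S : Finset (Fin 2 → ℤ), Disjoint S (freq K) → ∑ k ∈ S, ‖a k‖ ≤ E) :
    ‖seriesC a - trigC K a‖ ≤ E := by
  have hE0 : 0 ≤ E := by simpa using hE ∅ (Finset.disjoint_empty_left _)
  refine (ContinuousMap.norm_le _ hE0).2 fun x => ?_
  have h0 : Summable fun k => a k * UnitAddTorus.mFourier k x :=
    Summable.of_norm (by simpa only [norm_mul, norm_mFourier_apply, mul_one] using ha)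
  have h2 : HasSum (fun k : {k // k ∉ freq K} => a k * UnitAddTorus.mFourier (k : Fin 2 → ℤ) x)
      ((∑' k, a k * UnitAddTorus.mFourier k x) - ∑ k ∈ freq K, a k * UnitAddTorus.mFourier k x) := by
    refine (Finset.hasSum_compl_iff (f := fun k => a k * UnitAddTorus.mFourier k x) (freq K)).2 ?_
    rw [sub_add_cancel]
    exact h0.hasSum
  have h3 : Summable fun k : {k // k ∉ freq K} => ‖a k‖ := ha.subtype _
  rw [ContinuousMap.sub_apply, seriesC_apply ha, trigC_apply, trig, ← Complex.sub_re, ← h2.tsum_eq]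
  refine (Complex.abs_re_le_norm _).trans ((norm_tsum_le_tsum_norm ?_).trans ?_)
  · simpa only [norm_mul, norm_mFourier_apply, mul_one] using h3
  simp only [norm_mul, norm_mFourier_apply, mul_one]
  refine h3.tsum_le_of_sum_le fun S => ?_
  have h5 := hE (S.map (Function.Embedding.subtype _)) (Finset.disjoint_left.2 fun k hk => by
    simp only [Finset.mem_map, Function.Embedding.coe_subtype] at hk
    obtain ⟨k', _, rfl⟩ := hk
    exact k'.2)
  rwa [Finset.sum_map] at h5

lemma WtBound.summable_gradCoeff {m : ℕ} {M : ℝ} {c : (Fin 2 → ℤ) → ℂ} (hc : WtBound (m + 4) M c)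
    (l : Fin 2) : Summable fun k => ‖gradCoeff c l k‖ :=
  summable_of_sum_le (fun _ => norm_nonneg _) fun S => by
    simpa using sum_symD_pow_le hc (Nat.zero_le _) l l S

lemma WtBound.summable {n : ℕ} {M : ℝ} {c : (Fin 2 → ℤ) → ℂ} (hc : WtBound (n + 2) M c) :
    Summable fun k => ‖c k‖ :=
  summable_of_sum_wt (fun _ => norm_nonneg _) fun S => hc.mono (by omega) S

/-- The tail estimate even yields `h^(m+2)`; only `h^m` is kept, the order at which aliasing limits
the scheme anyway. -/
lemma WtBound.norm_grad_sub_le {m : ℕ} {M : ℝ} {c : (Fin 2 → ℤ) → ℂ} (hc : WtBound (m + 4) M c)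
    (K : ℕ) (l : Fin 2) :
    ‖seriesC (gradCoeff c l) - trigC K (gradCoeff c l)‖
      ≤ √(16 * 4 ^ (m + 1) * (4 * Real.pi ^ 2 * M)) * meshSize K ^ m := by
  have hM := hc.nonneg
  have hh := meshSize_pos K
  refine norm_seriesC_sub_trigC_le (hc.summable_gradCoeff l) fun S hS => ?_
  have h1 := sq_sum_tail_le hS (m + 1) (fun k => ‖gradCoeff c l k‖) (B := 4 * Real.pi ^ 2 * M) (by
    calc _ ≤ ∑ k ∈ S, 4 * Real.pi ^ 2 * (wt k ^ (m + 4) * ‖c k‖ ^ 2) := by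
          refine Finset.sum_le_sum fun k _ => ?_
          rw [gradCoeff, norm_mul, mul_pow]
          have hw := (wt_pos k).le
          calc _ ≤ wt k ^ (m + 1 + 2) * ((4 * Real.pi ^ 2 * wt k) * ‖c k‖ ^ 2) := by
                gcongr; exact norm_symD_sq_le l k
            _ = _ := by ring
      _ ≤ _ := by
          rw [← Finset.mul_sum]
          exact mul_le_mul_of_nonneg_left (hc S) (by positivity))
  refine le_of_sq_le_sq (h1.trans ?_) (by positivity)
  rw [mul_pow, Real.sq_sqrt (by positivity)]
  have h2 : meshSize K ^ (m + 1 + 1) ≤ meshSize K ^ m :=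
    pow_le_pow_of_le_one hh.le (meshSize_le_one K) (by omega)
  gcongr

/-- Termwise differentiation of the Fourier series. -/
lemma pderiv_eq_seriesC {u : C(Torus, ℝ)} {i : Fin 2} (h0 : Summable fun k => ‖fCoeff u k‖)
    (h1 : Summable fun k => ‖gradCoeff (fCoeff u) i k‖) (x : Torus) :
    pderiv i u x = seriesC (gradCoeff (fCoeff u) i) x := by
  have hn : ∀ (k : Fin 2 → ℤ) (σ : ℝ),
      ‖UnitAddTorus.mFourier k x * Complex.exp (symD i k * σ)‖ = 1 := fun k σ => by
    rw [← mFourier_single_coe, ← mFourier_apply_add, norm_mFourier_apply]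
  have hd : HasDerivAt (fun σ : ℝ => ∑' k, fCoeff u k *
        (UnitAddTorus.mFourier k x * Complex.exp (symD i k * σ)))
      (∑' k, gradCoeff (fCoeff u) i k *
        (UnitAddTorus.mFourier k x * Complex.exp (symD i k * (0 : ℝ)))) 0 := by
    refine hasDerivAt_tsum (𝕜 := ℝ) (F := ℂ) h1 (g := fun k (σ : ℝ) => fCoeff u k *
        (UnitAddTorus.mFourier k x * Complex.exp (symD i k * σ)))
      (g' := fun k (σ : ℝ) => gradCoeff (fCoeff u) i k *
        (UnitAddTorus.mFourier k x * Complex.exp (symD i k * σ))) (fun k σ => ?_)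
      (fun k σ => ?_) (y₀ := 0) ?_ 0
    · have h2 : HasDerivAt (fun σ : ℝ => symD i k * (σ : ℂ)) (symD i k) σ := by
        simpa using (Complex.ofRealCLM.hasDerivAt (x := σ)).const_mul (symD i k)
      convert! (h2.cexp.const_mul (UnitAddTorus.mFourier k x)).const_mul (fCoeff u k) using 1
      rw [gradCoeff]
      ring
    · rw [norm_mul, hn, mul_one]
    · exact Summable.of_norm (by simpa only [norm_mul, hn, mul_one] using h0)
  have hd2 := Complex.reCLM.hasFDerivAt.comp_hasDerivAt (0 : ℝ) hd
  have e : (Complex.reCLM ∘ fun σ : ℝ => ∑' k, fCoeff u k *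
        (UnitAddTorus.mFourier k x * Complex.exp (symD i k * σ)))
      = fun σ : ℝ => u (x + Pi.single i (σ : UnitAddCircle)) := by
    funext σ
    simp only [Function.comp, ← mFourier_single_coe, ← mFourier_apply_add,
      (hasSum_fCoeff h0 _).tsum_eq, Complex.reCLM_apply, Complex.ofReal_re]
  rw [e] at hd2
  rw [pderiv, hd2.deriv, seriesC_apply h1]
  simp

/-- Trigonometric test functions. -/
def testFn (k : Fin 2 → ℤ) (z : ℂ) (x : Torus) : ℝ := (z * UnitAddTorus.mFourier (-k) x).re

lemma pderiv_testFn (k : Fin 2 → ℤ) (z : ℂ) (i : Fin 2) :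
    pderiv i (testFn k z) = testFn k (symD i (-k) * z) := by
  funext x
  have h1 : HasDerivAt (fun σ : ℝ => symD i (-k) * (σ : ℂ)) (symD i (-k)) 0 := by
    simpa using (Complex.ofRealCLM.hasDerivAt (x := (0 : ℝ))).const_mul (symD i (-k))
  have h2 := Complex.reCLM.hasFDerivAt.comp_hasDerivAt (0 : ℝ)
    ((h1.cexp.const_mul (UnitAddTorus.mFourier (-k) x)).const_mul z)
  have e : (fun σ : ℝ => testFn k z (x + Pi.single i (σ : UnitAddCircle)))
      = (Complex.reCLM ∘ fun σ : ℝ => z * (UnitAddTorus.mFourier (-k) x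
        * Complex.exp (symD i (-k) * (σ : ℂ)))) := by
    funext σ
    simp only [testFn, mFourier_apply_add, mFourier_single_coe, Function.comp, Complex.reCLM_apply]
  rw [pderiv, e, h2.deriv]
  simp only [testFn, Complex.ofReal_zero, mul_zero, Complex.exp_zero, one_mul, Complex.reCLM_apply]
  congr 1
  ring

lemma laplacian_testFn (k : Fin 2 → ℤ) (z : ℂ) :
    laplacian (testFn k z) = testFn k (symL (-k) * z) := by
  funext x
  simp only [laplacian, pderiv_testFn, ← sum_symD_sq, testFn]
  rw [← Complex.re_sum, Finset.sum_mul, Finset.sum_mul]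
  congr 1
  exact Finset.sum_congr rfl fun i _ => by ring

lemma continuous_testFn (k : Fin 2 → ℤ) (z : ℂ) : Continuous (testFn k z) := by
  unfold testFn; fun_prop

lemma isSmooth_testFn (k : Fin 2 → ℤ) (z : ℂ) : IsSmooth (testFn k z) := by
  have e : (fun x : Fin 2 → ℝ => testFn k z fun i => (x i : UnitAddCircle))
      = fun x : Fin 2 → ℝ => Complex.reCLM (z * ∏ i,
        Complex.exp (2 * Real.pi * Complex.I * ((-k) i : ℤ) * ((x i : ℝ) : ℂ) / ((1 : ℝ) : ℂ))) := by
    funext x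
    simp only [testFn, UnitAddTorus.mFourier, ContinuousMap.coe_mk, fourier_coe_apply,
      Complex.reCLM_apply]
  unfold IsSmooth
  rw [e]
  refine Complex.reCLM.contDiff.comp (contDiff_const.mul (contDiff_prod fun i _ => ?_))
  refine ContDiff.cexp (ContDiff.div_const (contDiff_const.mul ?_) _)
  exact Complex.ofRealCLM.contDiff.comp (contDiff_apply ℝ ℝ i)

lemma integral_mul_testFn (f : C(Torus, ℝ)) (k : Fin 2 → ℤ) (z : ℂ) :
    ∫ x, f x * testFn k z x ∂torusMeasure = (z * fCoeff f k).re := by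
  have h1 : ∀ x, f x * testFn k z x
      = Complex.reCLM (z * (UnitAddTorus.mFourier (-k) x * (f x : ℂ))) := fun x => by
    simp only [testFn, Complex.reCLM_apply]
    rw [← mul_assoc, mul_comm _ ((f x : ℝ) : ℂ), Complex.re_ofReal_mul]
  simp only [h1]
  rw [ContinuousLinearMap.integral_comp_comm _ (continuous_integrable (by fun_prop)),
    integral_const_mul, fCoeff_eq, Complex.reCLM_apply]

/-- The gradient of the function with Fourier coefficients `c`. -/
def gradC (c : (Fin 2 → ℤ) → ℂ) (l : Fin 2) : C(Torus, ℝ) := seriesC (gradCoeff c l)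

/-- The differential equation, Fourier mode by Fourier mode. -/
lemma mode_equation {ε a T : ℝ} {ue : ℝ → C(Torus, ℝ)} (hsol : SolvesNSS ε a T ue) {t : ℝ}
    (ht : t ∈ Ioo a T) {w : C(Torus, ℝ)} (hw : HasDerivAt ue w t) {m : ℕ} {M : ℝ}
    (hc : WtBound (m + 4) M (fCoeff (ue t))) (k : Fin 2 → ℤ) :
    fCoeff w k + ε ^ 2 * (symL k * (symL k * fCoeff (ue t) k))
      + ∑ i, symD i k * fCoeff (fluxC (gradC (fCoeff (ue t))) i) k = 0 := by
  have h0 : ∀ x, deriv (fun τ => ue τ x) t = w x := fun x =>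
    (show HasDerivAt (fun τ => ue τ x) (w x) t from
      (ContinuousMap.evalCLM ℝ x : C(Torus, ℝ) →L[ℝ] ℝ).hasFDerivAt.comp_hasDerivAt t hw).deriv
  have hsum : Summable fun k => ‖fCoeff (ue t) k‖ := WtBound.summable (n := m + 2) hc
  have hp : ∀ i x, pderiv i (ue t) x = gradC (fCoeff (ue t)) i x := fun i x =>
    pderiv_eq_seriesC hsum (hc.summable_gradCoeff i) x
  set X := fCoeff w k + ε ^ 2 * (symL k * (symL k * fCoeff (ue t) k))
      + ∑ i, symD i k * fCoeff (fluxC (gradC (fCoeff (ue t))) i) k with hX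
  have key : ∀ z : ℂ, (z * X).re = 0 := by
    intro z
    have h := hsol t ht (testFn k z) (isSmooth_testFn k z)
    simp only [h0, hp, pderiv_testFn, laplacian_testFn] at h
    have e : ∀ x, (∑ i, gradC (fCoeff (ue t)) i x * testFn k (symD i (-k) * z) x) /
          (1 + ∑ i, gradC (fCoeff (ue t)) i x ^ 2)
        = ∑ i, fluxC (gradC (fCoeff (ue t))) i x * testFn k (symD i (-k) * z) x := fun x => by
      rw [Finset.sum_div]
      refine Finset.sum_congr rfl fun i _ => ?_
      rw [fluxC_apply, flux]
      ring
    simp only [e] at h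
    have hint : ∫ x, ∑ i, fluxC (gradC (fCoeff (ue t))) i x * testFn k (symD i (-k) * z) x ∂torusMeasure
        = ∑ i, ∫ x, fluxC (gradC (fCoeff (ue t))) i x * testFn k (symD i (-k) * z) x ∂torusMeasure :=
      integral_finsetSum _ fun i _ => continuous_integrable
        ((fluxC (gradC (fCoeff (ue t))) i).continuous.mul (continuous_testFn k _))
    rw [hint] at h
    simp only [integral_mul_testFn] at h
    have hneg : ∀ i, symD i (-k) = -symD i k := fun i => by simp [symD]
    have hneg' : symL (-k) = symL k := by simp [symL]
    rw [hneg'] at h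
    simp only [hneg] at h
    have e2 : z * X = z * fCoeff w k - ∑ i, -symD i k * z * fCoeff (fluxC (gradC (fCoeff (ue t))) i) k
        + ((ε ^ 2 : ℝ) : ℂ) * (symL k * (symL k * z) * fCoeff (ue t) k) := by
      rw [hX]
      simp only [Fin.sum_univ_two]
      push_cast
      ring
    rw [e2, Complex.add_re, Complex.sub_re, Complex.re_sum, Complex.re_ofReal_mul]
    linarith
  -- Real test functions only give `Re (z X) = 0`; the choice `z = conj X` turns this into `|X|² =
  -- 0`.
  have h1 := key ((starRingEnd ℂ) X)
  rw [← Complex.normSq_eq_conj_mul_self, Complex.ofReal_re] at h1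
  exact Complex.normSq_eq_zero.1 h1

/-- Weierstrass' test with a majorant of order `wt^(-3/2)`. The continuity serves to extend the mode
equation from the open time interval to its endpoints, since a time level may coincide with `T`. -/
lemma continuousOn_gradC {a b : ℝ} {c : ℝ → (Fin 2 → ℤ) → ℂ} {m : ℕ} {M : ℝ}
    (hc : ∀ t ∈ Icc a b, WtBound (m + 4) M (c t)) (hcont : ∀ k, ContinuousOn (fun t => c t k) (Icc a b))
    (l : Fin 2) : ContinuousOn (fun t => gradC (c t) l) (Icc a b) := by
  have hlin : ∀ f : C(Torus, ℂ), ∃ g : C(Torus, ℝ), ∀ x, g x = (f x).re :=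
    fun f => ⟨⟨fun x => (f x).re, by fun_prop⟩, fun _ => rfl⟩
  have hser : ContinuousOn (fun t => ∑' k, gradCoeff (c t) l k •
      (UnitAddTorus.mFourier k : C(Torus, ℂ))) (Icc a b) := by
    rcases (Icc a b).eq_empty_or_nonempty with he | ⟨t₀, ht₀⟩
    · rw [he]; exact continuousOn_empty _
    have hM : 0 ≤ M := (hc t₀ ht₀).nonneg
    have hbound : ∀ k, ∀ t ∈ Icc a b, ‖gradCoeff (c t) l k‖
        ≤ √(4 * Real.pi ^ 2 * M) * √((wt k ^ 3)⁻¹) := by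
      intro k t ht
      have h1 := hc t ht {k}
      rw [Finset.sum_singleton] at h1
      have hw := wt_pos k
      have h2 : wt k ^ 4 * ‖c t k‖ ^ 2 ≤ M := by
        refine le_trans ?_ h1
        gcongr
        · exact one_le_wt k
        · omega
      rw [← Real.sqrt_mul (by positivity)]
      refine Real.le_sqrt_of_sq_le ?_
      rw [gradCoeff, norm_mul, mul_pow]
      calc _ ≤ (4 * Real.pi ^ 2 * wt k) * ‖c t k‖ ^ 2 := by gcongr; exact norm_symD_sq_le l k
        _ = 4 * Real.pi ^ 2 * (wt k ^ 4 * ‖c t k‖ ^ 2) * (wt k ^ 3)⁻¹ := by field_simp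
        _ ≤ _ := by gcongr
    have hsum : Summable fun k => √(4 * Real.pi ^ 2 * M) * √((wt k ^ 3)⁻¹) := by
      refine Summable.mul_left _ ?_
      -- The exponent 3 exceeds the rank 2 of the lattice.
      have h3 : Summable fun k : Fin 2 → ℤ => ‖k‖ ^ (-(3 : ℝ)) := by
        simpa [Real.rpow_neg] using EisensteinSeries.summable_one_div_norm_rpow (k := 3) (by norm_num)
      refine Summable.of_norm_bounded_eventually h3 ?_
      filter_upwards [(Set.finite_singleton (0 : Fin 2 → ℤ)).compl_mem_cofinite] with k hk
      have hk0 : 0 < ‖k‖ := norm_pos_iff.2 (by simpa using hk)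
      rw [Real.norm_of_nonneg (Real.sqrt_nonneg _)]
      refine Real.sqrt_le_iff.2 ⟨by positivity, ?_⟩
      have h4 : ‖k‖ ^ 2 ≤ wt k := by
        obtain ⟨i, hi⟩ : ∃ i, ‖k‖ ≤ ‖k i‖ := by
          by_contra hcon
          push Not at hcon
          exact lt_irrefl _ ((pi_norm_lt_iff hk0).2 hcon)
        have h5 : ‖k‖ ^ 2 ≤ (k i : ℝ) ^ 2 := by
          rw [← sq_abs (k i : ℝ)]
          refine pow_le_pow_left₀ (norm_nonneg _) (hi.trans (le_of_eq ?_)) 2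
          exact Int.norm_eq_abs (k i)
        have h6 := Finset.single_le_sum (fun j _ => sq_nonneg (k j : ℝ)) (Finset.mem_univ i)
        unfold wt; linarith
      have h7 : ‖k‖ ^ (-(3 : ℝ)) = (‖k‖ ^ 3)⁻¹ := by
        rw [Real.rpow_neg (norm_nonneg _)]
        congr 1
        exact_mod_cast Real.rpow_natCast ‖k‖ 3
      rw [h7, inv_pow, ← pow_mul]
      refine inv_anti₀ (by positivity) ?_
      calc ‖k‖ ^ (3 * 2) = (‖k‖ ^ 2) ^ 3 := by ring
        _ ≤ _ := by gcongr
    refine continuousOn_tsum (fun k => ?_) hsum fun k t ht => ?_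
    · exact (continuousOn_const.mul (hcont k)).smul continuousOn_const
    · rw [norm_smul, UnitAddTorus.mFourier_norm, mul_one]
      exact hbound k t ht
  intro t ht
  have h1 := hser t ht
  rw [ContinuousWithinAt, tendsto_iff_norm_sub_tendsto_zero] at h1 ⊢
  refine squeeze_zero (fun _ => norm_nonneg _) (fun τ => ?_) h1
  refine (ContinuousMap.norm_le _ (norm_nonneg _)).2 fun x => ?_
  have h2 : (gradC (c τ) l - gradC (c t) l) x
      = (((∑' k, gradCoeff (c τ) l k • (UnitAddTorus.mFourier k : C(Torus, ℂ)))
        - ∑' k, gradCoeff (c t) l k • (UnitAddTorus.mFourier k : C(Torus, ℂ))) x).re := by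
    simp only [gradC, seriesC, ContinuousMap.sub_apply, ContinuousMap.coe_mk, Complex.sub_re]
  rw [h2]
  exact (Complex.abs_re_le_norm _).trans (ContinuousMap.norm_coe_le_norm _ x)

lemma continuousOn_fluxC {s : Set ℝ} {P : ℝ → Fin 2 → C(Torus, ℝ)}
    (hP : ∀ l, ContinuousOn (fun t => P t l) s) (i : Fin 2) :
    ContinuousOn (fun t => fluxC (P t) i) s := by
  intro t ht
  rw [ContinuousWithinAt, tendsto_iff_norm_sub_tendsto_zero]
  have h1 : Filter.Tendsto (fun τ => 3 * ∑ l, ‖P τ l - P t l‖) (nhdsWithin t s) (nhds 0) := by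
    have h2 : ∀ l ∈ (Finset.univ : Finset (Fin 2)),
        Filter.Tendsto (fun τ => ‖P τ l - P t l‖) (nhdsWithin t s) (nhds 0) := fun l _ =>
      tendsto_iff_norm_sub_tendsto_zero.1 (hP l t ht)
    simpa using (tendsto_finsetSum _ h2).const_mul 3
  exact squeeze_zero (fun _ => norm_nonneg _) (fun τ => norm_fluxC_sub_le _ _ i) h1

/-! ### Third differences of the flux -/

/-- Four consecutive values whose differences of orders `1, 2, 3` are controlled by `X, Y, Z`. -/
structure Ctrl (X Y Z R : ℝ) (f : ℕ → ℝ) : Prop where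
  nonneg : 0 ≤ R
  d0 : ∀ j ≤ 3, |f j| ≤ R
  d1 : ∀ j ≤ 2, |f (j + 1) - f j| ≤ R * X
  d2 : ∀ j ≤ 1, |f (j + 2) - 2 * f (j + 1) + f j| ≤ R * Y
  d3 : |f 3 - 3 * f 2 + 3 * f 1 - f 0| ≤ R * Z

lemma abs_add_mul_three_le {x₁ y₁ x₂ y₂ x₃ y₃ a₁ b₁ a₂ b₂ a₃ b₃ : ℝ} (h₁ : |x₁| ≤ a₁) (h₁' : |y₁| ≤ b₁)
    (h₂ : |x₂| ≤ a₂) (h₂' : |y₂| ≤ b₂) (h₃ : |x₃| ≤ a₃) (h₃' : |y₃| ≤ b₃) :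
    |x₁ * y₁ + 2 * (x₂ * y₂) + x₃ * y₃| ≤ a₁ * b₁ + 2 * (a₂ * b₂) + a₃ * b₃ := by
  have e : ∀ {x y a b : ℝ}, |x| ≤ a → |y| ≤ b → |x * y| ≤ a * b := fun hx hy => by
    rw [abs_mul]; exact mul_le_mul hx hy (abs_nonneg _) ((abs_nonneg _).trans hx)
  refine (abs_add_three _ _ _).trans ?_
  rw [abs_mul 2, abs_two]
  linarith [e h₁ h₁', e h₂ h₂', e h₃ h₃']

lemma abs_add_mul_four_le {x₁ y₁ x₂ y₂ x₃ y₃ x₄ y₄ a₁ b₁ a₂ b₂ a₃ b₃ a₄ b₄ : ℝ}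
    (h₁ : |x₁| ≤ a₁) (h₁' : |y₁| ≤ b₁) (h₂ : |x₂| ≤ a₂) (h₂' : |y₂| ≤ b₂) (h₃ : |x₃| ≤ a₃)
    (h₃' : |y₃| ≤ b₃) (h₄ : |x₄| ≤ a₄) (h₄' : |y₄| ≤ b₄) :
    |x₁ * y₁ + 3 * (x₂ * y₂) + 3 * (x₃ * y₃) + x₄ * y₄|
      ≤ a₁ * b₁ + 3 * (a₂ * b₂) + 3 * (a₃ * b₃) + a₄ * b₄ := by
  have e : ∀ {x y a b : ℝ}, |x| ≤ a → |y| ≤ b → |x * y| ≤ a * b := fun hx hy => by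
    rw [abs_mul]; exact mul_le_mul hx hy (abs_nonneg _) ((abs_nonneg _).trans hx)
  have h : |(3 : ℝ)| = 3 := by norm_num
  refine (abs_add_le _ _).trans ?_
  have := abs_add_three (x₁ * y₁) (3 * (x₂ * y₂)) (3 * (x₃ * y₃))
  rw [abs_mul 3, abs_mul 3, h] at this
  linarith [e h₁ h₁', e h₂ h₂', e h₃ h₃', e h₄ h₄']

section Ctrl

variable {X Y Z R R' : ℝ} {f g : ℕ → ℝ}

lemma Ctrl.add (hf : Ctrl X Y Z R f) (hg : Ctrl X Y Z R' g) :
    Ctrl X Y Z (R + R') (fun j => f j + g j) where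
  nonneg := add_nonneg hf.nonneg hg.nonneg
  d0 j hj := (abs_add_le _ _).trans (add_le_add (hf.d0 j hj) (hg.d0 j hj))
  d1 j hj := by
    rw [add_mul]
    refine le_trans (le_of_eq ?_) ((abs_add_le _ _).trans (add_le_add (hf.d1 j hj) (hg.d1 j hj)))
    congr 1; ring
  d2 j hj := by
    rw [add_mul]
    refine le_trans (le_of_eq ?_) ((abs_add_le _ _).trans (add_le_add (hf.d2 j hj) (hg.d2 j hj)))
    congr 1; ring
  d3 := by
    rw [add_mul]
    refine le_trans (le_of_eq ?_) ((abs_add_le _ _).trans (add_le_add hf.d3 hg.d3))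
    congr 1; ring

lemma Ctrl.one (hX : 0 ≤ X) (hY : 0 ≤ Y) (hZ : 0 ≤ Z) : Ctrl X Y Z 1 (fun _ => 1) where
  nonneg := zero_le_one
  d0 _ _ := by simp
  d1 _ _ := by simpa using hX
  d2 _ _ := by norm_num; exact hY
  d3 := by norm_num; exact hZ

/-- Discrete Leibniz rule. The conditions `X² ≤ Y` and `XY ≤ Z` return every mixed product to the
control of the right order; the constant 8 is the sum `1 + 3 + 3 + 1` of the binomial coefficients.
-/
lemma Ctrl.mul (hX : 0 ≤ X) (hXX : X ^ 2 ≤ Y) (hXY : X * Y ≤ Z)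
    (hf : Ctrl X Y Z R f) (hg : Ctrl X Y Z R' g) : Ctrl X Y Z (8 * (R * R')) (fun j => f j * g j) := by
  have hR := hf.nonneg
  have hR' := hg.nonneg
  have hRR : 0 ≤ R * R' := mul_nonneg hR hR'
  have hY : 0 ≤ Y := (sq_nonneg X).trans hXX
  have hZ : 0 ≤ Z := (mul_nonneg hX hY).trans hXY
  refine ⟨by positivity, fun j hj => ?_, fun j hj => ?_, fun j hj => ?_, ?_⟩
  · rw [abs_mul]
    nlinarith [mul_le_mul (hf.d0 j hj) (hg.d0 j hj) (abs_nonneg _) hR]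
  · have h := abs_add_mul_three_le (hf.d0 j (by omega)) (hg.d1 j hj) (show |(0 : ℝ)| ≤ 0 by simp)
      (show |(0 : ℝ)| ≤ 0 by simp) (hf.d1 j hj) (hg.d0 (j + 1) (by omega))
    have e : f (j + 1) * g (j + 1) - f j * g j
        = f j * (g (j + 1) - g j) + 2 * (0 * 0) + (f (j + 1) - f j) * g (j + 1) := by ring
    rw [e]
    nlinarith [mul_nonneg hRR hX]
  · have h := abs_add_mul_three_le (hf.d0 j (by omega)) (hg.d2 j hj) (hf.d1 j (by omega))
      (hg.d1 (j + 1) (by omega)) (hf.d2 j hj) (hg.d0 (j + 2) (by omega))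
    have e : f (j + 2) * g (j + 2) - 2 * (f (j + 1) * g (j + 1)) + f j * g j
        = f j * (g (j + 2) - 2 * g (j + 1) + g j)
          + 2 * ((f (j + 1) - f j) * (g (j + 1 + 1) - g (j + 1)))
          + (f (j + 2) - 2 * f (j + 1) + f j) * g (j + 2) := by ring
    rw [e]
    nlinarith [mul_nonneg hRR hY, mul_le_mul_of_nonneg_left hXX hRR]
  · have h := abs_add_mul_four_le (hf.d0 0 (by omega)) hg.d3 (hf.d1 0 (by omega)) (hg.d2 1 (by omega))
      (hf.d2 0 (by omega)) (hg.d1 2 (by omega)) hf.d3 (hg.d0 3 (by omega))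
    have e : f 3 * g 3 - 3 * (f 2 * g 2) + 3 * (f 1 * g 1) - f 0 * g 0
        = f 0 * (g 3 - 3 * g 2 + 3 * g 1 - g 0)
          + 3 * ((f (0 + 1) - f 0) * (g (1 + 2) - 2 * g (1 + 1) + g 1))
          + 3 * ((f (0 + 2) - 2 * f (0 + 1) + f 0) * (g (2 + 1) - g 2))
          + (f 3 - 3 * f 2 + 3 * f 1 - f 0) * g 3 := by norm_num; ring
    rw [e]
    nlinarith [mul_nonneg hRR hZ, mul_le_mul_of_nonneg_left hXY hRR]

/-- The Leibniz rule for `f · f⁻¹ = 1` is solved for the highest difference of `f⁻¹`, one order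
after the other. The constant is `13 = 9 + 3 + 1`. -/
lemma Ctrl.inv (hX : 0 ≤ X) (hXX : X ^ 2 ≤ Y) (hXY : X * Y ≤ Z)
    (hf : Ctrl X Y Z R f) (hf1 : ∀ j, 1 ≤ f j) :
    Ctrl X Y Z (13 * R ^ 3) (fun j => (f j)⁻¹) := by
  have hR1 : 1 ≤ R := (hf1 0).trans ((le_abs_self _).trans (hf.d0 0 (by omega)))
  have hR := hf.nonneg
  have hY : 0 ≤ Y := (sq_nonneg X).trans hXX
  have hZ : 0 ≤ Z := (mul_nonneg hX hY).trans hXY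
  have hR2 : R ≤ R ^ 2 := by nlinarith
  have hR3 : R ^ 2 ≤ R ^ 3 := by nlinarith [sq_nonneg R]
  have hne : ∀ j, f j ≠ 0 := fun j => (zero_lt_one.trans_le (hf1 j)).ne'
  have hg0 : ∀ j, |(f j)⁻¹| ≤ 1 := fun j => by
    rw [abs_inv, abs_of_pos (zero_lt_one.trans_le (hf1 j))]
    exact inv_le_one_of_one_le₀ (hf1 j)
  have hg1 : ∀ j ≤ 2, |(f (j + 1))⁻¹ - (f j)⁻¹| ≤ R * X := by
    intro j hj
    have e : (f (j + 1))⁻¹ - (f j)⁻¹ = -((f j)⁻¹ * ((f (j + 1))⁻¹ * (f (j + 1) - f j))) := by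
      have h1 := hne j
      have h2 := hne (j + 1)
      field_simp
      ring
    rw [e, abs_neg, abs_mul, abs_mul]
    calc _ ≤ 1 * (1 * (R * X)) := by
          gcongr
          · exact hg0 j
          · exact hg0 (j + 1)
          · exact hf.d1 j hj
      _ = _ := by ring
  have hg2 : ∀ j ≤ 1, |(f (j + 2))⁻¹ - 2 * (f (j + 1))⁻¹ + (f j)⁻¹| ≤ 3 * R ^ 2 * Y := by
    intro j hj
    have h := abs_add_mul_three_le (show |(0 : ℝ)| ≤ 0 by simp) (show |(0 : ℝ)| ≤ 0 by simp)
      (hf.d1 j (by omega)) (hg1 (j + 1) (by omega)) (hf.d2 j hj) (hg0 (j + 2))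
    have e : (f (j + 2))⁻¹ - 2 * (f (j + 1))⁻¹ + (f j)⁻¹
        = -((f j)⁻¹ * (0 * 0 + 2 * ((f (j + 1) - f j) * ((f (j + 1 + 1))⁻¹ - (f (j + 1))⁻¹))
          + (f (j + 2) - 2 * f (j + 1) + f j) * (f (j + 2))⁻¹)) := by
      have h1 := hne j
      have h2 := hne (j + 1)
      have h3 := hne (j + 2)
      rw [show j + 1 + 1 = j + 2 by ring]
      field_simp
      ring
    rw [e, abs_neg, abs_mul]
    calc _ ≤ 1 * _ := mul_le_mul (hg0 j) h (abs_nonneg _) zero_le_one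
      _ ≤ _ := by nlinarith [mul_le_mul_of_nonneg_left hXX (sq_nonneg R),
          mul_le_mul_of_nonneg_right hR2 hY]
  refine ⟨by positivity, fun j hj => ?_, fun j hj => ?_, fun j hj => ?_, ?_⟩
  · refine (hg0 j).trans ?_
    nlinarith
  · refine (hg1 j hj).trans ?_
    have : R ≤ 13 * R ^ 3 := by nlinarith
    gcongr
  · refine (hg2 j hj).trans ?_
    have : 3 * R ^ 2 ≤ 13 * R ^ 3 := by nlinarith
    gcongr
  · have h := abs_add_mul_four_le (show |(0 : ℝ)| ≤ 0 by simp) (show |(0 : ℝ)| ≤ 0 by simp)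
      (hf.d1 0 (by omega)) (hg2 1 (by omega)) (hf.d2 0 (by omega)) (hg1 2 (by omega)) hf.d3 (hg0 3)
    have e : (f 3)⁻¹ - 3 * (f 2)⁻¹ + 3 * (f 1)⁻¹ - (f 0)⁻¹
        = -((f 0)⁻¹ * (0 * 0 + 3 * ((f (0 + 1) - f 0) * ((f (1 + 2))⁻¹ - 2 * (f (1 + 1))⁻¹ + (f 1)⁻¹))
          + 3 * ((f (0 + 2) - 2 * f (0 + 1) + f 0) * ((f (2 + 1))⁻¹ - (f 2)⁻¹))
          + (f 3 - 3 * f 2 + 3 * f 1 - f 0) * (f 3)⁻¹)) := by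
      have h0 := hne 0
      have h1 := hne 1
      have h2 := hne 2
      have h3 := hne 3
      norm_num
      field_simp
      ring
    rw [e, abs_neg, abs_mul]
    have hR3' : 0 ≤ R ^ 3 := by positivity
    calc _ ≤ 1 * _ := mul_le_mul (hg0 0) h (abs_nonneg _) zero_le_one
      _ = 9 * R ^ 3 * (X * Y) + 3 * R ^ 2 * (X * Y) + R * Z := by ring
      _ ≤ 9 * R ^ 3 * Z + 3 * R ^ 2 * Z + R * Z := by gcongr
      _ ≤ 9 * R ^ 3 * Z + 3 * R ^ 3 * Z + R ^ 3 * Z := by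
          have : R ≤ R ^ 3 := hR2.trans hR3
          gcongr
      _ = 13 * R ^ 3 * Z := by ring

end Ctrl

/-- The constant in the third difference estimate. -/
def fluxConst (R : ℝ) : ℝ := 8 * (R * (13 * (1 + (8 * (R * R) + 8 * (R * R))) ^ 3))

lemma Ctrl.flux {X Y Z R : ℝ} (hX : 0 ≤ X) (hZ : 0 ≤ Z) (hXX : X ^ 2 ≤ Y) (hXY : X * Y ≤ Z)
    {v : ℕ → Fin 2 → ℝ} (hv : ∀ l, Ctrl X Y Z R fun j => v j l) (i : Fin 2) :
    Ctrl X Y Z (fluxConst R) fun j => flux i (v j) := by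
  have hY : 0 ≤ Y := (sq_nonneg X).trans hXX
  have h1 := (Ctrl.one hX hY hZ).add (((hv 0).mul hX hXX hXY (hv 0)).add
    ((hv 1).mul hX hXX hXY (hv 1)))
  have h2 := (hv i).mul hX hXX hXY (h1.inv hX hXX hXY fun j => by
    nlinarith [mul_self_nonneg (v j 0), mul_self_nonneg (v j 1)])
  convert! h2 using 1
  funext j
  simp only [NSS.flux, Fin.sum_univ_two, div_eq_mul_inv, sq]

/-- The bound is linear in `D₁, D₂, D₃`, with `D` as the only other factor. Hence a pointwise use
with `D` a supremum bound can be summed in L² over the grid. -/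
lemma abs_third_difference_flux_le {R : ℝ} (hR : 1 ≤ R) {v : ℕ → Fin 2 → ℝ}
    (hv : ∀ l, ∀ j ≤ 3, |v j l| ≤ R) {D₁ D₂ D₃ D : ℝ} (hD₁ : D₁ ≤ D)
    (h₁ : ∀ l, ∀ j ≤ 2, |v (j + 1) l - v j l| ≤ D₁)
    (h₂ : ∀ l, ∀ j ≤ 1, |v (j + 2) l - 2 * v (j + 1) l + v j l| ≤ D₂)
    (h₃ : ∀ l, |v 3 l - 3 * v 2 l + 3 * v 1 l - v 0 l| ≤ D₃) (i : Fin 2) :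
    |flux i (v 3) - 3 * flux i (v 2) + 3 * flux i (v 1) - flux i (v 0)|
      ≤ fluxConst R * (D₃ + D * D₂ + D ^ 2 * D₁) := by
  have p₁ : 0 ≤ D₁ := (abs_nonneg _).trans (h₁ 0 0 (by omega))
  have p₂ : 0 ≤ D₂ := (abs_nonneg _).trans (h₂ 0 0 (by omega))
  have p₃ : 0 ≤ D₃ := (abs_nonneg _).trans (h₃ 0)
  have p : 0 ≤ D := p₁.trans hD₁
  -- The controls are enlarged just enough for `X² ≤ Y` and `XY ≤ Z`, replacing all but one factor
  -- `D₁` by `D`.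
  have hc : ∀ l, Ctrl D₁ (D₂ + D * D₁) (D₃ + D * D₂ + D ^ 2 * D₁) R fun j => v j l := fun l => by
    have a1 : D₂ ≤ D₂ + D * D₁ := by nlinarith
    have a2 : D₃ ≤ D₃ + D * D₂ + D ^ 2 * D₁ := by nlinarith [mul_nonneg p p₂, mul_nonneg (sq_nonneg D) p₁]
    have a3 : 0 ≤ D₂ + D * D₁ := by positivity
    have a4 : 0 ≤ D₃ + D * D₂ + D ^ 2 * D₁ := by positivity
    exact ⟨by linarith, hv l, fun j hj => (h₁ l j hj).trans (by nlinarith),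
      fun j hj => (h₂ l j hj).trans (by nlinarith), (h₃ l).trans (by nlinarith)⟩
  refine (Ctrl.flux p₁ (by positivity) ?_ ?_ hc i).d3
  · nlinarith [mul_le_mul_of_nonneg_right hD₁ p₁]
  · nlinarith [mul_le_mul_of_nonneg_right hD₁ p₂, mul_le_mul_of_nonneg_right hD₁ (mul_nonneg p p₁)]

/-! ### Third differences of the discrete flux -/

lemma trig_add_smul (K : ℕ) (r : ℝ) (a b : (Fin 2 → ℤ) → ℂ) (x : Torus) :
    trig K (fun k => a k + r * b k) x = trig K a x + r * trig K b x := by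
  simp only [trig]
  rw [← Complex.re_ofReal_mul, ← Complex.add_re, Finset.mul_sum, ← Finset.sum_add_distrib]
  congr 1
  exact Finset.sum_congr rfl fun k _ => by ring

lemma trig_lincomb (K : ℕ) (r₀ r₁ r₂ r₃ : ℝ) (a b c d : (Fin 2 → ℤ) → ℂ) (x : Torus) :
    trig K (fun k => r₀ * a k + r₁ * b k + r₂ * c k + r₃ * d k) x
      = r₀ * trig K a x + r₁ * trig K b x + r₂ * trig K c x + r₃ * trig K d x := by
  rw [trig_add_smul K r₃ (fun k => r₀ * a k + r₁ * b k + r₂ * c k),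
    trig_add_smul K r₂ (fun k => r₀ * a k + r₁ * b k), trig_add_smul K r₁ (fun k => r₀ * a k)]
  have h := trig_add_smul K r₀ (fun _ => 0) a x
  simp only [zero_add] at h
  rw [h]
  simp [trig]

lemma gradCoeff_lincomb (r₀ r₁ r₂ r₃ : ℝ) (a b c d : (Fin 2 → ℤ) → ℂ) (l : Fin 2) :
    gradCoeff (fun k => r₀ * a k + r₁ * b k + r₂ * c k + r₃ * d k) l
      = fun k => r₀ * gradCoeff a l k + r₁ * gradCoeff b l k + r₂ * gradCoeff c l k
        + r₃ * gradCoeff d l k := by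
  funext k
  simp only [gradCoeff]
  ring

lemma norm2_mono {K : ℕ} {f g : Grid K → ℝ} (h : ∀ p, |f p| ≤ g p) : norm2 f ≤ norm2 g := by
  refine Real.sqrt_le_sqrt ?_
  refine mul_le_mul_of_nonneg_left (Finset.sum_le_sum fun p _ => ?_) (sq_nonneg _)
  rw [← sq_abs]
  exact pow_le_pow_left₀ (abs_nonneg _) (h p) 2

lemma norm2_smul {K : ℕ} (r : ℝ) (f : Grid K → ℝ) : norm2 (r • f) = |r| * norm2 f := by
  have h : meshSize K ^ 2 * ∑ p, (r • f) p ^ 2 = r ^ 2 * (meshSize K ^ 2 * ∑ p, f p ^ 2) := by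
    simp only [Pi.smul_apply, smul_eq_mul, mul_pow, ← Finset.mul_sum]
    ring
  rw [norm2, h, Real.sqrt_mul (sq_nonneg r), Real.sqrt_sq_eq_abs, norm2]

lemma norm2_abs {K : ℕ} (f : Grid K → ℝ) : norm2 (fun p => |f p|) = norm2 f := by
  simp only [norm2, sq_abs]

lemma norm2_sum_abs_le {K : ℕ} {ι : Type*} (A : Finset ι) (g : ι → Grid K → ℝ) :
    norm2 (fun p => ∑ a ∈ A, |g a p|) ≤ ∑ a ∈ A, norm2 (g a) := by
  classical
  induction A using Finset.induction_on with
  | empty => simp [norm2]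
  | insert a A ha ih =>
    simp only [Finset.sum_insert ha]
    refine (norm2_add_le (fun p => |g a p|) fun p => ∑ a ∈ A, |g a p|).trans ?_
    rw [norm2_abs]
    linarith

lemma norm2_grad_le {K : ℕ} {b : (Fin 2 → ℤ) → ℂ} (hb : IsHerm b) {N : ℝ} (hN : 0 ≤ N)
    (h : WtBound 2 (N ^ 2) b) (l : Fin 2) :
    norm2 (fun p => trig K (gradCoeff b l) (gridPoint K p)) ≤ 2 * Real.pi * N := by
  refine le_of_sq_le_sq ?_ (by positivity)
  rw [norm2_sq_trig K (hb.gradCoeff l)]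
  calc _ ≤ ∑ k ∈ freq K, 4 * Real.pi ^ 2 * (wt k ^ 2 * ‖b k‖ ^ 2) := by
        refine Finset.sum_le_sum fun k _ => ?_
        rw [gradCoeff, norm_mul, mul_pow]
        have h1 := norm_symD_sq_le l k
        have h2 := one_le_wt k
        have h3 : ‖symD l k‖ ^ 2 ≤ 4 * Real.pi ^ 2 * wt k ^ 2 :=
          h1.trans (by gcongr; nlinarith)
        nlinarith [mul_le_mul_of_nonneg_right h3 (sq_nonneg ‖b k‖)]
    _ ≤ 4 * Real.pi ^ 2 * N ^ 2 := by
        rw [← Finset.mul_sum]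
        exact mul_le_mul_of_nonneg_left (h _) (by positivity)
    _ = _ := by ring

/-- Interpolation: the supremum of the gradient is controlled by the `H²` and `H⁴` norms. -/
lemma sum_norm_gradCoeff_le {b : (Fin 2 → ℤ) → ℂ} {N N' : ℝ} (hN : 0 ≤ N) (hN' : 0 ≤ N')
    (h : WtBound 2 (N ^ 2) b) (h' : WtBound 4 (N' ^ 2) b) (l : Fin 2) (S : Finset (Fin 2 → ℤ)) :
    ∑ k ∈ S, ‖gradCoeff b l k‖ ≤ √(68 * Real.pi ^ 2 * (N * N')) := by
  refine Real.le_sqrt_of_sq_le ((sq_sum_le S _).trans ?_)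
  have h1 : ∑ k ∈ S, wt k ^ 2 * ‖gradCoeff b l k‖ ^ 2
      ≤ 4 * Real.pi ^ 2 * ∑ k ∈ S, (wt k * ‖b k‖) * (wt k ^ 2 * ‖b k‖) := by
    rw [Finset.mul_sum]
    refine Finset.sum_le_sum fun k _ => ?_
    rw [gradCoeff, norm_mul, mul_pow]
    have hw := wt_pos k
    calc _ ≤ wt k ^ 2 * ((4 * Real.pi ^ 2 * wt k) * ‖b k‖ ^ 2) := by
          gcongr; exact norm_symD_sq_le l k
      _ = _ := by ring
  -- The weight `wt³` lies halfway between those of H² and H⁴, so Cauchy–Schwarz gives the geometric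
  -- mean of the two norms.
  have h2 : ∑ k ∈ S, (wt k * ‖b k‖) * (wt k ^ 2 * ‖b k‖) ≤ N * N' := by
    refine le_of_sq_le_sq ((Finset.sum_mul_sq_le_sq_mul_sq S _ _).trans ?_) (mul_nonneg hN hN')
    rw [mul_pow]
    refine mul_le_mul ((le_of_eq ?_).trans (h S)) ((le_of_eq ?_).trans (h' S))
      (Finset.sum_nonneg fun _ _ => sq_nonneg _) (sq_nonneg _)
    · exact Finset.sum_congr rfl fun k _ => by ring
    · exact Finset.sum_congr rfl fun k _ => by ring
  nlinarith [mul_le_mul_of_nonneg_left h2 (by positivity : 0 ≤ 4 * Real.pi ^ 2)]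

lemma abs_le_sum_abs_product {n : ℕ} (g : Fin 2 → ℕ → ℝ) {l : Fin 2} {j : ℕ} (hj : j < n) :
    |g l j| ≤ ∑ q ∈ (Finset.univ : Finset (Fin 2)) ×ˢ Finset.range n, |g q.1 q.2| := by
  have hm : (l, j) ∈ (Finset.univ : Finset (Fin 2)) ×ˢ Finset.range n := by simp [hj]
  exact Finset.single_le_sum (f := fun q : Fin 2 × ℕ => |g q.1 q.2|)
    (fun _ _ => abs_nonneg _) hm

-- Differences of the gradient are measured in L² through `N₁, N₂, N₃`, and first differences also
-- uniformly through the interpolated quantity `√(N₁ N₁')`. Interpolation is essential in the cubic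
-- term: with the H⁴ norm alone its square would be of order `d⁴ I²` for the stencil integral `I`,
-- instead of `d⁵ I`.
set_option maxHeartbeats 400000 in
lemma exists_third_difference_bound (M : ℝ) :
    ∃ C, 0 ≤ C ∧ ∀ (K : ℕ) (c : ℕ → (Fin 2 → ℤ) → ℂ), (∀ j, IsHerm (c j)) →
      (∀ j ≤ 3, WtBound 4 M (c j)) → ∀ N₁ N₁' N₂ N₃ : ℝ, 0 ≤ N₁ → 0 ≤ N₁' → 0 ≤ N₂ → 0 ≤ N₃ →
      (∀ j ≤ 2, WtBound 2 (N₁ ^ 2) fun k => c (j + 1) k - c j k) →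
      (∀ j ≤ 2, WtBound 4 (N₁' ^ 2) fun k => c (j + 1) k - c j k) →
      (∀ j ≤ 1, WtBound 2 (N₂ ^ 2) fun k => c (j + 2) k - 2 * c (j + 1) k + c j k) →
      (WtBound 2 (N₃ ^ 2) fun k => c 3 k - 3 * c 2 k + 3 * c 1 k - c 0 k) → ∀ i : Fin 2,
      norm2 (fun p : Grid K => flux i (fun l => trig K (gradCoeff (c 3) l) (gridPoint K p))
        - 3 * flux i (fun l => trig K (gradCoeff (c 2) l) (gridPoint K p))
        + 3 * flux i (fun l => trig K (gradCoeff (c 1) l) (gridPoint K p))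
        - flux i (fun l => trig K (gradCoeff (c 0) l) (gridPoint K p)))
      ≤ C * (N₃ + √(N₁ * N₁') * N₂ + N₁ * N₁' * N₁) := by
  set R := max 1 (√(17 * ((4 * Real.pi ^ 2) ^ 2 * M))) with hR
  set κ := 6 * √(68 * Real.pi ^ 2) with hκ
  have hR1 : 1 ≤ R := le_max_left _ _
  have hF : 0 ≤ fluxConst R := by unfold fluxConst; positivity
  have hκ0 : 0 ≤ κ := by positivity
  refine ⟨fluxConst R * (12 * Real.pi * (1 + κ + κ ^ 2)), by positivity, ?_⟩
  intro K c hc hM N₁ N₁' N₂ N₃ p₁ p₁' p₂ p₃ h₁ h₁' h₂ h₃ i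
  set v : Grid K → ℕ → Fin 2 → ℝ := fun p j l => trig K (gradCoeff (c j) l) (gridPoint K p) with hv
  have hlin : ∀ (r₀ r₁ r₂ r₃ : ℝ) (j₀ j₁ j₂ j₃ : ℕ) (l : Fin 2) (p : Grid K),
      r₀ * v p j₀ l + r₁ * v p j₁ l + r₂ * v p j₂ l + r₃ * v p j₃ l
      = trig K (gradCoeff (fun k => r₀ * c j₀ k + r₁ * c j₁ k + r₂ * c j₂ k + r₃ * c j₃ k) l)
        (gridPoint K p) := by
    intro r₀ r₁ r₂ r₃ j₀ j₁ j₂ j₃ l p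
    rw [gradCoeff_lincomb, trig_lincomb]
  have e₁ : ∀ j l p, v p (j + 1) l - v p j l
      = trig K (gradCoeff (fun k => c (j + 1) k - c j k) l) (gridPoint K p) := by
    intro j l p
    have h := hlin 1 (-1) 0 0 (j + 1) j j j l p
    simp only [Complex.ofReal_one, Complex.ofReal_neg, Complex.ofReal_zero, zero_mul, add_zero,
      one_mul, neg_mul, ← sub_eq_add_neg] at h
    exact h
  have e₂ : ∀ j l p, v p (j + 2) l - 2 * v p (j + 1) l + v p j l
      = trig K (gradCoeff (fun k => c (j + 2) k - 2 * c (j + 1) k + c j k) l) (gridPoint K p) := by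
    intro j l p
    have h := hlin 1 (-2) 1 0 (j + 2) (j + 1) j j l p
    simp only [Complex.ofReal_one, Complex.ofReal_neg, Complex.ofReal_zero, zero_mul, add_zero,
      one_mul, neg_mul, ← sub_eq_add_neg, Complex.ofReal_ofNat] at h
    exact h
  have e₃ : ∀ l p, v p 3 l - 3 * v p 2 l + 3 * v p 1 l - v p 0 l
      = trig K (gradCoeff (fun k => c 3 k - 3 * c 2 k + 3 * c 1 k - c 0 k) l) (gridPoint K p) := by
    intro l p
    have h := hlin 1 (-3) 3 (-1) 3 2 1 0 l p
    simp only [Complex.ofReal_one, Complex.ofReal_neg,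
      one_mul, neg_mul, ← sub_eq_add_neg, Complex.ofReal_ofNat] at h
    exact h
  have H₁ : ∀ j, IsHerm fun k => c (j + 1) k - c j k := fun j k => by
    simp only [hc _ k, map_sub]
  have H₂ : ∀ j, IsHerm fun k => c (j + 2) k - 2 * c (j + 1) k + c j k := fun j k => by
    simp only [hc _ k, map_sub, map_add, map_mul, Complex.conj_ofNat]
  have H₃ : IsHerm fun k => c 3 k - 3 * c 2 k + 3 * c 1 k - c 0 k := fun k => by
    simp only [hc _ k, map_sub, map_add, map_mul, Complex.conj_ofNat]
  set D₁ : Grid K → ℝ := fun p => ∑ q ∈ (Finset.univ : Finset (Fin 2)) ×ˢ Finset.range 3,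
    |v p (q.2 + 1) q.1 - v p q.2 q.1| with hD₁
  set D₂ : Grid K → ℝ := fun p => ∑ q ∈ (Finset.univ : Finset (Fin 2)) ×ˢ Finset.range 2,
    |v p (q.2 + 2) q.1 - 2 * v p (q.2 + 1) q.1 + v p q.2 q.1| with hD₂
  set D₃ : Grid K → ℝ := fun p => ∑ l, |v p 3 l - 3 * v p 2 l + 3 * v p 1 l - v p 0 l| with hD₃
  have n₁ : norm2 D₁ ≤ 12 * Real.pi * N₁ := by
    refine (norm2_sum_abs_le _ fun (q : Fin 2 × ℕ) p => v p (q.2 + 1) q.1 - v p q.2 q.1).trans ?_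
    refine (Finset.sum_le_card_nsmul _ _ (2 * Real.pi * N₁) fun q hq => ?_).trans (le_of_eq ?_)
    · simp only [e₁]
      have : q.2 ≤ 2 := by simp at hq; omega
      exact norm2_grad_le (H₁ _) p₁ (h₁ _ this) _
    · simp; ring
  have n₂ : norm2 D₂ ≤ 12 * Real.pi * N₂ := by
    refine (norm2_sum_abs_le _ fun (q : Fin 2 × ℕ) p =>
      v p (q.2 + 2) q.1 - 2 * v p (q.2 + 1) q.1 + v p q.2 q.1).trans ?_
    refine (Finset.sum_le_card_nsmul _ _ (2 * Real.pi * N₂) fun q hq => ?_).trans ?_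
    · simp only [e₂]
      have : q.2 ≤ 1 := by simp at hq; omega
      exact norm2_grad_le (H₂ _) p₂ (h₂ _ this) _
    · simp; nlinarith [mul_nonneg Real.pi_pos.le p₂]
  have n₃ : norm2 D₃ ≤ 12 * Real.pi * N₃ := by
    refine (norm2_sum_abs_le _ fun l p => v p 3 l - 3 * v p 2 l + 3 * v p 1 l - v p 0 l).trans ?_
    refine (Finset.sum_le_card_nsmul _ _ (2 * Real.pi * N₃) fun l _ => ?_).trans ?_
    · simp only [e₃]
      exact norm2_grad_le H₃ p₃ h₃ _
    · simp; nlinarith [mul_nonneg Real.pi_pos.le p₃]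
  have m₁ : ∀ p l j, j ≤ 2 → |v p (j + 1) l - v p j l| ≤ D₁ p := by
    intro p l j hj
    have h := abs_le_sum_abs_product (n := 3) (fun l j => v p (j + 1) l - v p j l) (l := l)
      (j := j) (by omega)
    simpa only [hD₁] using h
  have m₂ : ∀ p l j, j ≤ 1 → |v p (j + 2) l - 2 * v p (j + 1) l + v p j l| ≤ D₂ p := by
    intro p l j hj
    have h := abs_le_sum_abs_product (n := 2)
      (fun l j => v p (j + 2) l - 2 * v p (j + 1) l + v p j l) (l := l) (j := j) (by omega)
    simpa only [hD₂] using h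
  have m₃ : ∀ p l, |v p 3 l - 3 * v p 2 l + 3 * v p 1 l - v p 0 l| ≤ D₃ p := by
    intro p l
    simp only [hD₃]
    exact Finset.single_le_sum (f := fun l => |v p 3 l - 3 * v p 2 l + 3 * v p 1 l - v p 0 l|)
      (fun _ _ => abs_nonneg _) (Finset.mem_univ l)
  -- The factor 6 in `κ` counts the six first differences: two components and three consecutive
  -- pairs.
  set D := κ * √(N₁ * N₁') with hD
  have hD0 : 0 ≤ D := by positivity
  have bD : ∀ p, D₁ p ≤ D := by
    intro p
    simp only [hD₁]
    refine (Finset.sum_le_card_nsmul _ _ (√(68 * Real.pi ^ 2 * (N₁ * N₁'))) fun q hq => ?_).trans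
      (le_of_eq ?_)
    · have : q.2 ≤ 2 := by simp at hq; omega
      rw [e₁]
      exact (abs_trig_le K _ _).trans (sum_norm_gradCoeff_le p₁ p₁' (h₁ _ this) (h₁' _ this) _ _)
    · rw [Real.sqrt_mul (by positivity), hD, hκ]; simp; ring
  clear_value D₁ D₂ D₃
  have hbound : ∀ p, |flux i (v p 3) - 3 * flux i (v p 2) + 3 * flux i (v p 1) - flux i (v p 0)|
      ≤ (fluxConst R • ((D₃ + D • D₂) + D ^ 2 • D₁)) p := by
    intro p
    refine (abs_third_difference_flux_le hR1 (v := v p) (D₂ := D₂ p) (D₃ := D₃ p) ?_ (bD p) ?_ ?_ ?_ i).trans (le_of_eq ?_)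
    · intro l j hj
      have h := sum_symD_pow_le (m := 0) (hM j hj) (Nat.zero_le _) l l (freq K)
      simp only [pow_zero, one_mul, zero_add] at h
      exact (abs_trig_le K _ _).trans (h.trans (le_max_right _ _))
    · exact fun l j hj => m₁ p l j hj
    · exact fun l j hj => m₂ p l j hj
    · exact fun l => m₃ p l
    · simp only [Pi.smul_apply, Pi.add_apply, smul_eq_mul]
  refine (norm2_mono hbound).trans ?_
  rw [norm2_smul, abs_of_nonneg hF, mul_assoc]
  refine mul_le_mul_of_nonneg_left ?_ hF
  have t1 := norm2_add_le (D₃ + D • D₂) (D ^ 2 • D₁)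
  have t2 := norm2_add_le D₃ (D • D₂)
  rw [norm2_smul, abs_of_nonneg (sq_nonneg D)] at t1
  rw [norm2_smul, abs_of_nonneg hD0] at t2
  have hDsq : D ^ 2 = κ ^ 2 * (N₁ * N₁') := by
    rw [hD, mul_pow, Real.sq_sqrt (mul_nonneg p₁ p₁')]
  have u2 := mul_le_mul_of_nonneg_left n₂ hD0
  have u1 := mul_le_mul_of_nonneg_left n₁ (sq_nonneg D)
  have hs0 : 0 ≤ √(N₁ * N₁') := Real.sqrt_nonneg _
  have q1 : 0 ≤ N₁ * N₁' * N₁ := by positivity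
  have q2 : 0 ≤ √(N₁ * N₁') * N₂ := mul_nonneg hs0 p₂
  calc _ ≤ 12 * Real.pi * N₃ + D * (12 * Real.pi * N₂) + D ^ 2 * (12 * Real.pi * N₁) := by linarith
    _ = 12 * Real.pi * (N₃ + κ * (√(N₁ * N₁') * N₂) + κ ^ 2 * (N₁ * N₁' * N₁)) := by
        rw [hDsq, hD]; ring
    _ ≤ 12 * Real.pi * ((1 + κ + κ ^ 2) * (N₃ + √(N₁ * N₁') * N₂ + N₁ * N₁' * N₁)) := by
        gcongr
        nlinarith [mul_nonneg hκ0 p₃, mul_nonneg hκ0 q1, mul_nonneg (sq_nonneg κ) p₃,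
          mul_nonneg (sq_nonneg κ) q2]
    _ = _ := by ring

/-! ### Quantitative regularity of the exact solution -/

lemma ae_Icc_of_ae_Ioo {a b : ℝ} {p : ℝ → Prop} (h : ∀ᵐ t ∂(volume.restrict (Ioo a b)), p t) :
    ∀ᵐ t ∂(volume.restrict (Icc a b)), p t := by
  rwa [← Measure.restrict_congr_set (Ioo_ae_eq_Icc (μ := volume) (a := a) (b := b))]

lemma eqOn_Icc_of_ae_Ioo {Y : Type*} [TopologicalSpace Y] [T2Space Y] {a b : ℝ} (hab : a < b)
    {f g : ℝ → Y} (h : f =ᵐ[volume.restrict (Ioo a b)] g) (hf : ContinuousOn f (Icc a b))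
    (hg : ContinuousOn g (Icc a b)) : EqOn f g (Icc a b) :=
  Measure.eqOn_Icc_of_ae_eq volume hab.ne (ae_Icc_of_ae_Ioo h) hf hg

lemma SeqSpace.continuous_coord (k : Fin 2 → ℤ) : Continuous fun y : SeqSpace => y k := by
  refine continuous_iff_continuousAt.2 fun y => ?_
  rw [ContinuousAt, tendsto_iff_norm_sub_tendsto_zero]
  have h : Filter.Tendsto (fun z : SeqSpace => ‖z - y‖) (nhds y) (nhds 0) :=
    tendsto_iff_norm_sub_tendsto_zero.1 Filter.tendsto_id
  refine squeeze_zero (fun _ => norm_nonneg _) (fun z => ?_) h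
  exact lp.norm_apply_le_norm (by norm_num) (z - y) k

lemma wtBound_of_seq {s : ℕ} {y : SeqSpace} {c : (Fin 2 → ℤ) → ℂ}
    (h : ∀ k, y k = (√(wt k ^ s) : ℂ) * c k) : WtBound s (‖y‖ ^ 2) c := by
  intro S
  have h1 := lp.sum_rpow_le_norm_rpow (p := 2) (by norm_num) y S
  simp only [ENNReal.toReal_ofNat, Real.rpow_ofNat] at h1
  refine (le_of_eq (Finset.sum_congr rfl fun k _ => ?_)).trans h1
  rw [h k, norm_mul, Complex.norm_real, mul_pow, Real.norm_eq_abs, sq_abs,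
    Real.sq_sqrt (pow_nonneg (wt_pos k).le s)]

lemma WtBound.mono_right {n : ℕ} {M M' : ℝ} {c : (Fin 2 → ℤ) → ℂ} (h : WtBound n M c)
    (hM : M ≤ M') : WtBound n M' c := fun S => (h S).trans hM

/-- The identification of coefficients holds almost everywhere and extends to every time because
both sides are continuous in time, coordinate by coordinate. -/
lemma MemHTimeHSpace.exists_jet {k s : ℕ} {a T : ℝ} {ue : ℝ → C(Torus, ℝ)}
    (h : MemHTimeHSpace k s a T ue) (hk : 0 < k) (haT : a < T) (hc : ContinuousOn ue (Icc a T)) :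
    ∃ V : ℕ → ℝ → SeqSpace, IsTimeJet k a T V ∧
      ∀ t ∈ Icc a T, ∀ q, V 0 t q = (√(wt q ^ s) : ℂ) * fCoeff (ue t) q := by
  obtain ⟨v, hv, hv'⟩ := h
  obtain ⟨V, hV, hV0⟩ := hv'.exists_jet hk haT
  refine ⟨V, hV, fun t ht q => ?_⟩
  refine eqOn_Icc_of_ae_Ioo haT ?_ ((SeqSpace.continuous_coord q).comp_continuousOn (hV.cont 0 hk))
    (continuousOn_const.mul ((fCoeffL q).continuous.comp_continuousOn hc)) ht
  filter_upwards [hv, hV0] with t h1 h2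
  exact (congrArg (fun y : SeqSpace => y q) h2).trans (h1 q)

/-- An essential bound becomes a bound at every time: each finite weighted sum is continuous in
time. -/
lemma MemLInfHSpace.exists_wtBound {s : ℕ} {a T : ℝ} {ue : ℝ → C(Torus, ℝ)}
    (h : MemLInfHSpace s a T ue) (haT : a < T) (hc : ContinuousOn ue (Icc a T)) :
    ∃ M, 0 ≤ M ∧ ∀ t ∈ Icc a T, WtBound s M (fCoeff (ue t)) := by
  obtain ⟨v, hv, hv'⟩ := h
  set B := (eLpNormEssSup v (volume.restrict (Ioo a T))).toReal with hB
  have hfin : eLpNormEssSup v (volume.restrict (Ioo a T)) ≠ ⊤ := by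
    have := hv'.2
    rw [eLpNorm_exponent_top] at this
    exact this.ne
  have hb : ∀ᵐ t ∂(volume.restrict (Ioo a T)), ‖v t‖ ≤ B := by
    filter_upwards [enorm_ae_le_eLpNormEssSup v (volume.restrict (Ioo a T))] with t ht
    rw [← toReal_enorm]
    exact ENNReal.toReal_mono hfin ht
  refine ⟨B ^ 2, sq_nonneg _, fun t ht S => ?_⟩
  have hcont : ContinuousOn (fun t => ∑ k ∈ S, wt k ^ s * ‖fCoeff (ue t) k‖ ^ 2) (Icc a T) :=
    continuousOn_finsetSum _ fun k _ => continuousOn_const.mul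
      (((fCoeffL k).continuous.comp_continuousOn hc).norm.pow 2)
  -- The inequality is encoded as the equation `max (sum) B² = B²` between continuous functions, so
  -- that equality almost everywhere suffices.
  have heq := eqOn_Icc_of_ae_Ioo haT (f := fun t => max (∑ k ∈ S, wt k ^ s * ‖fCoeff (ue t) k‖ ^ 2)
    (B ^ 2)) (g := fun _ => B ^ 2) (by
      filter_upwards [hv, hb] with t h1 h2
      refine max_eq_right (((wtBound_of_seq h1) S).trans ?_)
      exact pow_le_pow_left₀ (norm_nonneg _) h2 2) (hcont.sup continuousOn_const) continuousOn_const ht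
  exact max_eq_right_iff.1 heq

/-- The bounds on the exact solution `u` with time derivative `w` that the consistency analysis
uses: in space uniformly in time, and in time with the integrable weight `β`. -/
structure ExactBounds (ε a T : ℝ) (m : ℕ) (u w : ℝ → C(Torus, ℝ)) (M : ℝ) (β : ℝ → ℝ) : Prop where
  nonneg : 0 ≤ M
  weight_nonneg : ∀ t, 0 ≤ β t
  weight_integrable : IntegrableOn β (Icc a T)
  space : ∀ t ∈ Icc a T, WtBound (m + 4) M (fCoeff (u t))
  mode : ∀ t ∈ Icc a T, ∀ k, fCoeff (w t) k + ε ^ 2 * (symL k * (symL k * fCoeff (u t) k))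
      + ∑ i, symD i k * fCoeff (fluxC (gradC (fCoeff (u t))) i) k = 0
  bdf : ∀ t d, 0 ≤ d → a ≤ t - 3 * d → t ≤ T →
    ‖(11 / 6 : ℝ) • u t - (3 : ℝ) • u (t - d) + (3 / 2 : ℝ) • u (t - 2 * d)
        - (1 / 3 : ℝ) • u (t - 3 * d) - d • w t‖ ^ 2 ≤ 54675 * d ^ 7 * ∫ τ in (t - 3 * d)..t, β τ
  third : ∀ t d, 0 ≤ d → a ≤ t - 3 * d → t ≤ T →
    WtBound 2 (3888 * d ^ 5 * ∫ τ in (t - 3 * d)..t, β τ) fun k => fCoeff (u t) k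
      - 3 * fCoeff (u (t - d)) k + 3 * fCoeff (u (t - 2 * d)) k - fCoeff (u (t - 3 * d)) k
  second : ∀ t d, 0 ≤ d → a ≤ t - 2 * d → t ≤ T → WtBound 2 ((8 * d ^ 2 * M) ^ 2) fun k =>
    fCoeff (u t) k - 2 * fCoeff (u (t - d)) k + fCoeff (u (t - 2 * d)) k
  first : ∀ s t, a ≤ s → s ≤ t → t ≤ T → WtBound 2 ((M * (t - s)) ^ 2) fun k =>
    fCoeff (u t) k - fCoeff (u s) k
  first' : ∀ s t, a ≤ s → s ≤ t → t ≤ T → WtBound 4 ((t - s) * ∫ τ in s..t, β τ) fun k =>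
    fCoeff (u t) k - fCoeff (u s) k

/-- Three time jets of one function are used: `V` in C⁰ for the BDF error, `W` in H⁴ for first
differences, `Y` in H^{m+2} for differences up to third order. The weight `β` collects the squares
of their top derivatives, and the L^∞ bound supplies the spatial regularity. -/
lemma RegularityClass.exists_exactBounds {ε a T : ℝ} {m : ℕ} {u : ℝ → C(Torus, ℝ)}
    (hreg : RegularityClass m a T u) (hsol : SolvesNSS ε a T u) (haT : a < T) :
    ∃ w M β, ExactBounds ε a T m u w M β := by
  have hc := hreg.continuousOn
  obtain ⟨M₀, hM₀, hwt⟩ := hreg.linf_hm4.exists_wtBound haT hc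
  obtain ⟨V, hV, hV0⟩ := hreg.h4_c0.exists_jet (by norm_num) haT
  obtain ⟨W, hW, hW0⟩ := hreg.h1_h4.exists_jet (by norm_num) haT hc
  obtain ⟨Y, hY, hY0⟩ := hreg.h3_hm2.exists_jet (by norm_num) haT hc
  have hVu : EqOn (V 0) u (Icc a T) := eqOn_Icc_of_ae_Ioo haT hV0 (hV.cont 0 (by norm_num)) hc
  obtain ⟨M₁, hM₁, hY1⟩ := hY.exists_bound (j := 1) (by norm_num)
  obtain ⟨M₂, hM₂, hY2⟩ := hY.exists_bound (j := 2) (by norm_num)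
  set β : ℝ → ℝ := fun t => ‖V 4 t‖ ^ 2 + ‖W 1 t‖ ^ 2 + ‖Y 3 t‖ ^ 2 with hβ
  have iV : IntegrableOn (fun t => ‖V 4 t‖ ^ 2) (Icc a T) := (integrableOn_Icc_iff_integrableOn_Ioo).2
    ((hV.memLp 4 le_rfl).integrable_norm_pow (by norm_num))
  have iW : IntegrableOn (fun t => ‖W 1 t‖ ^ 2) (Icc a T) := (integrableOn_Icc_iff_integrableOn_Ioo).2
    ((hW.memLp 1 le_rfl).integrable_norm_pow (by norm_num))
  have iY : IntegrableOn (fun t => ‖Y 3 t‖ ^ 2) (Icc a T) := (integrableOn_Icc_iff_integrableOn_Ioo).2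
    ((hY.memLp 3 le_rfl).integrable_norm_pow (by norm_num))
  have iβ : IntegrableOn β (Icc a T) := (iV.add iW).add iY
  have hle : ∀ g : ℝ → ℝ, IntegrableOn g (Icc a T) → (∀ t, g t ≤ β t) → ∀ s t, a ≤ s → s ≤ t → t ≤ T →
      ∫ τ in s..t, g τ ≤ ∫ τ in s..t, β τ := by
    intro g hg hgβ s t hs hst ht
    have hsub : uIcc s t ⊆ Icc a T := by
      rw [uIcc_of_le hst]; exact Icc_subset_Icc hs ht
    exact intervalIntegral.integral_mono_on hst (hg.mono_set hsub).intervalIntegrable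
      (iβ.mono_set hsub).intervalIntegrable fun x _ => hgβ x
  have cmode : ∀ k, ContinuousOn (fun t => fCoeff (u t) k) (Icc a T) := fun k =>
    (fCoeffL k).continuous.comp_continuousOn hc
  have hsq : ∀ {x y J I d : ℝ}, 0 ≤ x → x ≤ y * J → J ^ 2 ≤ d * I → x ^ 2 ≤ y ^ 2 * (d * I) := by
    intro x y J I d hx h1 h2
    calc x ^ 2 ≤ (y * J) ^ 2 := pow_le_pow_left₀ hx h1 2
      _ = y ^ 2 * J ^ 2 := by ring
      _ ≤ _ := mul_le_mul_of_nonneg_left h2 (sq_nonneg _)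
  refine ⟨V 1, M₀ + M₁ + M₂, β, by positivity, fun t => by positivity, iβ, fun t ht =>
    (hwt t ht).mono_right (by linarith), ?_, ?_, ?_, ?_, ?_, ?_⟩
  · have hder : ∀ t ∈ Ioo a T, HasDerivAt u (V 1 t) t := by
      intro t ht
      have hcon := hV.cont 1 (by norm_num)
      have hint : IntervalIntegrable (V 1) volume a t :=
        intervalIntegrable_of_memLp (hV.memLp 1 (by norm_num)) a t ⟨le_rfl, haT.le⟩
          ⟨ht.1.le, ht.2.le⟩
      have h1 := intervalIntegral.integral_hasDerivAt_right hint
        (hcon.mono Ioo_subset_Icc_self |>.stronglyMeasurableAtFilter isOpen_Ioo t ht)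
        (hcon.continuousAt (Icc_mem_nhds ht.1 ht.2))
      refine (h1.const_add (V 0 a)).congr_of_eventuallyEq ?_
      filter_upwards [Ioo_mem_nhds ht.1 ht.2] with x hx
      rw [← hVu (Ioo_subset_Icc_self hx)]
      exact hV.ftc 0 (by norm_num) a ⟨le_rfl, haT.le⟩ x (Ioo_subset_Icc_self hx)
    intro t ht k
    -- The equation is known only in the open interval; continuity of all its terms carries it to
    -- the endpoints.
    refine eqOn_Icc_of_ae_Ioo haT (f := fun t => fCoeff (V 1 t) k
      + ε ^ 2 * (symL k * (symL k * fCoeff (u t) k))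
      + ∑ i, symD i k * fCoeff (fluxC (gradC (fCoeff (u t))) i) k) (g := fun _ => 0) ?_ ?_
      continuousOn_const ht
    · filter_upwards [ae_restrict_mem measurableSet_Ioo] with t ht
      exact mode_equation hsol ht (hder t ht) (hwt t (Ioo_subset_Icc_self ht)) k
    · refine (((fCoeffL k).continuous.comp_continuousOn (hV.cont 1 (by norm_num))).add
        (continuousOn_const.mul (continuousOn_const.mul (continuousOn_const.mul (cmode k))))).add
        (continuousOn_finsetSum _ fun i _ => continuousOn_const.mul
          ((fCoeffL k).continuous.comp_continuousOn ?_))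
      exact continuousOn_fluxC (fun l => continuousOn_gradC hwt cmode l) i
  · intro t d hd hs ht
    have h := hV.bdf_error hd hs ht
    rw [hVu ⟨by linarith, ht⟩, hVu ⟨by linarith, by linarith⟩, hVu ⟨by linarith, by linarith⟩,
      hVu ⟨hs, by linarith⟩] at h
    have h2 := hV.sq_integral_norm_le (j := 4) le_rfl hs (by linarith : t - 3 * d ≤ t) ht
    refine (hsq (norm_nonneg _) h h2).trans ?_
    have h3 := hle _ iV (fun t => by simp only [hβ]; nlinarith [sq_nonneg ‖W 1 t‖, sq_nonneg ‖Y 3 t‖])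
      _ _ hs (by linarith : t - 3 * d ≤ t) ht
    -- The constant is `135² · 3`: the square of the Taylor constant times the factor of the stencil
    -- length `3d` from Cauchy–Schwarz. Likewise `3888 = 36² · 3` below.
    calc _ = 54675 * d ^ 7 * ∫ τ in (t - 3 * d)..t, ‖V 4 τ‖ ^ 2 := by ring
      _ ≤ _ := mul_le_mul_of_nonneg_left h3 (by positivity)
  · intro t d hd hs ht
    have h := hY.third_difference hd hs ht
    have h2 := hY.sq_integral_norm_le (j := 3) le_rfl hs (by linarith : t - 3 * d ≤ t) ht
    have h3 := hle _ iY (fun t => by simp only [hβ]; nlinarith [sq_nonneg ‖W 1 t‖, sq_nonneg ‖V 4 t‖])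
      _ _ hs (by linarith : t - 3 * d ≤ t) ht
    refine ((wtBound_of_seq (s := m + 2) (y := Y 0 t - (3 : ℝ) • Y 0 (t - d)
      + (3 : ℝ) • Y 0 (t - 2 * d) - Y 0 (t - 3 * d)) fun k => ?_).mono_right
      ((hsq (norm_nonneg _) h h2).trans ?_)).mono (by omega)
    · simp only [lp.coeFn_sub, lp.coeFn_add, lp.coeFn_smul, Pi.sub_apply, Pi.add_apply,
        Pi.smul_apply, Complex.real_smul, Complex.ofReal_ofNat]
      rw [hY0 t ⟨by linarith, ht⟩, hY0 _ ⟨by linarith, by linarith⟩,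
        hY0 _ ⟨by linarith, by linarith⟩, hY0 _ ⟨hs, by linarith⟩]
      ring
    · calc _ = 3888 * d ^ 5 * ∫ τ in (t - 3 * d)..t, ‖Y 3 τ‖ ^ 2 := by ring
        _ ≤ _ := mul_le_mul_of_nonneg_left h3 (by positivity)
  · intro t d hd hs ht
    have h := hY.second_difference (M := M₀ + M₁ + M₂)
      (fun t ht => (hY2 t ht).trans (by linarith)) hd hs ht
    refine ((wtBound_of_seq (s := m + 2) (y := Y 0 t - (2 : ℝ) • Y 0 (t - d)
      + Y 0 (t - 2 * d)) fun k => ?_).mono_right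
      (pow_le_pow_left₀ (norm_nonneg _) h 2)).mono (by omega)
    simp only [lp.coeFn_sub, lp.coeFn_add, lp.coeFn_smul, Pi.sub_apply, Pi.add_apply,
        Pi.smul_apply, Complex.real_smul, Complex.ofReal_ofNat]
    rw [hY0 t ⟨by linarith, ht⟩, hY0 _ ⟨by linarith, by linarith⟩, hY0 _ ⟨hs, by linarith⟩]
    ring
  · intro s t hs hst ht
    have h := hY.norm_sub_le_mul (j := 0) (by norm_num) (M := M₀ + M₁ + M₂)
      (fun t ht => (hY1 t ht).trans (by linarith)) hs hst ht
    refine ((wtBound_of_seq (s := m + 2) (y := Y 0 t - Y 0 s) fun k => ?_).mono_right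
      (pow_le_pow_left₀ (norm_nonneg _) h 2)).mono (by omega)
    simp only [lp.coeFn_sub, Pi.sub_apply]
    rw [hY0 t ⟨by linarith, ht⟩, hY0 _ ⟨hs, by linarith⟩]
    ring
  · intro s t hs hst ht
    have h := hW.norm_sub_le (j := 0) (by norm_num) hs hst ht
    have h2 := hW.sq_integral_norm_le (j := 1) le_rfl hs hst ht
    have h3 := hle _ iW (fun t => by simp only [hβ]; nlinarith [sq_nonneg ‖Y 3 t‖, sq_nonneg ‖V 4 t‖])
      _ _ hs hst ht
    refine (wtBound_of_seq (s := 4) (y := W 0 t - W 0 s) fun k => ?_).mono_right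
      ((pow_le_pow_left₀ (norm_nonneg _) h 2).trans (h2.trans
        (mul_le_mul_of_nonneg_left h3 (by linarith))))
    simp only [lp.coeFn_sub, Pi.sub_apply]
    rw [hW0 t ⟨by linarith, ht⟩, hW0 _ ⟨hs, by linarith⟩]
    ring

/-! ### Consistency of the scheme -/

/-- The grid values of a trigonometric polynomial. -/
def gridTrig (K : ℕ) (a : (Fin 2 → ℤ) → ℂ) : Grid K → ℝ := fun p => trig K a (gridPoint K p)

lemma gridTrig_apply (K : ℕ) (a : (Fin 2 → ℤ) → ℂ) (p : Grid K) :
    gridTrig K a p = trig K a (gridPoint K p) := rfl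

lemma gridTrig_congr {K : ℕ} {a b : (Fin 2 → ℤ) → ℂ} (h : ∀ k ∈ freq K, a k = b k) :
    gridTrig K a = gridTrig K b := by
  funext p
  simp only [gridTrig, trig]
  rw [Finset.sum_congr rfl fun k hk => by rw [h k hk]]

lemma gridTrig_add (K : ℕ) (a b : (Fin 2 → ℤ) → ℂ) :
    gridTrig K (fun k => a k + b k) = gridTrig K a + gridTrig K b := by
  funext p
  have h := trig_add_smul K 1 a b (gridPoint K p)
  simp only [Complex.ofReal_one, one_mul] at h
  exact h

lemma gridTrig_smul (K : ℕ) (r : ℝ) (a : (Fin 2 → ℤ) → ℂ) :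
    gridTrig K (fun k => r * a k) = r • gridTrig K a := by
  funext p
  have h := trig_add_smul K r (fun _ => 0) a (gridPoint K p)
  simp only [zero_add] at h
  simp only [gridTrig, h, Pi.smul_apply, smul_eq_mul]
  simp [trig]

lemma gridTrig_sum (K : ℕ) {ι : Type*} (A : Finset ι) (a : ι → (Fin 2 → ℤ) → ℂ) :
    gridTrig K (fun k => ∑ i ∈ A, a i k) = ∑ i ∈ A, gridTrig K (a i) := by
  classical
  induction A using Finset.induction_on with
  | empty => funext p; simp [gridTrig, trig]
  | insert i A hi ih => simp only [Finset.sum_insert hi, gridTrig_add, ih]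

/-- The linear map `multiplier`. -/
def multiplierLin {K : ℕ} (σ : (Fin 2 → ℤ) → ℂ) : (Grid K → ℝ) →ₗ[ℝ] (Grid K → ℝ) where
  toFun := multiplier σ
  map_add' f g := by
    have h : ∀ k, dft (f + g) k = dft f k + dft g k := fun k => by
      simp only [dft, Pi.add_apply, Complex.ofReal_add, add_mul, Finset.sum_add_distrib, mul_add]
    have h2 := gridTrig_add K (fun k => σ k * dft f k) fun k => σ k * dft g k
    simp only [multiplier_eq_trig, h, mul_add]
    exact h2
  map_smul' r f := by
    have h : ∀ k, dft (r • f) k = r * dft f k := fun k => by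
      simp only [dft, Pi.smul_apply, smul_eq_mul, Complex.ofReal_mul, mul_assoc, ← Finset.mul_sum]
      ring
    have h2 := gridTrig_smul K r fun k => σ k * dft f k
    simp only [multiplier_eq_trig, h, RingHom.id_apply]
    refine Eq.trans ?_ h2
    refine gridTrig_congr fun k _ => ?_
    ring

lemma dN_eq_lin {K : ℕ} (i : Fin 2) (f : Grid K → ℝ) : dN i f = multiplierLin (symD i) f := rfl

lemma lapN_eq_lin {K : ℕ} (f : Grid K → ℝ) : lapN f = multiplierLin symL f := lapN_eq f

lemma multiplier_gridTrig {K : ℕ} (σ : (Fin 2 → ℤ) → ℂ) {a : (Fin 2 → ℤ) → ℂ} (ha : IsHerm a) :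
    multiplier σ (gridTrig K a) = gridTrig K fun k => σ k * a k :=
  gridTrig_congr fun _ hk => by rw [show dft (gridTrig K a) _ = _ from dft_trig K ha hk]

lemma dN_gridTrig {K : ℕ} (i : Fin 2) {a : (Fin 2 → ℤ) → ℂ} (ha : IsHerm a) :
    dN i (gridTrig K a) = gridTrig K (gradCoeff a i) := multiplier_gridTrig _ ha

lemma lapN_gridTrig {K : ℕ} {a : (Fin 2 → ℤ) → ℂ} (ha : IsHerm a) :
    lapN (gridTrig K a) = gridTrig K fun k => symL k * a k := by
  rw [lapN_eq, multiplier_gridTrig _ ha]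

lemma lapN_lapN_gridTrig {K : ℕ} {a : (Fin 2 → ℤ) → ℂ} (ha : IsHerm a) :
    lapN (lapN (gridTrig K a)) = gridTrig K fun k => symL k * (symL k * a k) := by
  rw [lapN_gridTrig ha, lapN_gridTrig (IsHerm.mul symL_neg ha)]

lemma divN_eq {K : ℕ} (F : Fin 2 → Grid K → ℝ) : divN F = ∑ i, dN i (F i) := by
  funext p
  simp only [divN, Finset.sum_apply]

lemma divN_sub {K : ℕ} (F G : Fin 2 → Grid K → ℝ) : divN (fun i => F i - G i) = divN F - divN G := by
  simp only [divN_eq, dN_eq_lin, map_sub, Finset.sum_sub_distrib]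

lemma divN_gridTrig {K : ℕ} {a : Fin 2 → (Fin 2 → ℤ) → ℂ} (ha : ∀ i, IsHerm (a i)) :
    divN (fun i => gridTrig K (a i)) = gridTrig K fun k => ∑ i, symD i k * a i k := by
  rw [divN_eq, gridTrig_sum]
  exact Finset.sum_congr rfl fun i _ => dN_gridTrig i (ha i)

/-- The linear part of the scheme. -/
def bdfLin {K : ℕ} (ε A d : ℝ) (x₃ x₂ x₁ x₀ : Grid K → ℝ) : Grid K → ℝ :=
  d⁻¹ • ((11 / 6 : ℝ) • x₃ - (3 : ℝ) • x₂ + (3 / 2 : ℝ) • x₁ - (1 / 3 : ℝ) • x₀)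
    + ε ^ 2 • lapN (lapN x₃) + (A * d ^ 2) • lapN (lapN (x₃ - x₂))

/-- The extrapolated flux. -/
def fluxExt {K : ℕ} (x₂ x₁ x₀ : Grid K → ℝ) (i : Fin 2) : Grid K → ℝ :=
  3 * fluxN x₂ i - 3 * fluxN x₁ i + fluxN x₀ i

lemma BDF3Step.eq_zero {ε A dt : ℝ} {K : ℕ} {u : ℤ → Grid K → ℝ} {n : ℤ} (h : BDF3Step ε A dt u n) :
    bdfLin ε A dt (u (n + 1)) (u n) (u (n - 1)) (u (n - 2))
      + divN (fluxExt (u n) (u (n - 1)) (u (n - 2))) = 0 := by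
  funext p
  have e : divN (fluxExt (u n) (u (n - 1)) (u (n - 2))) p = divN (fun i =>
    3 * fluxN (u n) i - 3 * fluxN (u (n - 1)) i + fluxN (u (n - 2)) i) p := rfl
  rw [Pi.zero_apply, ← h p, ← e]
  simp only [bdfLin, Pi.add_apply, Pi.sub_apply, Pi.smul_apply, smul_eq_mul]
  ring

lemma fluxN_gridTrig {K : ℕ} {a : (Fin 2 → ℤ) → ℂ} (ha : IsHerm a) (i : Fin 2) (p : Grid K) :
    fluxN (gridTrig K a) i p = flux i fun l => trig K (gradCoeff a l) (gridPoint K p) := by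
  rw [fluxN_eq]
  simp only [dN_gridTrig _ ha, gridTrig_apply]

lemma intervalIntegral_nonneg_mono {β : ℝ → ℝ} (h0 : ∀ t, 0 ≤ β t) {a T s' s t t' : ℝ}
    (hi : IntegrableOn β (Icc a T)) (h1 : a ≤ s') (h2 : s' ≤ s) (h3 : s ≤ t) (h4 : t ≤ t')
    (h5 : t' ≤ T) : ∫ τ in s..t, β τ ≤ ∫ τ in s'..t', β τ := by
  refine intervalIntegral.integral_mono_interval h2 h3 h4 (Filter.Eventually.of_forall h0) ?_
  refine (hi.mono_set ?_).intervalIntegrable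
  rw [uIcc_of_le (h2.trans (h3.trans h4))]
  exact Icc_subset_Icc h1 h5

lemma sq_add_three_le {x y z a b c : ℝ} (h1 : x ^ 2 ≤ a) (h2 : y ^ 2 ≤ b)
    (h3 : z ^ 2 ≤ c) : (x + y + z) ^ 2 ≤ 3 * (a + b + c) := by
  nlinarith [sq_nonneg (x - y), sq_nonneg (y - z), sq_nonneg (x - z)]

/-- The interpolated term has square `64 M³ d⁵ √(dI)`; the estimate `√(dI) ≤ d + I` splits it into
`d⁶` and `d⁵ I`, both of which survive summation over the time levels. -/
lemma third_difference_terms_sq_le {M d I : ℝ} (hM : 0 ≤ M) (hd : 0 ≤ d) (hI : 0 ≤ I) :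
    (√(3888 * d ^ 5 * I) + √(M * d * √(d * I)) * (8 * d ^ 2 * M) + M * d * √(d * I) * (M * d)) ^ 2
      ≤ 3 * (3888 + 64 * M ^ 3 + M ^ 4) * (d ^ 6 + d ^ 5 * I) := by
  have hs : √(d * I) ^ 2 = d * I := Real.sq_sqrt (by positivity)
  have hs0 : 0 ≤ √(d * I) := Real.sqrt_nonneg _
  have hs1 : √(d * I) ≤ d + I := Real.sqrt_le_iff.2 ⟨by linarith, by nlinarith [mul_nonneg hd hI, sq_nonneg d, sq_nonneg I]⟩
  have h6 : 0 ≤ d ^ 6 := by positivity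
  have h5 : 0 ≤ d ^ 5 * I := by positivity
  have h65 : d ^ 5 * (d + I) = d ^ 6 + d ^ 5 * I := by ring
  refine (sq_add_three_le
    (a := 3888 * (d ^ 6 + d ^ 5 * I)) (b := 64 * M ^ 3 * (d ^ 6 + d ^ 5 * I))
    (c := M ^ 4 * (d ^ 6 + d ^ 5 * I)) ?_ ?_ ?_).trans (le_of_eq (by ring))
  · rw [Real.sq_sqrt (by positivity)]; nlinarith
  · rw [mul_pow, Real.sq_sqrt (by positivity), ← h65]
    calc _ = 64 * M ^ 3 * (d ^ 5 * √(d * I)) := by ring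
      _ ≤ _ := by gcongr
  · calc _ = M ^ 4 * (d ^ 4 * √(d * I) ^ 2) := by ring
      _ = M ^ 4 * (d ^ 5 * I) := by rw [hs]; ring
      _ ≤ _ := by gcongr; linarith

lemma norm2_lapN_lapN_sq_le {K : ℕ} {b : (Fin 2 → ℤ) → ℂ} (hb : IsHerm b) {B : ℝ} (h : WtBound 4 B b) :
    norm2 (lapN (lapN (gridTrig K b))) ^ 2 ≤ (4 * Real.pi ^ 2) ^ 4 * B := by
  have hh : IsHerm fun k => symL k * (symL k * b k) := IsHerm.mul symL_neg (IsHerm.mul symL_neg hb)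
  rw [lapN_lapN_gridTrig hb]
  refine (le_of_eq (norm2_sq_trig K hh)).trans ?_
  calc _ ≤ ∑ k ∈ freq K, (4 * Real.pi ^ 2) ^ 4 * (wt k ^ 4 * ‖b k‖ ^ 2) := by
        refine Finset.sum_le_sum fun k _ => ?_
        rw [norm_mul, norm_mul, norm_symL]
        have h1 := one_le_wt k
        have h2 : (wt k - 1) ^ 4 ≤ wt k ^ 4 := pow_le_pow_left₀ (by linarith) (by linarith) 4
        calc _ = (4 * Real.pi ^ 2) ^ 4 * ((wt k - 1) ^ 4 * ‖b k‖ ^ 2) := by ring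
          _ ≤ _ := by gcongr
    _ ≤ _ := by
        rw [← Finset.mul_sum]
        exact mul_le_mul_of_nonneg_left (h _) (by positivity)

/-- The difference between the extrapolated discrete flux and the projected exact flux. -/
lemma ExactBounds.exists_flux_consistency {ε a T M : ℝ} {m : ℕ} {u w : ℝ → C(Torus, ℝ)} {β : ℝ → ℝ}
    (hE : ExactBounds ε a T m u w M β) :
    ∃ C, 0 ≤ C ∧ ∀ (K : ℕ) (t d : ℝ), 0 < d → a ≤ t - 3 * d → t ≤ T → ∀ i : Fin 2,
      norm2 (fluxExt (gridTrig K (fCoeff (u (t - d)))) (gridTrig K (fCoeff (u (t - 2 * d))))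
          (gridTrig K (fCoeff (u (t - 3 * d)))) i
        - gridTrig K (fCoeff (fluxC (gradC (fCoeff (u t))) i))) ^ 2
      ≤ C * (meshSize K ^ (2 * m) + d ^ 6 + d ^ 5 * ∫ τ in (t - 3 * d)..t, β τ) := by
  have hM := hE.nonneg
  obtain ⟨C₁, hC₁, H₁⟩ := exists_third_difference_bound M
  obtain ⟨C₂, hC₂, H₂⟩ := exists_alias_bound m M
  set C₃ := 6 * √(16 * 4 ^ (m + 1) * (4 * Real.pi ^ 2 * M)) with hC₃
  have hC₃0 : 0 ≤ C₃ := by positivity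
  refine ⟨3 * (C₁ ^ 2 * (3 * (3888 + 64 * M ^ 3 + M ^ 4)) + C₂ ^ 2 + C₃ ^ 2), by positivity, ?_⟩
  intro K t d hd hs ht i
  set I := ∫ τ in (t - 3 * d)..t, β τ with hI
  have hI0 : 0 ≤ I := intervalIntegral.integral_nonneg (by linarith) fun _ _ => hE.weight_nonneg _
  -- The stencil times are numbered forward, `tm 3 = t` being the new level.
  set tm : ℕ → ℝ := fun j => t - (3 - (j : ℝ)) * d with htm
  have tm3 : tm 3 = t := by simp [htm]
  have tm2 : tm 2 = t - d := by simp only [htm]; push_cast; ring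
  have tm1 : tm 1 = t - 2 * d := by simp only [htm]; push_cast; ring
  have tm0 : tm 0 = t - 3 * d := by simp only [htm]; push_cast; ring
  have tmlo : ∀ j, a ≤ tm j := fun j => by
    have : (0 : ℝ) ≤ j * d := by positivity
    simp only [htm]; linarith
  have tmhi : ∀ j ≤ 3, tm j ≤ t := fun j hj => by
    have : (j : ℝ) ≤ 3 := by exact_mod_cast hj
    simp only [htm]; nlinarith
  have tmlo' : ∀ j, t - 3 * d ≤ tm j := fun j => by
    have : (0 : ℝ) ≤ j * d := by positivity
    simp only [htm]; linarith
  have tmsub : ∀ j, tm (j + 1) - tm j = d := fun j => by simp only [htm]; push_cast; ring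
  have third := H₁ K (fun j => fCoeff (u (tm j))) (fun j => fCoeff_isHerm _)
    (fun j hj => (hE.space (tm j) ⟨tmlo j, (tmhi j hj).trans ht⟩).mono (by omega))
    (M * d) (√(d * I)) (8 * d ^ 2 * M) (√(3888 * d ^ 5 * I)) (by positivity) (Real.sqrt_nonneg _)
    (by positivity) (Real.sqrt_nonneg _)
    (fun j hj => by
      have h := hE.first (tm j) (tm (j + 1)) (tmlo j) (by linarith [tmsub j])
        ((tmhi _ (by omega)).trans ht)
      rwa [tmsub j] at h)
    (fun j hj => by
      have h := hE.first' (tm j) (tm (j + 1)) (tmlo j) (by linarith [tmsub j])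
        ((tmhi _ (by omega)).trans ht)
      rw [tmsub j] at h
      rw [Real.sq_sqrt (by positivity)]
      exact h.mono_right (mul_le_mul_of_nonneg_left (intervalIntegral_nonneg_mono hE.weight_nonneg
        hE.weight_integrable hs (tmlo' j) (by linarith [tmsub j]) (tmhi _ (by omega)) ht) hd.le))
    (fun j hj => by
      have e1 : tm (j + 2) - d = tm (j + 1) := by simp only [htm]; push_cast; ring
      have e2 : tm (j + 2) - 2 * d = tm j := by simp only [htm]; push_cast; ring
      have h := hE.second (tm (j + 2)) d hd.le (by rw [e2]; exact tmlo j)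
        ((tmhi _ (by omega)).trans ht)
      rwa [e1, e2] at h)
    (by
      rw [Real.sq_sqrt (by positivity)]
      have h := hE.third t d hd.le hs ht
      simpa only [tm0, tm1, tm2, tm3] using h) i
  simp only [tm0, tm1, tm2, tm3] at third
  have hwt := hE.space t ⟨by linarith, ht⟩
  set c := fCoeff (u t) with hc
  have h2 := H₂ K c hwt i
  have h3 : norm2 (gridTrig K (fCoeff (fluxC (fun l => trigC K (gradCoeff c l)) i
      - fluxC (gradC c) i))) ≤ C₃ * meshSize K ^ m := by
    refine (norm2_trig_fCoeff_le K _).trans ((norm_fluxC_sub_le _ _ i).trans ?_)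
    have h := fun l => hwt.norm_grad_sub_le K l
    simp only [norm_sub_rev (seriesC _)] at h
    rw [Fin.sum_univ_two]
    have h0 := h 0
    have h1 := h 1
    simp only [gradC, hC₃]
    linarith
  set F := fluxC (fun l => trigC K (gradCoeff c l)) i with hF
  set G := fluxC (gradC c) i with hG
  have hFG : gridTrig K (fCoeff (F - G)) = gridTrig K (fCoeff F) - gridTrig K (fCoeff G) := by
    have e : fCoeff (F - G) = fun k => fCoeff F k + (-1 : ℝ) * fCoeff G k := by
      funext k
      have := map_sub (fCoeffL k) F G
      simp only [fCoeffL_apply] at this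
      rw [this]; push_cast; ring
    rw [e, gridTrig_add, gridTrig_smul]
    module
  set X : Grid K → ℝ := fun p => flux i (fun l => trig K (gradCoeff c l) (gridPoint K p))
    - 3 * flux i (fun l => trig K (gradCoeff (fCoeff (u (t - d))) l) (gridPoint K p))
    + 3 * flux i (fun l => trig K (gradCoeff (fCoeff (u (t - 2 * d))) l) (gridPoint K p))
    - flux i (fun l => trig K (gradCoeff (fCoeff (u (t - 3 * d))) l) (gridPoint K p)) with hX
  set Y : Grid K → ℝ := fun p => F (gridPoint K p) - trig K (fCoeff F) (gridPoint K p) with hY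
  -- Three errors: `-X` from extrapolation in time, `Y` from aliasing, and the projection of `F - G`
  -- from truncating the gradient inside the flux.
  have hdecomp : fluxExt (gridTrig K (fCoeff (u (t - d)))) (gridTrig K (fCoeff (u (t - 2 * d))))
      (gridTrig K (fCoeff (u (t - 3 * d)))) i - gridTrig K (fCoeff G)
      = -X + Y + gridTrig K (fCoeff (F - G)) := by
    rw [hFG]
    funext p
    simp only [fluxExt, hX, hY, Pi.add_apply, Pi.sub_apply, Pi.mul_apply, Pi.neg_apply,
      fluxN_gridTrig (fCoeff_isHerm _), gridTrig_apply, Pi.ofNat_apply, hF, fluxC_apply, trigC_apply]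
    ring
  rw [hdecomp]
  have hn : norm2 (-X + Y + gridTrig K (fCoeff (F - G)))
      ≤ norm2 X + norm2 Y + norm2 (gridTrig K (fCoeff (F - G))) := by
    refine (norm2_add_le _ _).trans ?_
    have := norm2_add_le (-X) Y
    rw [norm2_neg] at this
    linarith
  have hmesh : (meshSize K ^ m) ^ 2 = meshSize K ^ (2 * m) := by rw [← pow_mul, mul_comm]
  have hmesh0 := (meshSize_pos K).le
  have hx : norm2 X ^ 2 ≤ C₁ ^ 2 * (3 * (3888 + 64 * M ^ 3 + M ^ 4)) * (d ^ 6 + d ^ 5 * I) := by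
    refine (pow_le_pow_left₀ (norm2_nonneg _) third 2).trans ?_
    rw [mul_pow, mul_assoc (C₁ ^ 2)]
    exact mul_le_mul_of_nonneg_left (third_difference_terms_sq_le hM hd.le hI0) (sq_nonneg _)
  have hy : norm2 Y ^ 2 ≤ C₂ ^ 2 * meshSize K ^ (2 * m) := by
    refine (pow_le_pow_left₀ (norm2_nonneg _) h2 2).trans (le_of_eq ?_)
    rw [mul_pow, hmesh]
  have hz : norm2 (gridTrig K (fCoeff (F - G))) ^ 2 ≤ C₃ ^ 2 * meshSize K ^ (2 * m) := by
    refine (pow_le_pow_left₀ (norm2_nonneg _) h3 2).trans (le_of_eq ?_)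
    rw [mul_pow, hmesh]
  refine (pow_le_pow_left₀ (norm2_nonneg _) hn 2).trans ((sq_add_three_le hx hy hz).trans ?_)
  set P := C₁ ^ 2 * (3 * (3888 + 64 * M ^ 3 + M ^ 4)) with hP
  have hP0 : 0 ≤ P := by positivity
  have q1 : 0 ≤ meshSize K ^ (2 * m) := by positivity
  have q2 : 0 ≤ d ^ 6 + d ^ 5 * I := by positivity
  nlinarith [mul_nonneg hP0 q1, mul_nonneg (sq_nonneg C₂) q2, mul_nonneg (sq_nonneg C₃) q2]

/-- The mode equation at time `t` removes the derivative, the biharmonic term and the exact flux.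
What remains outside the divergence is the BDF error and the stabilisation term. -/
theorem ExactBounds.exists_consistency {ε a T M : ℝ} {m : ℕ} {u w : ℝ → C(Torus, ℝ)} {β : ℝ → ℝ}
    (hE : ExactBounds ε a T m u w M β) (A : ℝ) :
    ∃ C, 0 ≤ C ∧ ∀ (K : ℕ) (t d : ℝ), 0 < d → a ≤ t - 3 * d → t ≤ T →
      ∃ (τ : Grid K → ℝ) (ρ : Fin 2 → Grid K → ℝ),
        bdfLin ε A d (gridTrig K (fCoeff (u t))) (gridTrig K (fCoeff (u (t - d))))
            (gridTrig K (fCoeff (u (t - 2 * d)))) (gridTrig K (fCoeff (u (t - 3 * d))))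
          + divN (fluxExt (gridTrig K (fCoeff (u (t - d)))) (gridTrig K (fCoeff (u (t - 2 * d))))
            (gridTrig K (fCoeff (u (t - 3 * d))))) = τ + divN ρ ∧
        norm2 τ ^ 2 + ∑ i, norm2 (ρ i) ^ 2
          ≤ C * (meshSize K ^ (2 * m) + d ^ 6 + d ^ 5 * ∫ τ in (t - 3 * d)..t, β τ) := by
  obtain ⟨C₁, hC₁, H₁⟩ := hE.exists_flux_consistency
  refine ⟨2 * C₁ + 2 * (54675 + A ^ 2 * (4 * Real.pi ^ 2) ^ 4), by positivity, ?_⟩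
  intro K t d hd hs ht
  have h1 := H₁ K t d hd hs ht
  have hbdf := hE.bdf t d hd.le hs ht
  have hfirst := hE.first' (t - d) t (by linarith) (by linarith) ht
  have hmode := hE.mode t ⟨by linarith, ht⟩
  have hImono := intervalIntegral_nonneg_mono hE.weight_nonneg hE.weight_integrable hs
    (by linarith : t - 3 * d ≤ t - d) (by linarith : t - d ≤ t) le_rfl ht
  set I := ∫ τ in (t - 3 * d)..t, β τ with hI
  have hI0 : 0 ≤ I := intervalIntegral.integral_nonneg (by linarith) fun _ _ => hE.weight_nonneg _
  set f : C(Torus, ℝ) := (11 / 6 : ℝ) • u t - (3 : ℝ) • u (t - d) + (3 / 2 : ℝ) • u (t - 2 * d)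
        - (1 / 3 : ℝ) • u (t - 3 * d) - d • w t with hf
  set b : (Fin 2 → ℤ) → ℂ := fun k => fCoeff (u t) k - fCoeff (u (t - d)) k with hb
  have hbH : IsHerm b := fun k => by
    simp only [hb, fCoeff_isHerm _ k, map_sub]
  set ρ : Fin 2 → Grid K → ℝ := fun i =>
    fluxExt (gridTrig K (fCoeff (u (t - d)))) (gridTrig K (fCoeff (u (t - 2 * d))))
      (gridTrig K (fCoeff (u (t - 3 * d)))) i
    - gridTrig K (fCoeff (fluxC (gradC (fCoeff (u t))) i)) with hρ
  -- The stabilisation part is of size `d² √(dI)`, since one time derivative in H⁴ is available; its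
  -- square is again `d⁵ I`.
  set τ : Grid K → ℝ := d⁻¹ • gridTrig K (fCoeff f) + (A * d ^ 2) • lapN (lapN (gridTrig K b)) with hτ
  refine ⟨τ, ρ, ?_, ?_⟩
  · have e1 : divN ρ = divN (fluxExt (gridTrig K (fCoeff (u (t - d))))
        (gridTrig K (fCoeff (u (t - 2 * d)))) (gridTrig K (fCoeff (u (t - 3 * d)))))
        - gridTrig K fun k => ∑ i, symD i k * fCoeff (fluxC (gradC (fCoeff (u t))) i) k := by
      rw [hρ, divN_sub, divN_gridTrig fun i => fCoeff_isHerm _]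
    have e2 : gridTrig K b = gridTrig K (fCoeff (u t)) - gridTrig K (fCoeff (u (t - d))) := by
      have : b = fun k => fCoeff (u t) k + (-1 : ℝ) * fCoeff (u (t - d)) k := by
        funext k; simp only [hb]; push_cast; ring
      rw [this, gridTrig_add, gridTrig_smul]; module
    have e3 : gridTrig K (fCoeff f) = (11 / 6 : ℝ) • gridTrig K (fCoeff (u t))
        - (3 : ℝ) • gridTrig K (fCoeff (u (t - d))) + (3 / 2 : ℝ) • gridTrig K (fCoeff (u (t - 2 * d)))
        - (1 / 3 : ℝ) • gridTrig K (fCoeff (u (t - 3 * d))) - d • gridTrig K (fCoeff (w t)) := by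
      have : fCoeff f = fun k => ((((11 / 6 : ℝ) * fCoeff (u t) k + (-3 : ℝ) * fCoeff (u (t - d)) k)
          + (3 / 2 : ℝ) * fCoeff (u (t - 2 * d)) k) + (-1 / 3 : ℝ) * fCoeff (u (t - 3 * d)) k)
          + (-d : ℝ) * fCoeff (w t) k := by
        funext k
        rw [← fCoeffL_apply, hf]
        simp only [map_sub, map_add, map_smul, Complex.real_smul, fCoeffL_apply]
        push_cast
        ring
      rw [this]
      simp only [gridTrig_add, gridTrig_smul]
      module
    have e4 : gridTrig K (fCoeff (w t)) + ε ^ 2 • lapN (lapN (gridTrig K (fCoeff (u t))))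
        + gridTrig K (fun k => ∑ i, symD i k * fCoeff (fluxC (gradC (fCoeff (u t))) i) k) = 0 := by
      rw [lapN_lapN_gridTrig (fCoeff_isHerm _), ← gridTrig_smul, ← gridTrig_add, ← gridTrig_add]
      have : (fun k => fCoeff (w t) k + ((ε ^ 2 : ℝ) : ℂ) * (symL k * (symL k * fCoeff (u t) k))
        + ∑ i, symD i k * fCoeff (fluxC (gradC (fCoeff (u t))) i) k) = fun _ => 0 := by
        funext k
        rw [← hmode k]
        push_cast
        rfl
      rw [this]
      funext p
      simp [gridTrig, trig]
    have e5 : d⁻¹ • d • gridTrig K (fCoeff (w t)) = gridTrig K (fCoeff (w t)) :=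
      inv_smul_smul₀ hd.ne' _
    rw [e1, hτ, e2, e3, smul_sub d⁻¹ _ (d • _), e5]
    have e6 := eq_neg_of_add_eq_zero_left e4
    rw [add_comm] at e4
    rw [bdfLin, ← sub_eq_zero]
    refine Eq.trans ?_ e4
    module
  · have n1 : norm2 (gridTrig K (fCoeff f)) ^ 2 ≤ 54675 * d ^ 7 * I :=
      (pow_le_pow_left₀ (norm2_nonneg _) (norm2_trig_fCoeff_le K f) 2).trans hbdf
    have n2 : norm2 (lapN (lapN (gridTrig K b))) ^ 2 ≤ (4 * Real.pi ^ 2) ^ 4 * (d * I) := by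
      refine (norm2_lapN_lapN_sq_le hbH hfirst).trans ?_
      rw [sub_sub_cancel]
      gcongr
    have n3 : norm2 τ ^ 2 ≤ 2 * (54675 + A ^ 2 * (4 * Real.pi ^ 2) ^ 4) * (d ^ 5 * I) := by
      have h := norm2_add_le (d⁻¹ • gridTrig K (fCoeff f)) ((A * d ^ 2) • lapN (lapN (gridTrig K b)))
      rw [norm2_smul, norm2_smul] at h
      have g1 : (|d⁻¹| * norm2 (gridTrig K (fCoeff f))) ^ 2 ≤ 54675 * (d ^ 5 * I) := by
        rw [mul_pow, sq_abs]
        calc _ ≤ d⁻¹ ^ 2 * (54675 * d ^ 7 * I) := by gcongr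
          _ = _ := by field_simp
      have g2 : (|A * d ^ 2| * norm2 (lapN (lapN (gridTrig K b)))) ^ 2
          ≤ A ^ 2 * (4 * Real.pi ^ 2) ^ 4 * (d ^ 5 * I) := by
        rw [mul_pow, sq_abs]
        calc _ ≤ (A * d ^ 2) ^ 2 * ((4 * Real.pi ^ 2) ^ 4 * (d * I)) := by gcongr
          _ = _ := by ring
      refine (pow_le_pow_left₀ (norm2_nonneg _) h 2).trans ((add_sq_le).trans ?_)
      linarith
    have n4 : ∑ i, norm2 (ρ i) ^ 2 ≤ 2 * C₁ * (meshSize K ^ (2 * m) + d ^ 6 + d ^ 5 * I) := by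
      rw [Fin.sum_univ_two]
      have a0 := h1 0
      have a1 := h1 1
      simp only [hρ]
      linarith
    have hmesh0 := (meshSize_pos K).le
    have q1 : 0 ≤ meshSize K ^ (2 * m) := by positivity
    have q2 : 0 ≤ d ^ 6 := by positivity
    have q3 : 0 ≤ 2 * (54675 + A ^ 2 * (4 * Real.pi ^ 2) ^ 4) := by positivity
    nlinarith [mul_nonneg q3 q1, mul_nonneg q3 q2]

/-! ### The energy inequality -/

lemma ip_add_left {K : ℕ} (f g z : Grid K → ℝ) : ip (f + g) z = ip f z + ip g z := by
  simp only [ip, Pi.add_apply, add_mul, Finset.sum_add_distrib, mul_add]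

lemma ip_smul_left {K : ℕ} (r : ℝ) (f z : Grid K → ℝ) : ip (r • f) z = r * ip f z := by
  simp only [ip, Pi.smul_apply, smul_eq_mul, mul_assoc, ← Finset.mul_sum]
  ring

lemma ip_sub_left {K : ℕ} (f g z : Grid K → ℝ) : ip (f - g) z = ip f z - ip g z := by
  simp only [ip, Pi.sub_apply, sub_mul, Finset.sum_sub_distrib, mul_sub]

lemma ip_sub_right {K : ℕ} (f g z : Grid K → ℝ) : ip z (f - g) = ip z f - ip z g := by
  rw [ip_comm, ip_sub_left, ip_comm f, ip_comm g]

lemma ip_smul_right {K : ℕ} (r : ℝ) (f z : Grid K → ℝ) : ip z (r • f) = r * ip z f := by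
  rw [ip_comm, ip_smul_left, ip_comm f]

lemma ip_divN {K : ℕ} (W : Fin 2 → Grid K → ℝ) (z : Grid K → ℝ) :
    ip (divN W) z = -∑ i, ip (W i) (dN i z) := by
  rw [divN_eq, Fin.sum_univ_two, Fin.sum_univ_two, ip_add_left, ip_dN, ip_dN]
  ring

lemma abs_ip_le_half {K : ℕ} (f g : Grid K → ℝ) :
    |ip f g| ≤ norm2 f ^ 2 / 2 + norm2 g ^ 2 / 2 :=
  (abs_ip_le f g).trans (by nlinarith [sq_nonneg (norm2 f - norm2 g)])

lemma norm2_sub_sq {K : ℕ} (f g : Grid K → ℝ) :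
    norm2 (f - g) ^ 2 = norm2 f ^ 2 - 2 * ip f g + norm2 g ^ 2 := by
  rw [norm2_sq, norm2_sq, norm2_sq, ip_sub_left, ip_sub_right, ip_sub_right, ip_comm g f]
  ring

lemma norm2_smul_sub_sq_le {K : ℕ} (f g : Grid K → ℝ) :
    norm2 ((2 : ℝ) • f - g) ^ 2 ≤ 8 * norm2 f ^ 2 + 2 * norm2 g ^ 2 := by
  have h := norm2_sub_le ((2 : ℝ) • f) g
  rw [norm2_smul, abs_of_pos two_pos] at h
  refine (pow_le_pow_left₀ (norm2_nonneg _) h 2).trans ?_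
  nlinarith [sq_nonneg (2 * norm2 f - norm2 g)]

/-- The squared norm of the discrete gradient. -/
def gradSq {K : ℕ} (f : Grid K → ℝ) : ℝ := ∑ i, norm2 (dN i f) ^ 2

lemma gradSq_nonneg {K : ℕ} (f : Grid K → ℝ) : 0 ≤ gradSq f := Finset.sum_nonneg fun _ _ => sq_nonneg _

/-- Summation by parts and Young's inequality. The parameter `θ` decides how much is charged to the
dissipation. -/
lemma gradSq_le {K : ℕ} (f : Grid K → ℝ) {θ : ℝ} (hθ : 0 < θ) :
    gradSq f ≤ θ * norm2 (lapN f) ^ 2 + norm2 f ^ 2 / (4 * θ) := by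
  rw [gradSq, sum_norm2_dN]
  refine ((neg_le_abs _).trans (abs_ip_le _ _)).trans ?_
  have h : 0 ≤ (2 * θ * norm2 (lapN f) - norm2 f) ^ 2 / (4 * θ) := by positivity
  have e : (2 * θ * norm2 (lapN f) - norm2 f) ^ 2 / (4 * θ)
      = θ * norm2 (lapN f) ^ 2 + norm2 f ^ 2 / (4 * θ) - norm2 f * norm2 (lapN f) := by
    field_simp
    ring
  linarith

lemma gradSq_smul_sub_le {K : ℕ} (f g : Grid K → ℝ) :
    gradSq ((2 : ℝ) • f - g) ≤ 8 * gradSq f + 2 * gradSq g := by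
  simp only [gradSq, Finset.mul_sum, ← Finset.sum_add_distrib]
  refine Finset.sum_le_sum fun i _ => ?_
  have : dN i ((2 : ℝ) • f - g) = (2 : ℝ) • dN i f - dN i g := by
    simp only [dN_eq_lin, map_sub, map_smul]
  rw [this]
  exact norm2_smul_sub_sq_le _ _

lemma norm2_fluxN_sub_sq_le {K : ℕ} (f g : Grid K → ℝ) (i : Fin 2) :
    norm2 (fluxN f i - fluxN g i) ^ 2 ≤ 18 * gradSq (f - g) := by
  have h1 : norm2 (fluxN f i - fluxN g i) ≤ norm2 ((3 : ℝ) • fun p => ∑ l, |dN l (f - g) p|) := by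
    refine norm2_mono fun p => ?_
    simp only [Pi.sub_apply, fluxN_eq, Pi.smul_apply, smul_eq_mul]
    refine (abs_flux_sub_le i _ _).trans (le_of_eq ?_)
    simp only [dN_eq_lin, map_sub, Pi.sub_apply]
  have h2 := norm2_sum_abs_le (Finset.univ : Finset (Fin 2)) fun l => dN l (f - g)
  rw [norm2_smul, abs_of_pos three_pos] at h1
  rw [Fin.sum_univ_two] at h2
  have h3 : norm2 (fluxN f i - fluxN g i) ≤ 3 * (norm2 (dN 0 (f - g)) + norm2 (dN 1 (f - g))) :=
    h1.trans (mul_le_mul_of_nonneg_left h2 three_pos.le)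
  refine (pow_le_pow_left₀ (norm2_nonneg _) h3 2).trans ?_
  rw [gradSq, Fin.sum_univ_two]
  nlinarith [sq_nonneg (norm2 (dN 0 (f - g)) - norm2 (dN 1 (f - g)))]

lemma norm2_fluxExt_sub_sq_le {K : ℕ} (x₂ x₁ x₀ y₂ y₁ y₀ : Grid K → ℝ) (i : Fin 2) :
    norm2 (fluxExt x₂ x₁ x₀ i - fluxExt y₂ y₁ y₀ i) ^ 2
      ≤ 486 * (gradSq (x₂ - y₂) + gradSq (x₁ - y₁) + gradSq (x₀ - y₀)) := by
  have e : fluxExt x₂ x₁ x₀ i - fluxExt y₂ y₁ y₀ i = (3 : ℝ) • (fluxN x₂ i - fluxN y₂ i)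
      + (-3 : ℝ) • (fluxN x₁ i - fluxN y₁ i) + (fluxN x₀ i - fluxN y₀ i) := by
    funext p
    simp only [fluxExt, Pi.add_apply, Pi.sub_apply, Pi.smul_apply, smul_eq_mul, Pi.mul_apply,
      Pi.ofNat_apply]
    ring
  have h1 := norm2_add_le ((3 : ℝ) • (fluxN x₂ i - fluxN y₂ i) + (-3 : ℝ) • (fluxN x₁ i - fluxN y₁ i))
    (fluxN x₀ i - fluxN y₀ i)
  have h2 := norm2_add_le ((3 : ℝ) • (fluxN x₂ i - fluxN y₂ i)) ((-3 : ℝ) • (fluxN x₁ i - fluxN y₁ i))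
  rw [norm2_smul, norm2_smul, abs_of_pos three_pos, abs_neg, abs_of_pos three_pos] at h2
  have h := h1.trans (add_le_add_left h2 _)
  rw [e]
  have k2 := norm2_fluxN_sub_sq_le x₂ y₂ i
  have k1 := norm2_fluxN_sub_sq_le x₁ y₁ i
  have k0 := norm2_fluxN_sub_sq_le x₀ y₀ i
  refine (pow_le_pow_left₀ (norm2_nonneg _) h 2).trans ((sq_add_three_le
    (a := 162 * gradSq (x₂ - y₂)) (b := 162 * gradSq (x₁ - y₁)) (c := 162 * gradSq (x₀ - y₀))
    (by linarith) (by linarith) ?_).trans (by linarith))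
  linarith [gradSq_nonneg (x₀ - y₀)]

/-- The `G`-norm of the third order BDF method for the multiplier `2 * x₃ - x₂`. -/
def gForm (x y z : ℝ) : ℝ :=
  1 / 2 * x ^ 2 + 5 / 6 * x * (x - y) - 1 / 3 * x * (y - z) + 19 / 12 * (x - y) ^ 2
    - (x - y) * (y - z) + 5 / 6 * (y - z) ^ 2

/-- G-stability: the discrepancy is an explicit sum of three squares of differences. -/
lemma gForm_sub_le (x₃ x₂ x₁ x₀ : ℝ) :
    gForm x₃ x₂ x₁ - gForm x₂ x₁ x₀
      ≤ (11 / 6 * x₃ - 3 * x₂ + 3 / 2 * x₁ - 1 / 3 * x₀) * (2 * x₃ - x₂) := by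
  have h : (11 / 6 * x₃ - 3 * x₂ + 3 / 2 * x₁ - 1 / 3 * x₀) * (2 * x₃ - x₂)
      - (gForm x₃ x₂ x₁ - gForm x₂ x₁ x₀)
      = 5 / 6 * ((x₁ - x₀) - 3 / 5 * (x₂ - x₁) + 2 / 5 * (x₃ - x₂)) ^ 2
        + 9 / 20 * ((x₂ - x₁) - 2 / 3 * (x₃ - x₂)) ^ 2 + 5 / 12 * (x₃ - x₂) ^ 2 := by
    simp only [gForm]; ring
  have h2 : 0 ≤ 5 / 6 * ((x₁ - x₀) - 3 / 5 * (x₂ - x₁) + 2 / 5 * (x₃ - x₂)) ^ 2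
        + 9 / 20 * ((x₂ - x₁) - 2 / 3 * (x₃ - x₂)) ^ 2 + 5 / 12 * (x₃ - x₂) ^ 2 := by positivity
  linarith

/-- Positive definiteness by completing squares; the factor 1/20 leaves a small positive remainder
in `z²`. -/
lemma le_gForm (x y z : ℝ) : (x ^ 2 + y ^ 2 + z ^ 2) / 20 ≤ gForm x y z := by
  have h : gForm x y z - (x ^ 2 + y ^ 2 + z ^ 2) / 20 = 43 / 15 * (x - 40 / 43 * y + 10 / 43 * z) ^ 2
      + 381 / 430 * (y - 920 / 1143 * z) ^ 2 + 3721 / 68580 * z ^ 2 := by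
    simp only [gForm]; ring
  have h2 : 0 ≤ 43 / 15 * (x - 40 / 43 * y + 10 / 43 * z) ^ 2
      + 381 / 430 * (y - 920 / 1143 * z) ^ 2 + 3721 / 68580 * z ^ 2 := by positivity
  linarith

lemma gForm_le (x y z : ℝ) : gForm x y z ≤ 10 * (x ^ 2 + y ^ 2 + z ^ 2) := by
  have h : 10 * (x ^ 2 + y ^ 2 + z ^ 2) - gForm x y z = 85 / 12 * (x + 32 / 85 * y - 8 / 85 * z) ^ 2
      + 1897 / 340 * (y + 1616 / 5691 * z) ^ 2 + 295501 / 34146 * z ^ 2 := by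
    simp only [gForm]; ring
  have h2 : 0 ≤ 85 / 12 * (x + 32 / 85 * y - 8 / 85 * z) ^ 2
      + 1897 / 340 * (y + 1616 / 5691 * z) ^ 2 + 295501 / 34146 * z ^ 2 := by positivity
  linarith

/-- The `G`-norm on grid functions. -/
def gNorm {K : ℕ} (x y z : Grid K → ℝ) : ℝ := meshSize K ^ 2 * ∑ p, gForm (x p) (y p) (z p)

lemma norm2_sq_eq {K : ℕ} (f : Grid K → ℝ) : norm2 f ^ 2 = meshSize K ^ 2 * ∑ p, f p ^ 2 := by
  rw [norm2, Real.sq_sqrt (by positivity)]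

lemma le_gNorm {K : ℕ} (x y z : Grid K → ℝ) :
    norm2 x ^ 2 + norm2 y ^ 2 + norm2 z ^ 2 ≤ 20 * gNorm x y z := by
  have h := mul_le_mul_of_nonneg_left (Finset.sum_le_sum fun p (_ : p ∈ Finset.univ) =>
    le_gForm (x p) (y p) (z p)) (sq_nonneg (meshSize K))
  rw [← Finset.sum_div, Finset.sum_add_distrib, Finset.sum_add_distrib] at h
  simp only [norm2_sq_eq, gNorm]
  linarith

lemma gNorm_le {K : ℕ} (x y z : Grid K → ℝ) :
    gNorm x y z ≤ 10 * (norm2 x ^ 2 + norm2 y ^ 2 + norm2 z ^ 2) := by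
  have h := mul_le_mul_of_nonneg_left (Finset.sum_le_sum fun p (_ : p ∈ Finset.univ) =>
    gForm_le (x p) (y p) (z p)) (sq_nonneg (meshSize K))
  rw [← Finset.mul_sum, Finset.sum_add_distrib, Finset.sum_add_distrib] at h
  simp only [norm2_sq_eq, gNorm]
  linarith

lemma gNorm_sub_le {K : ℕ} (x₃ x₂ x₁ x₀ : Grid K → ℝ) :
    gNorm x₃ x₂ x₁ - gNorm x₂ x₁ x₀
      ≤ ip ((11 / 6 : ℝ) • x₃ - (3 : ℝ) • x₂ + (3 / 2 : ℝ) • x₁ - (1 / 3 : ℝ) • x₀)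
        ((2 : ℝ) • x₃ - x₂) := by
  simp only [gNorm, ip, ← mul_sub, ← Finset.sum_sub_distrib]
  gcongr with p
  exact gForm_sub_le (x₃ p) (x₂ p) (x₁ p) (x₀ p)

/-- The Lyapunov functional of the scheme. -/
def energy {K : ℕ} (ε A d : ℝ) (x₃ x₂ x₁ : Grid K → ℝ) : ℝ :=
  gNorm x₃ x₂ x₁ + d * ε ^ 2 * (11 / 16 * norm2 (lapN x₃) ^ 2 + 1 / 8 * norm2 (lapN x₂) ^ 2
    + 1 / 16 * norm2 (lapN x₁) ^ 2) + A * d ^ 3 / 2 * norm2 (lapN x₃) ^ 2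

lemma le_energy {K : ℕ} {ε A d : ℝ} (hA : 0 ≤ A) (hd : 0 ≤ d) (x₃ x₂ x₁ : Grid K → ℝ) :
    norm2 x₃ ^ 2 + norm2 x₂ ^ 2 + norm2 x₁ ^ 2 ≤ 20 * energy ε A d x₃ x₂ x₁ := by
  have h := le_gNorm x₃ x₂ x₁
  have h1 : 0 ≤ d * ε ^ 2 * (11 / 16 * norm2 (lapN x₃) ^ 2 + 1 / 8 * norm2 (lapN x₂) ^ 2
    + 1 / 16 * norm2 (lapN x₁) ^ 2) := by positivity
  have h2 : 0 ≤ A * d ^ 3 / 2 * norm2 (lapN x₃) ^ 2 := by positivity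
  rw [energy]
  linarith

lemma bdfLin_sub {K : ℕ} (ε A d : ℝ) (x₃ x₂ x₁ x₀ y₃ y₂ y₁ y₀ : Grid K → ℝ) :
    bdfLin ε A d (x₃ - y₃) (x₂ - y₂) (x₁ - y₁) (x₀ - y₀)
      = bdfLin ε A d x₃ x₂ x₁ x₀ - bdfLin ε A d y₃ y₂ y₁ y₀ := by
  simp only [bdfLin, lapN_eq_lin, map_sub]
  module

lemma ip_lapN_lapN {K : ℕ} (f g : Grid K → ℝ) : ip (lapN (lapN f)) g = ip (lapN f) (lapN g) :=
  ip_lapN _ _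

/-- With `q` the inner product of the two Laplacians, `2b₃ - q` and `2b₃ - 3q + b₂` equal `3b₃/2 -
b₂/2` and `(b₃ - b₂)/2` up to positive multiples of `‖Δ_N(x₃ - x₂)‖² = b₃ - 2q + b₂`. -/
lemma gNorm_sub_le_mul_ip_bdfLin {K : ℕ} {ε A d : ℝ} (hA : 0 ≤ A) (hd : 0 < d)
    (x₃ x₂ x₁ x₀ : Grid K → ℝ) :
    gNorm x₃ x₂ x₁ - gNorm x₂ x₁ x₀
      + d * ε ^ 2 * (3 / 2 * norm2 (lapN x₃) ^ 2 - 1 / 2 * norm2 (lapN x₂) ^ 2)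
      + A * d ^ 3 / 2 * (norm2 (lapN x₃) ^ 2 - norm2 (lapN x₂) ^ 2)
      ≤ d * ip (bdfLin ε A d x₃ x₂ x₁ x₀) ((2 : ℝ) • x₃ - x₂) := by
  have hl : lapN ((2 : ℝ) • x₃ - x₂) = (2 : ℝ) • lapN x₃ - lapN x₂ := by
    simp only [lapN_eq_lin, map_sub, map_smul]
  have hl2 : lapN (x₃ - x₂) = lapN x₃ - lapN x₂ := by simp only [lapN_eq_lin, map_sub]
  rw [bdfLin, ip_add_left, ip_add_left, ip_smul_left, ip_smul_left, ip_smul_left, ip_lapN_lapN,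
    ip_lapN_lapN, hl, hl2]
  have h1 := gNorm_sub_le x₃ x₂ x₁ x₀
  have e1 : ip (lapN x₃) ((2 : ℝ) • lapN x₃ - lapN x₂)
      = 2 * norm2 (lapN x₃) ^ 2 - ip (lapN x₃) (lapN x₂) := by
    rw [ip_sub_right, ip_smul_right, norm2_sq]
  have e2 : ip (lapN x₃ - lapN x₂) ((2 : ℝ) • lapN x₃ - lapN x₂)
      = 2 * norm2 (lapN x₃) ^ 2 - 3 * ip (lapN x₃) (lapN x₂) + norm2 (lapN x₂) ^ 2 := by
    rw [ip_sub_left, e1, ip_sub_right, ip_smul_right, ip_comm (lapN x₂) (lapN x₃), norm2_sq (lapN x₂)]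
    ring
  have h2 := norm2_sub_sq (lapN x₃) (lapN x₂)
  have h3 := sq_nonneg (norm2 (lapN x₃ - lapN x₂))
  rw [e1, e2]
  set q := ip (lapN x₃) (lapN x₂)
  set b₃ := norm2 (lapN x₃) ^ 2
  set b₂ := norm2 (lapN x₂) ^ 2
  set B := ip ((11 / 6 : ℝ) • x₃ - (3 : ℝ) • x₂ + (3 / 2 : ℝ) • x₁ - (1 / 3 : ℝ) • x₀)
        ((2 : ℝ) • x₃ - x₂)
  have k1 : 0 ≤ d * ε ^ 2 * (b₃ - 2 * q + b₂) := mul_nonneg (by positivity) (by linarith)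
  have k2 : 0 ≤ A * d ^ 3 * (b₃ - 2 * q + b₂) := mul_nonneg (by positivity) (by linarith)
  have e : d * (d⁻¹ * B + ε ^ 2 * (2 * b₃ - q) + A * d ^ 2 * (2 * b₃ - 3 * q + b₂))
      = B + d * ε ^ 2 * (2 * b₃ - q) + A * d ^ 3 * (2 * b₃ - 3 * q + b₂) := by
    field_simp
  rw [e]
  linarith

/-- The residual is tested against `z = 2x₃ - x₂`, its divergence part and the flux difference being
moved onto the gradient of `z`. All gradients are then split between dissipation and energy. -/
lemma energy_step {K : ℕ} {ε A d r : ℝ} (hε : 0 < ε) (hA : 0 ≤ A) (hd : 0 < d)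
    {U₃ U₂ U₁ U₀ u₃ u₂ u₁ u₀ τ : Grid K → ℝ} {ρ : Fin 2 → Grid K → ℝ}
    (hU : bdfLin ε A d U₃ U₂ U₁ U₀ + divN (fluxExt U₂ U₁ U₀) = τ + divN ρ)
    (hu : bdfLin ε A d u₃ u₂ u₁ u₀ + divN (fluxExt u₂ u₁ u₀) = 0)
    (hr : norm2 τ ^ 2 + ∑ i, norm2 (ρ i) ^ 2 ≤ r) :
    energy ε A d (U₃ - u₃) (U₂ - u₂) (U₁ - u₁) + d * ε ^ 2 / 2 * norm2 (lapN (U₃ - u₃)) ^ 2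
      ≤ energy ε A d (U₂ - u₂) (U₁ - u₁) (U₀ - u₀)
        + d * (r / 2 + 20 * (10 ^ 6 / ε ^ 2 + 4) * (energy ε A d (U₃ - u₃) (U₂ - u₂) (U₁ - u₁)
          + energy ε A d (U₂ - u₂) (U₁ - u₁) (U₀ - u₀))) := by
  set W : Fin 2 → Grid K → ℝ := fun i => fluxExt U₂ U₁ U₀ i - fluxExt u₂ u₁ u₀ i with hW
  have hWle : ∀ i, norm2 (W i) ^ 2
      ≤ 486 * (gradSq (U₂ - u₂) + gradSq (U₁ - u₁) + gradSq (U₀ - u₀)) :=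
    norm2_fluxExt_sub_sq_le U₂ U₁ U₀ u₂ u₁ u₀
  have heq : bdfLin ε A d (U₃ - u₃) (U₂ - u₂) (U₁ - u₁) (U₀ - u₀) = τ + divN ρ - divN W := by
    rw [bdfLin_sub, hW, divN_sub, ← hU, eq_neg_of_add_eq_zero_left hu]
    module
  clear_value W
  set x₃ := U₃ - u₃
  set x₂ := U₂ - u₂
  set x₁ := U₁ - u₁
  set x₀ := U₀ - u₀
  have key := gNorm_sub_le_mul_ip_bdfLin (ε := ε) hA hd x₃ x₂ x₁ x₀
  set z := (2 : ℝ) • x₃ - x₂ with hz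
  rw [heq, ip_sub_left, ip_add_left, ip_divN, ip_divN] at key
  have t1 := (le_abs_self _).trans (abs_ip_le_half τ z)
  have t2 : -∑ i, ip (ρ i) (dN i z) ≤ (∑ i, norm2 (ρ i) ^ 2) / 2 + gradSq z / 2 := by
    rw [gradSq, Fin.sum_univ_two, Fin.sum_univ_two, Fin.sum_univ_two]
    have a := (neg_le_abs _).trans (abs_ip_le_half (ρ 0) (dN 0 z))
    have b := (neg_le_abs _).trans (abs_ip_le_half (ρ 1) (dN 1 z))
    linarith
  have t3 : ∑ i, ip (W i) (dN i z) ≤ 486 * (gradSq x₂ + gradSq x₁ + gradSq x₀) + gradSq z / 2 := by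
    have e : gradSq z = norm2 (dN 0 z) ^ 2 + norm2 (dN 1 z) ^ 2 := by rw [gradSq, Fin.sum_univ_two]
    rw [e, Fin.sum_univ_two]
    have a := (le_abs_self _).trans (abs_ip_le_half (W 0) (dN 0 z))
    have b := (le_abs_self _).trans (abs_ip_le_half (W 1) (dN 1 z))
    have := hWle 0
    have := hWle 1
    linarith
  have t4 := norm2_smul_sub_sq_le x₃ x₂
  have t5 := gradSq_smul_sub_le x₃ x₂
  rw [← hz] at t4 t5
  -- The coefficient of each `gradSq` is at most `488 = 486 + 2`, and `488/8000 < 1/16`. The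
  -- complementary factor `488 · 2000/ε²` is below `10⁶/ε²`.
  have hθ : 0 < ε ^ 2 / 8000 := by positivity
  have g3 := gradSq_le x₃ hθ
  have g2 := gradSq_le x₂ hθ
  have g1 := gradSq_le x₁ hθ
  have g0 := gradSq_le x₀ hθ
  have n3 := gradSq_nonneg x₃
  have n1 := gradSq_nonneg x₁
  have n2 := gradSq_nonneg x₂
  have n0 := gradSq_nonneg x₀
  have hdiv : ∀ y : ℝ, y / (4 * (ε ^ 2 / 8000)) = 10 ^ 6 / ε ^ 2 / 500 * y := fun y => by
    field_simp
    ring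
  rw [hdiv] at g3 g2 g1 g0
  set B := 10 ^ 6 / ε ^ 2 with hB
  have hB0 : 0 ≤ B := by positivity
  have E1 := le_energy (ε := ε) hA hd.le x₃ x₂ x₁
  have E0 := le_energy (ε := ε) hA hd.le x₂ x₁ x₀
  set a₃ := norm2 x₃ ^ 2 with ha₃
  set a₂ := norm2 x₂ ^ 2 with ha₂
  set a₁ := norm2 x₁ ^ 2 with ha₁
  set a₀ := norm2 x₀ ^ 2 with ha₀
  have p3 : 0 ≤ a₃ := sq_nonneg _
  have p2 : 0 ≤ a₂ := sq_nonneg _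
  have p1 : 0 ≤ a₁ := sq_nonneg _
  have p0 : 0 ≤ a₀ := sq_nonneg _
  have rhs : ip τ z + -∑ i, ip (ρ i) (dN i z) - -∑ i, ip (W i) (dN i z)
      ≤ r / 2 + (B + 4) * (a₃ + a₂ + a₁ + a₀) + ε ^ 2 / 16 * (norm2 (lapN x₃) ^ 2
        + norm2 (lapN x₂) ^ 2 + norm2 (lapN x₁) ^ 2 + norm2 (lapN x₀) ^ 2) := by
    linarith
  have hL : (B + 4) * (a₃ + a₂ + a₁ + a₀) ≤ 20 * (B + 4) * (energy ε A d x₃ x₂ x₁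
          + energy ε A d x₂ x₁ x₀) := by
    have : a₃ + a₂ + a₁ + a₀ ≤ 20 * (energy ε A d x₃ x₂ x₁ + energy ε A d x₂ x₁ x₀) := by linarith
    nlinarith [mul_le_mul_of_nonneg_left this (by linarith : 0 ≤ B + 4)]
  have fin := key.trans (mul_le_mul_of_nonneg_left
    (rhs.trans (add_le_add_left (add_le_add_right hL (r / 2)) _)) hd.le)
  have pb : 0 ≤ d * ε ^ 2 * norm2 (lapN x₃) ^ 2 := by positivity
  set E₁ := energy ε A d x₃ x₂ x₁ with hE₁
  set E₀ := energy ε A d x₂ x₁ x₀ with hE₀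
  have f1 : gNorm x₃ x₂ x₁ = E₁ - d * ε ^ 2 * (11 / 16 * norm2 (lapN x₃) ^ 2
    + 1 / 8 * norm2 (lapN x₂) ^ 2 + 1 / 16 * norm2 (lapN x₁) ^ 2)
    - A * d ^ 3 / 2 * norm2 (lapN x₃) ^ 2 := by rw [hE₁, energy]; ring
  have f0 : gNorm x₂ x₁ x₀ = E₀ - d * ε ^ 2 * (11 / 16 * norm2 (lapN x₂) ^ 2
    + 1 / 8 * norm2 (lapN x₁) ^ 2 + 1 / 16 * norm2 (lapN x₀) ^ 2)
    - A * d ^ 3 / 2 * norm2 (lapN x₂) ^ 2 := by rw [hE₀, energy]; ring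
  rw [f1, f0] at fin
  -- The weights `11/16, 1/8, 1/16` in `energy` are chosen so that the contributions of `x₂, x₁, x₀`
  -- cancel exactly; of the dissipation of `x₃` there remains `3/4`, more than the `1/2` claimed.
  linarith

/-! ### The discrete Gronwall inequality -/

lemma discrete_gronwall {y c : ℕ → ℝ} {q : ℝ} (hq : 0 ≤ q) (hc : ∀ n, 0 ≤ c n) {N : ℕ}
    (h : ∀ n < N, y (n + 1) ≤ (1 + q) * y n + c n) (n : ℕ) (hn : n ≤ N) :
    y n ≤ (1 + q) ^ n * (y 0 + ∑ j ∈ Finset.range n, c j) := by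
  induction n with
  | zero => simp
  | succ n ih =>
    have h1 := ih (by omega)
    have h2 := h n (by omega)
    rw [Finset.sum_range_succ]
    have h3 : 1 ≤ (1 + q) ^ (n + 1) := one_le_pow₀ (by linarith)
    have h4 := mul_le_mul_of_nonneg_left h1 (by linarith : 0 ≤ 1 + q)
    have h5 := mul_le_mul_of_nonneg_right h3 (hc n)
    calc _ ≤ (1 + q) * ((1 + q) ^ n * (y 0 + ∑ j ∈ Finset.range n, c j)) + c n := by linarith
      _ = (1 + q) ^ (n + 1) * (y 0 + ∑ j ∈ Finset.range n, c j) + 1 * c n := by ring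
      _ ≤ _ := by linarith

/-- For `q ≤ 1/2` one has `(1 + q)/(1 - q) ≤ 1 + 4q`, so the implicit term can be moved to the left.
The dissipation `g` is carried along in the sum `Y`. -/
lemma implicit_gronwall {y g c : ℕ → ℝ} {q : ℝ} (hq : 0 ≤ q) (hq' : q ≤ 1 / 2) (hy : ∀ n, 0 ≤ y n)
    (hg : ∀ n, 0 ≤ g n) (hc : ∀ n, 0 ≤ c n) {N : ℕ}
    (h : ∀ n < N, y (n + 1) + g n ≤ y n + (c n / 2 + q * (y (n + 1) + y n))) :
    y N + ∑ j ∈ Finset.range N, g j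
      ≤ Real.exp (4 * q * N) * (y 0 + ∑ j ∈ Finset.range N, c j) := by
  set Y : ℕ → ℝ := fun n => y n + ∑ j ∈ Finset.range n, g j with hY
  have h1 : ∀ n < N, Y (n + 1) ≤ (1 + 4 * q) * Y n + c n := by
    intro n hn
    have hS : 0 ≤ ∑ j ∈ Finset.range n, g j := Finset.sum_nonneg fun j _ => hg j
    have h2 := h n hn
    simp only [hY, Finset.sum_range_succ]
    set S := ∑ j ∈ Finset.range n, g j
    have h3 : (1 - q) * (y (n + 1) + g n) ≤ (1 + q) * y n + c n / 2 := by
      nlinarith [mul_nonneg hq (hg n)]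
    have h4 : (1 - q) * (y (n + 1) + g n) ≤ (1 - q) * ((1 + 4 * q) * y n + c n) := by
      nlinarith [mul_nonneg (mul_nonneg hq (by linarith : 0 ≤ 1 / 2 - q)) (hy n),
        mul_nonneg (by linarith : 0 ≤ 1 / 2 - q) (hc n)]
    have h5 := le_of_mul_le_mul_left h4 (by linarith)
    nlinarith [mul_nonneg hq hS]
  have h2 := discrete_gronwall (by linarith : 0 ≤ 4 * q) hc h1 N le_rfl
  have h3 : (1 + 4 * q) ^ N ≤ Real.exp (4 * q * N) := by
    rw [mul_comm (4 * q), Real.exp_nat_mul]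
    exact pow_le_pow_left₀ (by linarith) (by linarith [Real.add_one_le_exp (4 * q)]) N
  have h4 : 0 ≤ y 0 + ∑ j ∈ Finset.range N, c j :=
    add_nonneg (hy 0) (Finset.sum_nonneg fun j _ => hc j)
  have h5 : Y 0 = y 0 := by simp [hY]
  rw [h5] at h2
  exact h2.trans (mul_le_mul_of_nonneg_right h3 h4)

/-! ### Convergence -/

/-- The stencil intervals have length `3d` and advance by `d`, so each time is counted at most three
times. In terms of primitives the partial sums are bounded by three consecutive values of `P`. -/
lemma sum_integral_le {β : ℝ → ℝ} {a T t₀ d : ℝ} (h0 : ∀ t, 0 ≤ β t)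
    (hi : IntegrableOn β (Icc a T)) (hd : 0 ≤ d) (ha : a ≤ t₀) (M : ℕ) (hT : t₀ + (M + 2) * d ≤ T) :
    ∑ n ∈ Finset.range M, ∫ τ in (t₀ + n * d)..(t₀ + (n + 3) * d), β τ ≤ 3 * ∫ τ in a..T, β τ := by
  set P : ℕ → ℝ := fun j => ∫ τ in t₀..(t₀ + j * d), β τ with hP
  have hPle : ∀ j ≤ M + 2, P j ≤ ∫ τ in a..T, β τ := by
    intro j hj
    have hj' : (j : ℝ) ≤ M + 2 := by exact_mod_cast hj
    have : (j : ℝ) * d ≤ (M + 2) * d := mul_le_mul_of_nonneg_right hj' hd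
    exact intervalIntegral_nonneg_mono h0 hi le_rfl ha (by linarith [mul_nonneg j.cast_nonneg hd])
      (by linarith) le_rfl
  have hsum : ∀ n ≤ M, ∑ n ∈ Finset.range n, ∫ τ in (t₀ + n * d)..(t₀ + (n + 3) * d), β τ
      ≤ P n + P (n + 1) + P (n + 2) := by
    intro n
    induction n with
    | zero =>
      intro _
      have hP0 : ∀ j, 0 ≤ P j := fun j => intervalIntegral.integral_nonneg
        (by linarith [mul_nonneg j.cast_nonneg hd]) fun _ _ => h0 _
      simp only [Finset.range_zero, Finset.sum_empty]
      exact add_nonneg (add_nonneg (hP0 0) (hP0 1)) (hP0 2)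
    | succ n ih =>
      intro hn
      have hn' : (n : ℝ) + 1 ≤ M := by exact_mod_cast hn
      have hnd : ((n : ℝ) + 3) * d ≤ (M + 2) * d := mul_le_mul_of_nonneg_right (by linarith) hd
      have hnn : 0 ≤ (n : ℝ) * d := by positivity
      have e : (t₀ + ((n + 3 : ℕ) : ℝ) * d) = t₀ + (n + 3) * d := by push_cast; ring
      have h : P n + ∫ τ in (t₀ + n * d)..(t₀ + (n + 3) * d), β τ = P (n + 3) := by
        simp only [hP, e]
        refine intervalIntegral.integral_add_adjacent_intervals ?_ ?_ <;>
        · refine (hi.mono_set ?_).intervalIntegrable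
          rw [uIcc_of_le (by linarith)]
          exact Icc_subset_Icc (by linarith) (by linarith)
      rw [Finset.sum_range_succ]
      have := ih (by omega)
      have e2 : P (n + 1 + 2) = P (n + 3) := rfl
      have e3 : P (n + 1 + 1) = P (n + 2) := rfl
      rw [e2, e3]
      linarith
  have := hsum M le_rfl
  have := hPle M (by omega)
  have := hPle (M + 1) (by omega)
  have := hPle (M + 2) (by omega)
  linarith

/-- The stabilisation part is of higher order in `d`, hence controlled by the initial bound on `ε² d
‖Δ_N x‖²` at the price of `A/(2ε²)`. The value 31 is `3 · 10` from the G-norm plus 1 for the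
dissipation weights. -/
lemma energy_le {K : ℕ} {ε A d Q : ℝ} (hε : 0 < ε) (hA : 0 ≤ A) (hd : 0 < d) (hd1 : d ≤ 1)
    {x₃ x₂ x₁ : Grid K → ℝ} (a₃ : norm2 x₃ ^ 2 ≤ Q) (a₂ : norm2 x₂ ^ 2 ≤ Q) (a₁ : norm2 x₁ ^ 2 ≤ Q)
    (b₃ : ε ^ 2 * d * norm2 (lapN x₃) ^ 2 ≤ Q) (b₂ : ε ^ 2 * d * norm2 (lapN x₂) ^ 2 ≤ Q)
    (b₁ : ε ^ 2 * d * norm2 (lapN x₁) ^ 2 ≤ Q) :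
    energy ε A d x₃ x₂ x₁ ≤ (31 + A / (2 * ε ^ 2)) * Q := by
  have h := gNorm_le x₃ x₂ x₁
  have hQ : 0 ≤ Q := (sq_nonneg _).trans a₃
  have h1 : A * d ^ 3 / 2 * norm2 (lapN x₃) ^ 2 ≤ A / (2 * ε ^ 2) * Q := by
    calc _ = A / (2 * ε ^ 2) * (d ^ 2 * (ε ^ 2 * d * norm2 (lapN x₃) ^ 2)) := by field_simp
      _ ≤ A / (2 * ε ^ 2) * (1 * Q) := by
        gcongr
        exact pow_le_one₀ hd.le hd1
      _ = _ := by ring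
  rw [energy]
  linarith

/-- The levels are numbered by natural numbers from the start `t₀`, so that `e 0, e 1, e 2` are the
starting errors and Gronwall runs over the steps after them. -/
theorem ExactBounds.exists_error_bound {ε A a T M : ℝ} {m : ℕ} {u w : ℝ → C(Torus, ℝ)} {β : ℝ → ℝ}
    (hE : ExactBounds ε a T m u w M β) (hε : 0 < ε) (hA : 0 ≤ A) (haT : a < T) (C₀ : ℝ) :
    ∃ C δ, 0 ≤ C ∧ 0 < δ ∧ ∀ (K N : ℕ) (d t₀ : ℝ) (v e : ℕ → Grid K → ℝ), 0 < d → d ≤ δ → a ≤ t₀ →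
      t₀ + N * d ≤ T → (∀ j : ℕ, e j = gridTrig K (fCoeff (u (t₀ + j * d))) - v j) →
      (∀ n, bdfLin ε A d (v (n + 3)) (v (n + 2)) (v (n + 1)) (v n)
        + divN (fluxExt (v (n + 2)) (v (n + 1)) (v n)) = 0) →
      (∀ j ≤ 2, norm2 (e j) + √(ε ^ 2 * d * norm2 (lapN (e j)) ^ 2)
        ≤ C₀ * (d ^ 3 + meshSize K ^ m)) →
      norm2 (e N) ^ 2 + ε ^ 2 * d * ∑ i ∈ Finset.range (N + 1), norm2 (lapN (e i)) ^ 2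
        ≤ C * (d ^ 3 + meshSize K ^ m) ^ 2 := by
  obtain ⟨C₁, hC₁, H⟩ := hE.exists_consistency A
  set J := ∫ τ in a..T, β τ with hJ
  have hJ0 : 0 ≤ J := intervalIntegral.integral_nonneg haT.le fun _ _ => hE.weight_nonneg _
  set L := 20 * (10 ^ 6 / ε ^ 2 + 4) with hL
  have hL0 : 0 < L := by positivity
  set X := Real.exp (4 * L * (T - a)) with hX
  have hX0 : 0 < X := Real.exp_pos _
  have hTa : 0 < T - a := sub_pos.2 haT
  -- The factor 22 is 20 from `le_energy` plus 2 from the halved dissipation. The summand `4 C₀²`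
  -- covers the starting levels: 3 in the sum and 1 when the final level is itself one of them. The
  -- bound on the step is `d L ≤ 1/2`, as required by the Gronwall inequality.
  refine ⟨4 * C₀ ^ 2 + 22 * (X * ((31 + A / (2 * ε ^ 2)) * C₀ ^ 2 + C₁ * (T - a + 3 * J))),
    min 1 (1 / (2 * L)), by positivity, by positivity, ?_⟩
  intro K N d t₀ v e hd hdδ ht₀ hT he hv hstart
  have hd1 : d ≤ 1 := hdδ.trans (min_le_left _ _)
  have hdL : d * L ≤ 1 / 2 := by
    have := mul_le_mul_of_nonneg_right (hdδ.trans (min_le_right _ _)) hL0.le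
    refine this.trans (le_of_eq ?_)
    field_simp
  set Q := d ^ 3 + meshSize K ^ m with hQ
  have hh := meshSize_pos K
  have hQ0 : 0 ≤ Q := by positivity
  have hsa : ∀ j ≤ 2, norm2 (e j) ^ 2 ≤ C₀ ^ 2 * Q ^ 2 := fun j hj => by
    rw [← mul_pow]
    exact pow_le_pow_left₀ (norm2_nonneg _)
      (by linarith [hstart j hj, Real.sqrt_nonneg (ε ^ 2 * d * norm2 (lapN (e j)) ^ 2)]) 2
  have hsb : ∀ j ≤ 2, ε ^ 2 * d * norm2 (lapN (e j)) ^ 2 ≤ C₀ ^ 2 * Q ^ 2 := fun j hj => by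
    rw [← mul_pow]
    have h : √(ε ^ 2 * d * norm2 (lapN (e j)) ^ 2) ≤ C₀ * Q := by
      linarith [hstart j hj, norm2_nonneg (e j)]
    rw [← Real.sq_sqrt (by positivity : 0 ≤ ε ^ 2 * d * norm2 (lapN (e j)) ^ 2)]
    exact pow_le_pow_left₀ (Real.sqrt_nonneg _) h 2
  have hS3 : ε ^ 2 * d * ∑ i ∈ Finset.range 3, norm2 (lapN (e i)) ^ 2 ≤ 3 * (C₀ ^ 2 * Q ^ 2) := by
    simp only [Finset.sum_range_succ, Finset.range_zero, Finset.sum_empty]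
    linarith [hsb 0 (by omega), hsb 1 (by omega), hsb 2 (by omega)]
  have hrest : 0 ≤ 22 * (X * ((31 + A / (2 * ε ^ 2)) * C₀ ^ 2 + C₁ * (T - a + 3 * J))) * Q ^ 2 := by
    positivity
  -- Levels 0 and 1 are starting values, where nothing has to be propagated; for `N ≥ 2` the energy
  -- at level `N` is defined.
  rcases Nat.lt_or_ge N 2 with hN | hN
  · have h1 : ∑ i ∈ Finset.range (N + 1), norm2 (lapN (e i)) ^ 2
        ≤ ∑ i ∈ Finset.range 3, norm2 (lapN (e i)) ^ 2 :=
      Finset.sum_le_sum_of_subset_of_nonneg (Finset.range_mono (by omega)) fun _ _ _ => sq_nonneg _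
    have h2 := mul_le_mul_of_nonneg_left h1 (by positivity : 0 ≤ ε ^ 2 * d)
    linarith [hsa N (by omega)]
  obtain ⟨P, rfl⟩ : ∃ P, N = P + 2 := ⟨N - 2, by omega⟩
  have hT' : t₀ + (P + 2) * d ≤ T := by
    refine le_of_eq_of_le ?_ hT
    push_cast
    ring
  set I : ℕ → ℝ := fun n => ∫ τ in (t₀ + n * d)..(t₀ + (n + 3) * d), β τ with hI
  have hI0 : ∀ n, 0 ≤ I n := fun n => intervalIntegral.integral_nonneg (by linarith) fun _ _ =>
    hE.weight_nonneg _
  set r : ℕ → ℝ := fun n => C₁ * (meshSize K ^ (2 * m) + d ^ 6 + d ^ 5 * I n) with hr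
  have hr0 : ∀ n, 0 ≤ r n := fun n => by have := hI0 n; positivity
  have step : ∀ n < P, energy ε A d (e (n + 3)) (e (n + 2)) (e (n + 1))
      + d * ε ^ 2 / 2 * norm2 (lapN (e (n + 3))) ^ 2
      ≤ energy ε A d (e (n + 2)) (e (n + 1)) (e n) + (d * r n / 2 + d * L
        * (energy ε A d (e (n + 3)) (e (n + 2)) (e (n + 1))
          + energy ε A d (e (n + 2)) (e (n + 1)) (e n))) := by
    intro n hn
    have hn' : (n : ℝ) + 1 ≤ P := by exact_mod_cast hn
    have hnd : ((n : ℝ) + 3) * d ≤ (P + 2) * d := mul_le_mul_of_nonneg_right (by linarith) hd.le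
    have hnn : 0 ≤ (n : ℝ) * d := by positivity
    obtain ⟨τ, ρ, h1, h2⟩ := H K (t₀ + (n + 3) * d) d hd (by linarith) (by linarith)
    have e0 : t₀ + (n + 3) * d - 3 * d = t₀ + (n : ℝ) * d := by ring
    have e1 : t₀ + (n + 3) * d - 2 * d = t₀ + ((n + 1 : ℕ) : ℝ) * d := by push_cast; ring
    have e2 : t₀ + (n + 3) * d - d = t₀ + ((n + 2 : ℕ) : ℝ) * d := by push_cast; ring
    have e3 : t₀ + ((n : ℝ) + 3) * d = t₀ + ((n + 3 : ℕ) : ℝ) * d := by push_cast; ring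
    rw [e0] at h2
    rw [e0, e1, e2, e3] at h1
    have h := energy_step hε hA hd h1 (hv n) h2
    simp only [← he] at h
    refine h.trans (le_of_eq ?_)
    simp only [hr, hI, hL]
    ring
  have gron := implicit_gronwall (y := fun n => energy ε A d (e (n + 2)) (e (n + 1)) (e n))
    (g := fun n => d * ε ^ 2 / 2 * norm2 (lapN (e (n + 3))) ^ 2) (c := fun n => d * r n)
    (by positivity) hdL (fun n => by
      have := le_energy (ε := ε) hA hd.le (e (n + 2)) (e (n + 1)) (e n)
      nlinarith [sq_nonneg (norm2 (e (n + 2))), sq_nonneg (norm2 (e (n + 1))), sq_nonneg (norm2 (e n))])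
    (fun n => by positivity) (fun n => mul_nonneg hd.le (hr0 n)) (N := P) step
  have hexp : Real.exp (4 * (d * L) * P) ≤ X := by
    refine Real.exp_le_exp.2 ?_
    have : (P : ℝ) * d ≤ T - a := by linarith
    nlinarith [mul_le_mul_of_nonneg_left this hL0.le]
  have hy0 := energy_le hε hA hd hd1 (hsa 2 le_rfl) (hsa 1 (by omega)) (hsa 0 (by omega))
    (hsb 2 le_rfl) (hsb 1 (by omega)) (hsb 0 (by omega))
  have hQ2 : meshSize K ^ (2 * m) + d ^ 6 ≤ Q ^ 2 := by
    have : Q ^ 2 = meshSize K ^ (2 * m) + d ^ 6 + 2 * (d ^ 3 * meshSize K ^ m) := by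
      rw [hQ]; ring
    have : 0 ≤ d ^ 3 * meshSize K ^ m := by positivity
    linarith
  -- The terms constant in `n` add up to the length of the time interval; the factor `d` raises `d⁵
  -- I n` to `d⁶ I n`, whose integrals overlap at most three times.
  have hc : ∑ n ∈ Finset.range P, d * r n ≤ C₁ * (T - a + 3 * J) * Q ^ 2 := by
    have hsum := sum_integral_le hE.weight_nonneg hE.weight_integrable hd.le ht₀ P hT'
    have h1 : ∑ n ∈ Finset.range P, d * r n
        = C₁ * ((P * d) * (meshSize K ^ (2 * m) + d ^ 6) + d ^ 6 * ∑ n ∈ Finset.range P, I n) := by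
      simp only [hr, ← Finset.mul_sum, Finset.sum_add_distrib, Finset.sum_const, Finset.card_range,
        nsmul_eq_mul]
      ring
    have h2 : (P : ℝ) * d ≤ T - a := by linarith
    have h3 : d ^ 6 ≤ Q ^ 2 := by
      have : 0 ≤ meshSize K ^ (2 * m) := by positivity
      linarith
    rw [h1, mul_assoc C₁]
    refine mul_le_mul_of_nonneg_left ?_ hC₁
    have k1 : (P : ℝ) * d * (meshSize K ^ (2 * m) + d ^ 6) ≤ (T - a) * Q ^ 2 :=
      mul_le_mul h2 hQ2 (by positivity) hTa.le
    have k2 : d ^ 6 * ∑ n ∈ Finset.range P, I n ≤ Q ^ 2 * (3 * J) :=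
      mul_le_mul h3 hsum (Finset.sum_nonneg fun n _ => hI0 n) (sq_nonneg _)
    linarith
  set Z := X * ((31 + A / (2 * ε ^ 2)) * C₀ ^ 2 + C₁ * (T - a + 3 * J)) with hZ
  have hfin : energy ε A d (e (P + 2)) (e (P + 1)) (e P)
      + ∑ n ∈ Finset.range P, d * ε ^ 2 / 2 * norm2 (lapN (e (n + 3))) ^ 2 ≤ Z * Q ^ 2 := by
    refine gron.trans ?_
    have hnn : 0 ≤ (31 + A / (2 * ε ^ 2)) * (C₀ ^ 2 * Q ^ 2) + C₁ * (T - a + 3 * J) * Q ^ 2 := by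
      positivity
    calc _ ≤ Real.exp (4 * (d * L) * P) * ((31 + A / (2 * ε ^ 2)) * (C₀ ^ 2 * Q ^ 2)
          + C₁ * (T - a + 3 * J) * Q ^ 2) := by
          refine mul_le_mul_of_nonneg_left ?_ (Real.exp_pos _).le
          exact add_le_add hy0 hc
      _ ≤ X * ((31 + A / (2 * ε ^ 2)) * (C₀ ^ 2 * Q ^ 2) + C₁ * (T - a + 3 * J) * Q ^ 2) :=
          mul_le_mul_of_nonneg_right hexp hnn
      _ = _ := by rw [hZ]; ring
  have hsplit : ∑ i ∈ Finset.range (P + 2 + 1), norm2 (lapN (e i)) ^ 2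
      = ∑ i ∈ Finset.range 3, norm2 (lapN (e i)) ^ 2
        + ∑ n ∈ Finset.range P, norm2 (lapN (e (n + 3))) ^ 2 := by
    rw [show P + 2 + 1 = 3 + P by ring, Finset.sum_range_add]
    simp only [add_comm 3]
  have hle := le_energy (ε := ε) hA hd.le (e (P + 2)) (e (P + 1)) (e P)
  have hg : ∑ n ∈ Finset.range P, d * ε ^ 2 / 2 * norm2 (lapN (e (n + 3))) ^ 2
      = ε ^ 2 * d * (∑ n ∈ Finset.range P, norm2 (lapN (e (n + 3))) ^ 2) / 2 := by
    rw [← Finset.mul_sum]; ring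
  rw [hg] at hfin
  have hg0 : 0 ≤ ε ^ 2 * d * ∑ n ∈ Finset.range P, norm2 (lapN (e (n + 3))) ^ 2 :=
    mul_nonneg (by positivity) (Finset.sum_nonneg fun _ _ => sq_nonneg _)
  rw [hsplit, mul_add]
  have q1 := sq_nonneg (norm2 (e (P + 1)))
  have q0 := sq_nonneg (norm2 (e P))
  have q2 := sq_nonneg (norm2 (e (P + 2)))
  have q3 : 0 ≤ C₀ ^ 2 * Q ^ 2 := by positivity
  linarith

end NSS

end

/-! ### The convergence theorem. -/

theorem mainTheorem3 (ε A a T : ℝ) (hε : 0 < ε) (hA : 0 ≤ A) (ha : a ≤ 0) (hT : 0 < T) (m : ℕ)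
    (ue : ℝ → C(NSS.Torus, ℝ)) (hreg : NSS.RegularityClass m a T ue)
    (hsol : NSS.SolvesNSS ε a T ue) (s : ℤ) (hs : s ≤ 0) (C₀ : ℝ) :
    ∃ C > 0, ∃ δ > 0, ∃ h₀ > 0, ∀ (dt : ℝ) (K : ℕ), 0 < dt → dt ≤ δ → NSS.meshSize K ≤ h₀ →
      a ≤ s * dt →
      ∀ u : ℤ → NSS.Grid K → ℝ,
        (∀ n ≥ s + 2, NSS.BDF3Step ε A dt u n) →
        (∀ j ∈ Finset.Icc s (s + 2),
          NSS.norm2 (NSS.err ue dt u j)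
              + √(ε ^ 2 * dt * NSS.norm2 (NSS.lapN (NSS.err ue dt u j)) ^ 2)
            ≤ C₀ * (dt ^ 3 + NSS.meshSize K ^ m)) →
        ∀ l : ℕ, 1 ≤ l → dt * l ≤ T →
          NSS.norm2 (NSS.err ue dt u l)
              + √(ε ^ 2 * dt *
                  ∑ j ∈ Finset.Icc 1 l, NSS.norm2 (NSS.lapN (NSS.err ue dt u j)) ^ 2)
            ≤ C * (dt ^ 3 + NSS.meshSize K ^ m) := by
  obtain ⟨w, M, β, hE⟩ := hreg.exists_exactBounds hsol (ha.trans_lt hT)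
  obtain ⟨C, δ, hC, hδ, H⟩ := hE.exists_error_bound hε hA (ha.trans_lt hT) C₀
  -- Each of the two terms on the left is at most `√C Q`; the summand 1 only makes the constant
  -- positive. The mesh size never exceeds 1, so `h₀ = 1` is no restriction.
  refine ⟨2 * √C + 1, by positivity, δ, hδ, 1, one_pos, ?_⟩
  intro dt K hdt hdtδ _ has u hu hstart l _ hl
  -- Levels are renumbered from the first one: level `l` becomes `l + σ`, at time `-σ dt + (l + σ)
  -- dt = l dt ≤ T`.
  obtain ⟨σ, rfl⟩ : ∃ σ : ℕ, s = -(σ : ℤ) := ⟨(-s).toNat, by omega⟩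
  set e : ℕ → NSS.Grid K → ℝ := fun i => NSS.err ue dt u (-(σ : ℤ) + i) with he
  have hel : ∀ j : ℕ, NSS.err ue dt u (j : ℤ) = e (j + σ) := fun j => by
    simp only [he]
    congr 1
    push_cast
    ring
  have key := H K (l + σ) dt ((-(σ : ℤ) : ℤ) * dt) (fun i => u (-(σ : ℤ) + i)) e hdt hdtδ has
    (by push_cast; linarith) (fun j => by
      have : (((-(σ : ℤ) : ℤ) : ℝ) * dt + j * dt) = ((-(σ : ℤ) + j : ℤ) : ℝ) * dt := by
        push_cast; ring
      rw [this]
      rfl)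
    (fun n => by
      have h := (hu (-(σ : ℤ) + (n + 2 : ℕ)) (by omega)).eq_zero
      have i₃ : -(σ : ℤ) + (n + 2 : ℕ) + 1 = -(σ : ℤ) + (n + 3 : ℕ) := by omega
      have i₁ : -(σ : ℤ) + (n + 2 : ℕ) - 1 = -(σ : ℤ) + (n + 1 : ℕ) := by omega
      have i₀ : -(σ : ℤ) + (n + 2 : ℕ) - 2 = -(σ : ℤ) + n := by omega
      rwa [i₃, i₁, i₀] at h)
    (fun j hj => hstart _ (by simp only [Finset.mem_Icc]; omega))
  set Q := dt ^ 3 + NSS.meshSize K ^ m with hQ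
  have hQ0 : 0 ≤ Q := by
    have := NSS.meshSize_pos K
    positivity
  -- The sum over the levels `1, …, l` is part of the shifted sum, which also contains the levels up
  -- to 0.
  have hsum : ∑ j ∈ Finset.Icc 1 l, NSS.norm2 (NSS.lapN (NSS.err ue dt u j)) ^ 2
      ≤ ∑ i ∈ Finset.range (l + σ + 1), NSS.norm2 (NSS.lapN (e i)) ^ 2 := by
    simp only [hel]
    have hmap := Finset.sum_map (Finset.Icc 1 l) (addRightEmbedding σ)
      fun i => NSS.norm2 (NSS.lapN (e i)) ^ 2
    simp only [addRightEmbedding_apply] at hmap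
    rw [← hmap]
    refine Finset.sum_le_sum_of_subset_of_nonneg ?_ fun _ _ _ => sq_nonneg _
    intro i hi
    simp only [Finset.mem_map, Finset.mem_Icc, addRightEmbedding_apply] at hi
    obtain ⟨j, hj, rfl⟩ := hi
    simp only [Finset.mem_range]
    omega
  have hroot : (√C * Q) ^ 2 = C * Q ^ 2 := by rw [mul_pow, Real.sq_sqrt hC]
  have hε2 : 0 ≤ ε ^ 2 * dt := by positivity
  have hsum' := mul_le_mul_of_nonneg_left hsum hε2
  have h0 : 0 ≤ ε ^ 2 * dt * ∑ j ∈ Finset.Icc 1 l, NSS.norm2 (NSS.lapN (NSS.err ue dt u j)) ^ 2 :=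
    mul_nonneg hε2 (Finset.sum_nonneg fun _ _ => sq_nonneg _)
  have h1 : NSS.norm2 (NSS.err ue dt u l) ≤ √C * Q := by
    refine le_of_sq_le_sq ?_ (by positivity)
    rw [hel l, hroot]
    linarith
  have h2 : √(ε ^ 2 * dt * ∑ j ∈ Finset.Icc 1 l, NSS.norm2 (NSS.lapN (NSS.err ue dt u j)) ^ 2)
      ≤ √C * Q := by
    refine Real.sqrt_le_iff.2 ⟨by positivity, ?_⟩
    rw [hroot]
    linarith [sq_nonneg (NSS.norm2 (e (l + σ)))]
  linarith
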